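/- **Setting.** Let $G$ be a connected real Lie group whose Lie algebra $\mathfrak g$ is simple and noncompact, let $\theta$ be a Cartan involution of $\mathfrak g$ with Cartan decomposition $\mathfrak g=\mathfrak k\oplus\mathfrak p$, and let $\mathfrak a\subset\mathfrak p$ be a maximal abelian subspace with restricted root system $\Sigma=\Sigma(\mathfrak g,\mathfrak a)$ and root spaces $\mathfrak g^\alpha$. Let $\iota:G\to G_{\mathbb C}$ be a smooth homomorphism into a connected complex Lie group such that $d\iota$ identifies $\operatorname{Lie}(G_{\mathbb C})$ with $\mathfrak g_{\mathbb C}=\mathfrak g\oplus i\mathfrak g$ (for example the universal complexification of $G$), let $K_{\mathbb C}\subset G_{\mathbb C}$ be the analytic subgroup with Lie algebra $\mathfrak k_{\mathbb C}$, and let $x_0=eK_{\mathbb C}\in X_{\mathbb C}=G_{\mathbb C}/K_{\mathbb C}$. The group $G$ acts on $X_{\mathbb C}$ through $\iota$. Put $$\Omega=\{Y\in\mathfrak a\mid \operatorname{spec}(\operatorname{ad}Y)\subset\,]-1,1[\,\},\qquad \Xi=G\exp(i\pi\Omega/2).x_0\subset X_{\mathbb C}$$ (the complex crown). **Part A.**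 Assume that $\Sigma$ is of type $C_n$ or $BC_n$ with $n\ge 1$ (the root systems occurring when $\Xi$ is a Hermitian symmetric space for an overgroup of $G$; $C_1=A_1$), that is, there is a basis $\gamma_1,\dots,\gamma_n$ of $\mathfrak a^*$ with $$\Sigma=\{\pm\gamma_i\pm\gamma_j\mid 1\le i,j\le n\}\setminus\{0\}\quad\text{or}\quad \Sigma=\big(\{\pm\gamma_i\pm\gamma_j\mid 1\le i,j\le n\}\setminus\{0\}\big)\cup\{\pm\gamma_i\mid 1\le i\le n\}.$$ Let $T_j\in\mathfrak a$ be given by $\gamma_i(T_j)=\delta_{ij}$. Call $E\in\mathfrak g^{2\gamma_j}$ normalized if $[T_j,E]=2E$, $[T_j,\theta E]=-2\theta E$ and $[E,\theta E]=-T_j$. Let $$\Lambda^{++}=\Big\{\sum_{j=1}^n y_jE_j\ \Big|\ E_j\in\mathfrak g^{2\gamma_j}\text{ normalized},\ y_j\in\mathbb R,\ |y_j|<1\Big\},\qquad \Lambda^+=\operatorname{Ad}(K(0))\Lambda^{++},$$ where $K(0)=\exp(\mathfrak k\cap\mathfrak g(0))$, $\mathfrak g(0)=\mathfrak a\oplus\mathfrak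 m\oplus\bigoplus_{i\ne j}\mathfrak g^{\gamma_i-\gamma_j}$ and $\mathfrak m$ is the centralizer of $\mathfrak a$ in $\mathfrak k$. Then: 1. If $\sum_j t_jT_j\in\frac{\pi}{2}\Omega$ and $E_j\in\mathfrak g^{2\gamma_j}$ is normalized for each $j$, then $$G\exp\Big(i\sum_{j=1}^n\sin(2t_j)E_j\Big).x_0=G\exp\Big(i\sum_{j=1}^n t_jT_j\Big).x_0 .$$ 2. $\Xi=G\exp(i\Lambda^+).x_0=G\exp(i\Lambda^{++}).x_0$. **Part B.** Let $n\ge1$, $G=\mathrm{Sp}(n,\mathbb R)\subset G_{\mathbb C}=\mathrm{Sp}(n,\mathbb C)$ with $\mathfrak k=\mathfrak{sp}(n,\mathbb R)\cap\mathfrak{so}(2n)$ and $\mathfrak a=\{\operatorname{diag}(t_1,\dots,t_n,-t_1,\dots,-t_n)\}$, and define $K_{\mathbb C},x_0,\Omega,\Xi$ as above. Let $$\mathfrak n=\Big\{\begin{pmatrix}Y&Z\\0&-Y^T\end{pmatrix}\Big|\ Y\text{ strictly upper triangular},\ Z\in\mathrm{Sym}(n,\mathbb R)\Big\},\quad \mathfrak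 n^+=\Big\{\begin{pmatrix}0&Z\\0&0\end{pmatrix}\Big|\ Z\in\mathrm{Sym}(n,\mathbb R)\Big\},$$ let $\Lambda$ (resp. $\Lambda^+$) be the connected component containing $0$ of the set of $Y\in\mathfrak n$ (resp. $Y\in\mathfrak n^+$) with $\exp(iY).x_0\in\Xi$, and let $\Lambda^{++}$ be the set of the elements $\begin{pmatrix}0&D\\0&0\end{pmatrix}\in\Lambda$ with $D$ diagonal. Then: 1. $\Lambda^+=\Big\{\begin{pmatrix}0&Z\\0&0\end{pmatrix}\in\mathfrak n^+\ \Big|\ \|Z\|<1\Big\}$, where $\|\cdot\|$ is the operator norm for the Euclidean norm on $\mathbb R^n$. 2. $\Lambda^{++}=\Big\{\begin{pmatrix}0&\operatorname{diag}(t_1,\dots,t_n)\\0&0\end{pmatrix}\Big|\ |t_i|<1\text{ for all }i\Big\}$, and $\Lambda^+=\operatorname{Ad}(K_0)\Lambda^{++}$ with $K_0=\mathrm{SO}(n,\mathbb R)$ embedded by $k\mapsto\begin{pmatrix}k&0\\0&k\end{pmatrix}$. 3. $\Xi=G\exp(i\Lambda^+).x_0=G\exp(i\Lambda^{++}).x_0$.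 -/

import Mathlib

open scoped Manifold ContDiff Matrix Pointwise

noncomputable section

namespace CrownDomain

/-! ### Structure theory of a real Lie algebra with a Cartan involution -/

section LieAlg

variable {𝔤 : Type*} [LieRing 𝔤] [LieAlgebra ℝ 𝔤]

/-- A Cartan involution: an involutive automorphism `θ` such that `-B(X, θ X) > 0` for `X ≠ 0`,
where `B` is the Killing form. -/
structure IsCartanInvolution (θ : 𝔤 →ₗ⁅ℝ⁆ 𝔤) : Prop where
  involutive : ∀ X, θ (θ X) = X
  killing_neg : ∀ X, X ≠ 0 → killingForm ℝ 𝔤 X (θ X) < 0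

/-- The maximal compact subalgebra `𝔨`, the `+1`-eigenspace of `θ`. -/
def partK (θ : 𝔤 →ₗ⁅ℝ⁆ 𝔤) : Submodule ℝ 𝔤 :=
  Module.End.eigenspace (θ : 𝔤 →ₗ[ℝ] 𝔤) 1

/-- The complement `𝔭`, the `-1`-eigenspace of `θ`. -/
def partP (θ : 𝔤 →ₗ⁅ℝ⁆ 𝔤) : Submodule ℝ 𝔤 :=
  Module.End.eigenspace (θ : 𝔤 →ₗ[ℝ] 𝔤) (-1)

/-- `𝔞` is a maximal abelian subspace of `𝔭`. -/
structure IsMaximalFlat (θ : 𝔤 →ₗ⁅ℝ⁆ 𝔤) (𝔞 : Submodule ℝ 𝔤) : Prop where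
  le_partP : 𝔞 ≤ partP θ
  abelian : ∀ X ∈ 𝔞, ∀ Y ∈ 𝔞, ⁅X, Y⁆ = 0
  maximal : ∀ 𝔟 : Submodule ℝ 𝔤, 𝔟 ≤ partP θ → (∀ X ∈ 𝔟, ∀ Y ∈ 𝔟, ⁅X, Y⁆ = 0) →
    𝔞 ≤ 𝔟 → 𝔟 = 𝔞

/-- The simultaneous eigenspace `𝔤^α = {X | [H, X] = α(H) X for all H ∈ 𝔞}`. -/
def rootSpace (𝔞 : Submodule ℝ 𝔤) (α : Module.Dual ℝ 𝔞) : Submodule ℝ 𝔤 where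
  carrier := {X | ∀ H : 𝔞, ⁅(H : 𝔤), X⁆ = α H • X}
  add_mem' := by
    intro X Y hX hY H
    rw [lie_add, hX H, hY H, smul_add]
  zero_mem' := by
    intro H
    rw [lie_zero, smul_zero]
  smul_mem' := by
    intro c X hX H
    rw [lie_smul, hX H, smul_comm]

/-- The restricted root system `Σ = Σ(𝔤, 𝔞)`. -/
def restrictedRoots (𝔞 : Submodule ℝ 𝔤) : Set (Module.Dual ℝ 𝔞) :=
  {α | α ≠ 0 ∧ rootSpace 𝔞 α ≠ ⊥}

/-- The polyhedron `Ω = {Y ∈ 𝔞 | spec (ad Y) ⊆ ]-1, 1[}`. -/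
def Omega (𝔞 : Set 𝔤) : Set 𝔤 :=
  {Y | Y ∈ 𝔞 ∧ spectrum ℝ (LieAlgebra.ad ℝ 𝔤 Y) ⊆ Set.Ioo (-1) 1}

/-- `{±γ_i ± γ_j | 1 ≤ i, j ≤ n} \ {0}`: the root system of type `C_n` if the `γ_i` are linearly
independent. -/
def typeC {V : Type*} [AddCommGroup V] {n : ℕ} (γ : Fin n → V) : Set V :=
  {α | α ≠ 0 ∧ ∃ i j, α = γ i + γ j ∨ α = γ i - γ j ∨ α = -γ i + γ j ∨ α = -γ i - γ j}

/-- `({±γ_i ± γ_j | 1 ≤ i, j ≤ n} \ {0}) ∪ {±γ_i | 1 ≤ i ≤ n}`: the root system of type `BC_n` if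
the `γ_i` are linearly independent. -/
def typeBC {V : Type*} [AddCommGroup V] {n : ℕ} (γ : Fin n → V) : Set V :=
  typeC γ ∪ {α | ∃ i, α = γ i ∨ α = -γ i}

/-- `E ∈ 𝔤^{2γ_j}` is normalized if `T_j, E, θ(E)` span a standard `𝔰𝔩(2)`:
`[T_j, E] = 2E`, `[T_j, θ E] = -2 θ E`, `[E, θ E] = -T_j` (as for `diag(1, -1)`, `E₁₂` and
`θ(E₁₂) = -E₂₁` in `𝔰𝔩(2, ℝ)`). -/
def IsNormalized (θ : 𝔤 →ₗ⁅ℝ⁆ 𝔤) {𝔞 : Submodule ℝ 𝔤} {n : ℕ} (γ : Fin n → Module.Dual ℝ 𝔞)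
    (T : Fin n → 𝔞) (j : Fin n) (E : 𝔤) : Prop :=
  E ∈ rootSpace 𝔞 ((2 : ℝ) • γ j) ∧ IsSl2Triple (T j : 𝔤) E (-θ E)

/-- `Λ⁺⁺ = {∑ y_j E_j | |y_j| < 1}`, with normalized `E_j ∈ 𝔤^{2γ_j}`. -/
def LambdaPP (θ : 𝔤 →ₗ⁅ℝ⁆ 𝔤) {𝔞 : Submodule ℝ 𝔤} {n : ℕ} (γ : Fin n → Module.Dual ℝ 𝔞)
    (T : Fin n → 𝔞) : Set 𝔤 :=
  {Y | ∃ (y : Fin n → ℝ) (E : Fin n → 𝔤), (∀ j, IsNormalized θ γ T j (E j)) ∧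
    (∀ j, |y j| < 1) ∧ Y = ∑ j, y j • E j}

/-- The centralizer `𝔪` of `𝔞` in `𝔨`. -/
def partM (θ : 𝔤 →ₗ⁅ℝ⁆ 𝔤) (𝔞 : Submodule ℝ 𝔤) : Submodule ℝ 𝔤 :=
  partK θ ⊓ rootSpace 𝔞 0

/-- `𝔤(0) = 𝔞 ⊕ 𝔪 ⊕ ⨁_{i ≠ j} 𝔤^{γ_i - γ_j}`. -/
def partZero (θ : 𝔤 →ₗ⁅ℝ⁆ 𝔤) {𝔞 : Submodule ℝ 𝔤} {n : ℕ} (γ : Fin n → Module.Dual ℝ 𝔞) :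
    Submodule ℝ 𝔤 :=
  𝔞 ⊔ partM θ 𝔞 ⊔ ⨆ (i : Fin n) (j : Fin n) (_ : i ≠ j), rootSpace 𝔞 (γ i - γ j)

end LieAlg

/-- Smooth real Lie groups have the smoothness under which the Lie bracket on the tangent space at
`1` is defined. -/
instance instLEInftyMinSmoothness : ENat.LEInfty (minSmoothness ℝ 3) :=
  ⟨by
    rw [minSmoothness_of_isRCLikeNormedField]
    exact ENat.LEInfty.out⟩

/-! ### Exponential map and adjoint representation of a real Lie group -/

section LieGrp

variable {E : Type*} [NormedAddCommGroup E] [NormedSpace ℝ E]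
  {G : Type*} [TopologicalSpace G] [ChartedSpace E G] [Group G]

/-- `φ : ℝ → G` is the smooth one-parameter subgroup with initial velocity `X`. -/
structure IsOneParameterSubgroup (X : GroupLieAlgebra 𝓘(ℝ, E) G) (φ : ℝ → G) : Prop where
  contMDiff : ContMDiff 𝓘(ℝ, ℝ) 𝓘(ℝ, E) ∞ φ
  map_add : ∀ s t, φ (s + t) = φ s * φ t
  velocity : mfderiv 𝓘(ℝ, ℝ) 𝓘(ℝ, E) φ 0 (1 : ℝ) = X

open Classical in
/-- The exponential map `exp X = φ_X(1)`, where `φ_X` is the one-parameter subgroup with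
initial velocity `X`. -/
def lieExp (X : GroupLieAlgebra 𝓘(ℝ, E) G) : G :=
  if h : ∃ φ : ℝ → G, IsOneParameterSubgroup X φ then h.choose 1 else 1

/-- `Ad(g)`, the derivative at `1` of the conjugation `x ↦ g x g⁻¹`. -/
def Ad (g : G) (X : GroupLieAlgebra 𝓘(ℝ, E) G) : GroupLieAlgebra 𝓘(ℝ, E) G :=
  mfderiv 𝓘(ℝ, E) 𝓘(ℝ, E) (fun x : G => g * x * g⁻¹) 1 X

end LieGrp

/-! ### Complexifications and crowns -/

section Crown

variable {E : Type*} [NormedAddCommGroup E] [NormedSpace ℝ E]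
  {G : Type*} [TopologicalSpace G] [ChartedSpace E G] [Group G]
  {F : Type*} [NormedAddCommGroup F] [NormedSpace ℂ F]
  {GC : Type*} [TopologicalSpace GC] [ChartedSpace F GC] [Group GC]

/-- The derivative `dι : 𝔤 → Lie(G_ℂ)` of `ι : G → G_ℂ` at `1`. -/
def dLie (ι : G →* GC) (X : GroupLieAlgebra 𝓘(ℝ, E) G) : GroupLieAlgebra 𝓘(ℂ, F) GC :=
  mfderiv 𝓘(ℝ, E) 𝓘(ℝ, F) ι 1 X

/-- The exponential map of a complex Lie group is that of the underlying real Lie group. -/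
def complexExp (Z : GroupLieAlgebra 𝓘(ℂ, F) GC) : GC :=
  lieExp (E := F) Z

/-- `ι : G → G_ℂ` is a smooth homomorphism into a complex Lie group sitting over the inclusion of
`𝔤` into its complexification: every element of `Lie(G_ℂ)` is `dι(X) + i dι(Y)` for exactly one
pair `(X, Y)`. For semisimple `G` the universal complexification has this property. -/
structure IsComplexification (ι : G →* GC) : Prop where
  contMDiff : ContMDiff 𝓘(ℝ, E) 𝓘(ℝ, F) ∞ ι
  bijective : Function.Bijective
    (fun p : GroupLieAlgebra 𝓘(ℝ, E) G × GroupLieAlgebra 𝓘(ℝ, E) G =>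
      (dLie ι p.1 + Complex.I • dLie ι p.2 : GroupLieAlgebra 𝓘(ℂ, F) GC))

variable [CompleteSpace E] [LieGroup 𝓘(ℝ, E) ∞ G]

/-- `K_ℂ`, the analytic subgroup of `G_ℂ` with Lie algebra `𝔨_ℂ`, i.e. the subgroup generated by
`exp(𝔨_ℂ)`. -/
def KC (ι : G →* GC)
    (θ : GroupLieAlgebra 𝓘(ℝ, E) G →ₗ⁅ℝ⁆ GroupLieAlgebra 𝓘(ℝ, E) G) : Subgroup GC :=
  Subgroup.closure
    {x | ∃ X ∈ partK θ, ∃ Y ∈ partK θ, x = complexExp (F := F) (dLie ι X + Complex.I • dLie ι Y)}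

/-- The subset `G exp(iS).x₀` of `X_ℂ = G_ℂ / K_ℂ`, for `S ⊆ 𝔤`; here `x₀ = e K_ℂ`. -/
def orbitExp (ι : G →* GC)
    (θ : GroupLieAlgebra 𝓘(ℝ, E) G →ₗ⁅ℝ⁆ GroupLieAlgebra 𝓘(ℝ, E) G)
    (S : Set (GroupLieAlgebra 𝓘(ℝ, E) G)) : Set (GC ⧸ KC (F := F) ι θ) :=
  {x | ∃ g : G, ∃ Y ∈ S,
    x = (QuotientGroup.mk (ι g * complexExp (F := F) (Complex.I • dLie ι Y)) : GC ⧸ KC (F := F) ι θ)}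

/-- The complex crown `Ξ = G exp(iπΩ/2).x₀`. -/
def crown (ι : G →* GC)
    (θ : GroupLieAlgebra 𝓘(ℝ, E) G →ₗ⁅ℝ⁆ GroupLieAlgebra 𝓘(ℝ, E) G)
    (𝔞 : Submodule ℝ (GroupLieAlgebra 𝓘(ℝ, E) G)) : Set (GC ⧸ KC (F := F) ι θ) :=
  orbitExp (F := F) ι θ ((Real.pi / 2) • Omega (𝔞 : Set (GroupLieAlgebra 𝓘(ℝ, E) G)))

/-- `K(0) = exp(𝔨(0))` with `𝔨(0) = 𝔤(0) ∩ 𝔨`. -/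
def KZero (θ : GroupLieAlgebra 𝓘(ℝ, E) G →ₗ⁅ℝ⁆ GroupLieAlgebra 𝓘(ℝ, E) G)
    {𝔞 : Submodule ℝ (GroupLieAlgebra 𝓘(ℝ, E) G)} {n : ℕ}
    (γ : Fin n → Module.Dual ℝ 𝔞) : Set G :=
  {k | ∃ X ∈ partZero θ γ ⊓ partK θ, k = lieExp X}

/-- `Λ⁺ = Ad(K(0)) Λ⁺⁺`. -/
def LambdaP (θ : GroupLieAlgebra 𝓘(ℝ, E) G →ₗ⁅ℝ⁆ GroupLieAlgebra 𝓘(ℝ, E) G)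
    {𝔞 : Submodule ℝ (GroupLieAlgebra 𝓘(ℝ, E) G)} {n : ℕ}
    (γ : Fin n → Module.Dual ℝ 𝔞) (T : Fin n → 𝔞) : Set (GroupLieAlgebra 𝓘(ℝ, E) G) :=
  {Z | ∃ k ∈ KZero θ γ, ∃ Y ∈ LambdaPP θ γ T, Z = Ad k Y}

end Crown

/-! ### The symplectic group -/

namespace Sp

variable (n : ℕ)

/-- `G = Sp(n, ℝ)`. -/
abbrev G : Type := Matrix.symplecticGroup (Fin n) ℝ

/-- `G_ℂ = Sp(n, ℂ)`. -/
abbrev GC : Type := Matrix.symplecticGroup (Fin n) ℂ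

/-- `𝔤 = 𝔰𝔭(n, ℝ)`. -/
abbrev LieG : Type := LieAlgebra.Symplectic.sp (Fin n) ℝ

/-- The inclusion of real matrices into complex matrices. -/
def toC {n : ℕ} (A : Matrix (Fin n ⊕ Fin n) (Fin n ⊕ Fin n) ℝ) :
    Matrix (Fin n ⊕ Fin n) (Fin n ⊕ Fin n) ℂ :=
  A.map Complex.ofReal

/-- The analytic subgroup `K_ℂ` of `Sp(n, ℂ)` whose Lie algebra is the complexification of
`𝔨 = 𝔰𝔭(n, ℝ) ∩ 𝔰𝔬(2n)`. -/
def KC : Subgroup (GC n) :=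
  Subgroup.closure {x | ∃ X Y : LieG n, X.1ᵀ = -X.1 ∧ Y.1ᵀ = -Y.1 ∧
    x.1 = NormedSpace.exp (toC X.1 + Complex.I • toC Y.1)}

/-- The subset `G exp(iS).x₀` of `X_ℂ = Sp(n, ℂ) / K_ℂ`, for `S ⊆ 𝔰𝔭(n, ℝ)`. -/
def orbitExp (S : Set (LieG n)) : Set (GC n ⧸ KC n) :=
  {x | ∃ g : G n, ∃ Y ∈ S, ∃ h : GC n, h.1 = toC g.1 * NormedSpace.exp (Complex.I • toC Y.1) ∧
    x = (QuotientGroup.mk h : GC n ⧸ KC n)}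

/-- `𝔞 = {diag(t₁, …, t_n, -t₁, …, -t_n)}`. -/
def partA : Set (LieG n) :=
  {Y | ∃ t : Fin n → ℝ, Y.1 = Matrix.fromBlocks (Matrix.diagonal t) 0 0 (-Matrix.diagonal t)}

/-- `𝔫`: the matrices `(Y, Z; 0, -Yᵀ)` with `Y` strictly upper triangular and `Z` symmetric. -/
def partN : Set (LieG n) :=
  {X | ∃ Y Z : Matrix (Fin n) (Fin n) ℝ, (∀ i j, j ≤ i → Y i j = 0) ∧ Z.IsSymm ∧
    X.1 = Matrix.fromBlocks Y Z 0 (-Yᵀ)}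

/-- `𝔫⁺`: the matrices `(0, Z; 0, 0)` with `Z` symmetric. -/
def partNPlus : Set (LieG n) :=
  {X | ∃ Z : Matrix (Fin n) (Fin n) ℝ, Z.IsSymm ∧ X.1 = Matrix.fromBlocks 0 Z 0 0}

/-- The complex crown `Ξ = G exp(iπΩ/2).x₀`. -/
def crown : Set (GC n ⧸ KC n) :=
  orbitExp n ((Real.pi / 2) • Omega (partA n))

/-- `Y ∈ 𝔤` satisfies `exp(iY).x₀ ∈ Ξ`. -/
def ExpMem (Y : LieG n) : Prop :=
  ∃ h : GC n, h.1 = NormedSpace.exp (Complex.I • toC Y.1) ∧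
    (QuotientGroup.mk h : GC n ⧸ KC n) ∈ crown n

/-- `Λ`: the connected component of `0` in `{Y ∈ 𝔫 | exp(iY).x₀ ∈ Ξ}`. -/
def Lambda : Set (LieG n) :=
  connectedComponentIn {Y | Y ∈ partN n ∧ ExpMem n Y} 0

/-- `Λ⁺`: the connected component of `0` in `{Y ∈ 𝔫⁺ | exp(iY).x₀ ∈ Ξ}`. -/
def LambdaP : Set (LieG n) :=
  connectedComponentIn {Y | Y ∈ partNPlus n ∧ ExpMem n Y} 0

/-- `Λ⁺⁺`: the elements of `Λ` of the form `(0, D; 0, 0)` with `D` diagonal. -/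
def LambdaPP : Set (LieG n) :=
  {Y | Y ∈ Lambda n ∧ ∃ t : Fin n → ℝ, Y.1 = Matrix.fromBlocks 0 (Matrix.diagonal t) 0 0}

/-- The operator norm on `M(n, ℝ)` for the Euclidean norm on `ℝⁿ`. -/
def opNorm {n : ℕ} (Z : Matrix (Fin n) (Fin n) ℝ) : ℝ :=
  ‖Matrix.toEuclideanCLM (𝕜 := ℝ) Z‖

end Sp

end CrownDomain

end

/-! Both parts rest on one identity in rank one. Let (h, e, f) be an sl(2)-triple, U = e - f the
compact direction, |t| < π/4, and choose w with tanh w = sin 2t, so that t = ½ arctan(sinh w). Then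
exp(i sin(2t) e) = exp(-½ log(cosh w) h) exp(-(π/4) U) · exp(i t h) · exp((π/4) U) exp(i (w/2) U).
With f = -θ e, the two factors on the left come from G and the two on the right lie in K_ℂ, so exp(i
sin(2t) e).x₀ and exp(i t h).x₀ lie in the same G-orbit. Since G_ℂ need not be a matrix group, the
identity is not checked on matrices: once the K_ℂ-factors are moved to the other side, both sides
are curves in w with the same initial value and the same logarithmic derivative, hence equal
(`eq_of_hasLogDerivAt`, `sl2_decomposition`). Only bracket relations enter, through the exponential
map, Ad and the fact that the bracket is the derivative of Ad (`bracket_eq_dAd`).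

Part A. The roots 2γ_j are strongly orthogonal, so the normalized triples commute for different j
and the rank-one identities multiply (`exists_decomposition_of_commuting`). The crown is then
covered because normalized vectors exist (`exists_isNormalized`), because ∑ t_j T_j ∈ (π/2)Ω means
|t_j| < π/4 for all j (`sum_mem_smul_Omega_iff`), and because t ↦ sin 2t maps ]-π/4, π/4[ onto ]-1,
1[. Applying Ad(K(0)) changes no orbit: elements of exp 𝔨 act from the left and their images lie in
K_ℂ (`orbitExp_Ad_gexp`).

Part B. Here the same decomposition is an explicit identity of matrices with diagonal blocks
(`exists_upper_sin_eq`). A symmetric Z is diagonalized by an orthogonal k, and all of O(n) lies in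
K_ℂ (`ofReal_ofOrthogonal_mem_KC`), so only diagonal Z matter. For these, |t_i| < 1 suffices by the
decomposition; it is necessary because `crownForm` is invariant under G, changes by congruence under
K_ℂ, is positive definite on the crown, and has the 2×2 minors 4(1 - t_i²) at exp(iY)
(`posDef_crownForm_of_mem_crown`, `abs_lt_one_of_posDef_crownForm_upper`). So exp(iY).x₀ ∈ Ξ on 𝔫⁺
means ‖Z‖ < 1, a set star-shaped about 0, and passing to connected components loses nothing. -/

noncomputable section

namespace CrownDomain

open Set Filter Topology

/-! ### The adjoint representation and its derivative at the identity -/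

section AdL
variable (𝕜 : Type*) [RCLike 𝕜] {E : Type*} [NormedAddCommGroup E] [NormedSpace 𝕜 E]
  {G : Type*} [TopologicalSpace G] [ChartedSpace E G] [Group G]

/-- The adjoint action of `g` as a continuous linear map. -/
def AdL (g : G) : E →L[𝕜] E := mfderiv 𝓘(𝕜, E) 𝓘(𝕜, E) (fun x : G => g * x * g⁻¹) 1

variable [LieGroup 𝓘(𝕜, E) ∞ G]

/-- Differentiating the smooth map (g, x) ↦ g x g⁻¹ in x keeps smoothness in g. The parametric
derivative is taken in tangent coordinates, which are trivial here because both x = 1 and its image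
are the identity for every g. -/
theorem mdifferentiableAt_AdL :
    MDifferentiableAt 𝓘(𝕜, E) 𝓘(𝕜, E →L[𝕜] E) (fun g : G => AdL 𝕜 (E := E) g) 1 := by
  have hf : ContMDiffAt (𝓘(𝕜, E).prod 𝓘(𝕜, E)) 𝓘(𝕜, E) ∞
      (Function.uncurry fun g x : G => g * x * g⁻¹) ((1 : G), (1 : G)) := by
    apply ContMDiff.contMDiffAt
    exact (contMDiff_fst.mul contMDiff_snd).mul contMDiff_fst.inv
  have hg : ContMDiffAt 𝓘(𝕜, E) 𝓘(𝕜, E) ∞ (fun _ : G => (1 : G)) (1 : G) := contMDiffAt_const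
  have := ContMDiffAt.mfderiv (m := 1) (n := ∞) (fun g x : G => g * x * g⁻¹) (fun _ => 1) hf
    (hg.of_le (by exact_mod_cast le_top)) (by rw [one_add_one_eq_two]; exact ENat.LEInfty.out)
  have h1 := this.mdifferentiableAt (by simp)
  refine h1.congr_of_eventuallyEq (Eventually.of_forall fun g => ?_)
  change AdL 𝕜 g = inTangentCoordinates 𝓘(𝕜, E) 𝓘(𝕜, E) (fun _ : G => (1 : G))
    (fun g : G => g * 1 * g⁻¹) (fun g => AdL 𝕜 g) 1 g
  rw [inTangentCoordinates_eq (I := 𝓘(𝕜, E)) (I' := 𝓘(𝕜, E)) (fun _ : G => (1 : G))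
    (fun g : G => g * 1 * g⁻¹) (fun g => AdL 𝕜 g) (mem_chart_source E (1 : G))
    (by simp)]
  have key : ∀ a b : G, a = 1 → b = 1 → ∀ v : E,
      (tangentBundleCore 𝓘(𝕜, E) G).coordChange (achart E a) (achart E b) a v = v := by
    rintro a b rfl rfl v
    exact (tangentBundleCore 𝓘(𝕜, E) G).coordChange_self _ _ (mem_achart_source E 1) v
  ext v
  simp only [ContinuousLinearMap.comp_apply]
  rw [key _ _ (by simp) (by simp), key _ _ rfl rfl]

/-- The derivative at `1` of the adjoint representation. -/
def dAd (G : Type*) [TopologicalSpace G] [ChartedSpace E G] [Group G] : E →L[𝕜] E →L[𝕜] E :=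
  mfderiv 𝓘(𝕜, E) 𝓘(𝕜, E →L[𝕜] E) (fun g : G => AdL 𝕜 (E := E) g) 1

theorem hasMFDerivAt_dAd :
    HasMFDerivAt 𝓘(𝕜, E) 𝓘(𝕜, E →L[𝕜] E) (fun g : G => AdL 𝕜 (E := E) g) 1
      (dAd 𝕜 (E := E) G) :=
  (mdifferentiableAt_AdL 𝕜).hasMFDerivAt

end AdL

/-! ### Complex Lie groups as real Lie groups -/

theorem hasMFDerivAt_restrictScalars {E F : Type*} [NormedAddCommGroup E] [NormedSpace ℂ E]
   [NormedAddCommGroup F] [NormedSpace ℂ F] {M N : Type*} [TopologicalSpace M] [ChartedSpace E M]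
   [TopologicalSpace N] [ChartedSpace F N] {f : M → N} {x : M} {f' : E →L[ℂ] F}
   (h : HasMFDerivAt 𝓘(ℂ, E) 𝓘(ℂ, F) f x f') :
   HasMFDerivAt 𝓘(ℝ, E) 𝓘(ℝ, F) f x (f'.restrictScalars ℝ : E →L[ℝ] F) :=
  ⟨h.1, HasFDerivWithinAt.restrictScalars ℝ h.2⟩

theorem ContMDiff.restrictScalars {E F : Type*} [NormedAddCommGroup E] [NormedSpace ℂ E]
   [NormedAddCommGroup F] [NormedSpace ℂ F] {M N : Type*} [TopologicalSpace M] [ChartedSpace E M]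
   [TopologicalSpace N] [ChartedSpace F N] {f : M → N} {n : WithTop ℕ∞}
   (h : ContMDiff 𝓘(ℂ, E) 𝓘(ℂ, F) n f) :
   ContMDiff 𝓘(ℝ, E) 𝓘(ℝ, F) n f := fun x => by
  have h1 := contMDiffAt_iff.1 (h x)
  exact contMDiffAt_iff.2 ⟨h1.1, h1.2.restrict_scalars ℝ⟩

section
variable {F : Type*} [NormedAddCommGroup F] [NormedSpace ℂ F]
  {M : Type*} [TopologicalSpace M] [ChartedSpace F M] 
theorem isManifold_restrictScalars [IsManifold 𝓘(ℂ, F) ∞ M] : IsManifold 𝓘(ℝ, F) ∞ M := by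
  apply isManifold_of_contDiffOn
  intro e e' he he'
  have h := HasGroupoid.compatible (G := contDiffGroupoid ∞ 𝓘(ℂ, F)) he he'
  rw [contDiffGroupoid, mem_groupoid_of_pregroupoid] at h
  exact ContDiffOn.restrict_scalars ℝ h.1
theorem lieGroup_restrictScalars [Group M] [LieGroup 𝓘(ℂ, F) ∞ M] : LieGroup 𝓘(ℝ, F) ∞ M := by
  have : IsManifold 𝓘(ℝ, F) ∞ M := isManifold_restrictScalars
  have h1 := contMDiff_mul 𝓘(ℂ, F) ∞ (G := M)
  have h2 := contMDiff_inv 𝓘(ℂ, F) ∞ (G := M)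
  refine { contMDiff_mul := ?_, contMDiff_inv := ContMDiff.restrictScalars h2 }
  intro x
  have h3 := contMDiffAt_iff.1 (h1 x)
  refine contMDiffAt_iff.2 ⟨h3.1, h3.2.restrict_scalars ℝ⟩

end

/-! ### The Lie bracket as the derivative of Ad, computed in a chart -/

section Chart
variable {E : Type*} [NormedAddCommGroup E] [NormedSpace ℝ E]
  {G : Type*} [TopologicalSpace G] [ChartedSpace E G]

theorem hasMFDerivAt_extChartAt_self (x : G) :
    HasMFDerivAt 𝓘(ℝ, E) 𝓘(ℝ, E) (extChartAt 𝓘(ℝ, E) x) x (ContinuousLinearMap.id ℝ E) := by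
  refine ⟨continuousAt_extChartAt x, ?_⟩
  have : writtenInExtChartAt 𝓘(ℝ, E) 𝓘(ℝ, E) x (extChartAt 𝓘(ℝ, E) x)
      =ᶠ[𝓝 (extChartAt 𝓘(ℝ, E) x x)] id := by
    filter_upwards [extChartAt_target_mem_nhds (I := 𝓘(ℝ, E)) x] with y hy
    simp only [writtenInExtChartAt, extChartAt_model_space_eq_id, Function.comp]
    exact (extChartAt 𝓘(ℝ, E) x).right_inv hy
  exact ((hasFDerivAt_id _).congr_of_eventuallyEq this).hasFDerivWithinAt

theorem hasMFDerivAt_extChartAt_symm_self (x : G) :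
    HasMFDerivAt 𝓘(ℝ, E) 𝓘(ℝ, E) (extChartAt 𝓘(ℝ, E) x).symm (extChartAt 𝓘(ℝ, E) x x)
      (ContinuousLinearMap.id ℝ E) := by
  refine ⟨continuousAt_extChartAt_symm x, ?_⟩
  have : writtenInExtChartAt 𝓘(ℝ, E) 𝓘(ℝ, E) (extChartAt 𝓘(ℝ, E) x x) (extChartAt 𝓘(ℝ, E) x).symm
      =ᶠ[𝓝 (extChartAt 𝓘(ℝ, E) x x)] id := by
    filter_upwards [extChartAt_target_mem_nhds (I := 𝓘(ℝ, E)) x] with y hy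
    simp only [writtenInExtChartAt, extChartAt_model_space_eq_id, Function.comp]
    simpa using (extChartAt 𝓘(ℝ, E) x).right_inv hy
  exact ((hasFDerivAt_id _).congr_of_eventuallyEq this).hasFDerivWithinAt

/-- The derivative at `x` of the preferred chart at `b`. -/
def dChart (b x : G) : E →L[ℝ] E := mfderiv 𝓘(ℝ, E) 𝓘(ℝ, E) (extChartAt 𝓘(ℝ, E) b) x

theorem hasFDerivAt_extChartAt_comp [IsManifold 𝓘(ℝ, E) ∞ G] {f : G → G} {a b : G} {f' : E →L[ℝ] E}
    (hf : HasMFDerivAt 𝓘(ℝ, E) 𝓘(ℝ, E) f a f') (hb : f a ∈ (chartAt E b).source) :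
    HasFDerivAt (fun y => extChartAt 𝓘(ℝ, E) b (f ((extChartAt 𝓘(ℝ, E) a).symm y)))
      (dChart b (f a) ∘L f')
      (extChartAt 𝓘(ℝ, E) a a) := by
  have h1 := hasMFDerivAt_extChartAt_symm_self (E := E) a
  have hs : (extChartAt 𝓘(ℝ, E) a).symm (extChartAt 𝓘(ℝ, E) a a) = a := extChartAt_to_inv a
  have h2 : HasMFDerivAt 𝓘(ℝ, E) 𝓘(ℝ, E) f
    ((extChartAt 𝓘(ℝ, E) a).symm (extChartAt 𝓘(ℝ, E) a a)) f' := by rw [hs]; exact hf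
  have h3 : HasMFDerivAt 𝓘(ℝ, E) 𝓘(ℝ, E) (extChartAt 𝓘(ℝ, E) b)
    (f ((extChartAt 𝓘(ℝ, E) a).symm (extChartAt 𝓘(ℝ, E) a a)))
    (dChart (E := E) b (f a)) := by
    rw [hs]; exact (mdifferentiableAt_extChartAt hb).hasMFDerivAt
  exact hasMFDerivAt_iff_hasFDerivAt.1
    (HasMFDerivAt.comp (extChartAt 𝓘(ℝ, E) a a) h3 (HasMFDerivAt.comp _ h2 h1))

variable [Group G]

/-- The group multiplication in the preferred chart at the identity. -/
def chartMul (p : E × E) : E :=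
  extChartAt 𝓘(ℝ, E) (1 : G)
    ((extChartAt 𝓘(ℝ, E) (1 : G)).symm p.1 * (extChartAt 𝓘(ℝ, E) (1 : G)).symm p.2)

variable [LieGroup 𝓘(ℝ, E) ∞ G]

theorem mdifferentiableAt_mul_left (g h : G) :
    MDifferentiableAt 𝓘(ℝ, E) 𝓘(ℝ, E) (fun x : G => g * x) h :=
  (contMDiff_mul_left (I := 𝓘(ℝ, E)) (n := ∞)).mdifferentiable (by simp) h

theorem mdifferentiableAt_mul_right (g h : G) :
    MDifferentiableAt 𝓘(ℝ, E) 𝓘(ℝ, E) (fun x : G => x * g) h :=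
  (contMDiff_mul_right (I := 𝓘(ℝ, E)) (n := ∞)).mdifferentiable (by simp) h

/-- The derivative of left multiplication by `g` at `h`. -/
def dLeft (g h : G) : E →L[ℝ] E := mfderiv 𝓘(ℝ, E) 𝓘(ℝ, E) (fun x : G => g * x) h

/-- The derivative of right multiplication by `g` at `h`. -/
def dRight (g h : G) : E →L[ℝ] E := mfderiv 𝓘(ℝ, E) 𝓘(ℝ, E) (fun x : G => x * g) h

theorem hasMFDerivAt_dLeft (g h : G) :
    HasMFDerivAt 𝓘(ℝ, E) 𝓘(ℝ, E) (fun x : G => g * x) h (dLeft (E := E) g h) :=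
  (mdifferentiableAt_mul_left g h).hasMFDerivAt

theorem hasMFDerivAt_dRight (g h : G) :
    HasMFDerivAt 𝓘(ℝ, E) 𝓘(ℝ, E) (fun x : G => x * g) h (dRight (E := E) g h) :=
  (mdifferentiableAt_mul_right g h).hasMFDerivAt

theorem hasMFDerivAt_AdL (g : G) :
    HasMFDerivAt 𝓘(ℝ, E) 𝓘(ℝ, E) (fun x : G => g * x * g⁻¹) 1 (AdL ℝ (E := E) g) := by
  have : MDifferentiableAt 𝓘(ℝ, E) 𝓘(ℝ, E) (fun x : G => g * x * g⁻¹) 1 :=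
    (mdifferentiableAt_mul_right g⁻¹ (g * 1)).comp (1 : G) (mdifferentiableAt_mul_left g 1)
  exact this.hasMFDerivAt

theorem dRight_one : dRight (E := E) (1 : G) 1 = ContinuousLinearMap.id ℝ E :=
  hasMFDerivAt_unique (hasMFDerivAt_dRight (E := E) 1 1)
    ((hasMFDerivAt_id (I := 𝓘(ℝ, E)) (1 : G)).congr_of_eventuallyEq
      (Eventually.of_forall (by simp)))

theorem AdL_one : AdL ℝ (E := E) (1 : G) = ContinuousLinearMap.id ℝ E :=
  hasMFDerivAt_unique (hasMFDerivAt_AdL (E := E) (1 : G))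
    ((hasMFDerivAt_id (I := 𝓘(ℝ, E)) (1 : G)).congr_of_eventuallyEq
      (Eventually.of_forall (by simp)))

/-- This compares left- and right-invariant vector fields; differentiating it in g at the identity
is what computes the derivative of Ad. -/
theorem dRight_comp_AdL (g : G) :
    (dRight (E := E) g (1 : G)) ∘L (AdL ℝ g) = dLeft g 1 := by
  have h1 : HasMFDerivAt 𝓘(ℝ, E) 𝓘(ℝ, E) (fun x : G => x * g) (g * 1 * g⁻¹)
      (dRight (E := E) g (1 : G)) := by
    have := hasMFDerivAt_dRight (E := E) g (1 : G)
    rwa [show g * 1 * g⁻¹ = 1 by simp]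
  have h2 := h1.comp (1 : G) (hasMFDerivAt_AdL g)
  have h3 : ((fun x : G => x * g) ∘ fun x => g * x * g⁻¹) = fun x => g * x := by
    ext x; simp
  rw [h3] at h2
  exact hasMFDerivAt_unique h2 (hasMFDerivAt_dLeft g 1)

theorem contDiffAt_chartMul :
    ContDiffAt ℝ ∞ (chartMul (E := E) (G := G))
      (extChartAt 𝓘(ℝ, E) (1 : G) 1, extChartAt 𝓘(ℝ, E) (1 : G) 1) := by
  set c := extChartAt 𝓘(ℝ, E) (1 : G) 1
  have hs : (extChartAt 𝓘(ℝ, E) (1 : G)).symm c = 1 := extChartAt_to_inv 1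
  have h1 : ContMDiffAt 𝓘(ℝ, E) 𝓘(ℝ, E) ∞ (extChartAt 𝓘(ℝ, E) (1 : G)).symm c :=
    (contMDiffOn_extChartAt_symm (1 : G)).contMDiffAt (extChartAt_target_mem_nhds 1)
  rw [← contMDiffAt_iff_contDiffAt]
  have h2 : ContMDiffAt 𝓘(ℝ, E × E) 𝓘(ℝ, E) ∞
      (fun p : E × E => (extChartAt 𝓘(ℝ, E) (1 : G)).symm p.1) (c, c) :=
    ContMDiffAt.comp (c, c) (f := Prod.fst) (g := (extChartAt 𝓘(ℝ, E) (1 : G)).symm) h1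
      contDiffAt_fst.contMDiffAt
  have h3 : ContMDiffAt 𝓘(ℝ, E × E) 𝓘(ℝ, E) ∞
      (fun p : E × E => (extChartAt 𝓘(ℝ, E) (1 : G)).symm p.2) (c, c) :=
    ContMDiffAt.comp (c, c) (f := Prod.snd) (g := (extChartAt 𝓘(ℝ, E) (1 : G)).symm) h1
      contDiffAt_snd.contMDiffAt
  have h4 := h2.mul h3
  have h5 : ContMDiffAt 𝓘(ℝ, E) 𝓘(ℝ, E) ∞ (extChartAt 𝓘(ℝ, E) (1 : G))
    ((fun p : E × E => (extChartAt 𝓘(ℝ, E) (1 : G)).symm p.1 *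
      (extChartAt 𝓘(ℝ, E) (1 : G)).symm p.2) (c, c)) := by
    simp only [hs, mul_one]
    exact contMDiffAt_extChartAt
  exact h5.comp (c, c) h4

/-- The chain rule for y ↦ m(x, y) at the base point c, where m is `chartMul`. The right side
expresses the left-invariant field of `v` in the chart, in a form that can be differentiated once
more. -/
theorem eventually_dLeft_chart :
    ∀ᶠ x in 𝓝 (extChartAt 𝓘(ℝ, E) (1 : G) 1), ∀ v : E,
      dChart (1 : G) ((extChartAt 𝓘(ℝ, E) (1 : G)).symm x)
        (dLeft ((extChartAt 𝓘(ℝ, E) (1 : G)).symm x) 1 v) =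
      fderiv ℝ (chartMul (E := E) (G := G)) (x, extChartAt 𝓘(ℝ, E) (1 : G) 1) (0, v) := by
  set c := extChartAt 𝓘(ℝ, E) (1 : G) 1 with hc
  have hd : ∀ᶠ p in 𝓝 (c, c), DifferentiableAt ℝ (chartMul (E := E) (G := G)) p := by
    filter_upwards [((contDiffAt_chartMul (E := E) (G := G)).of_le
      (n := ∞) (m := 1) ENat.LEInfty.out).eventually (by simp)] with p hp
    exact hp.differentiableAt (by simp)
  have hd' : ∀ᶠ x in 𝓝 c, DifferentiableAt ℝ (chartMul (E := E) (G := G)) (x, c) :=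
    (Continuous.prodMk_left c).continuousAt.eventually hd
  filter_upwards [extChartAt_target_mem_nhds (I := 𝓘(ℝ, E)) (1 : G), hd'] with x hx hdx v
  set g := (extChartAt 𝓘(ℝ, E) (1 : G)).symm x with hg
  have hgs : g * 1 ∈ (chartAt E (1 : G)).source := by
    rw [mul_one, ← extChartAt_source 𝓘(ℝ, E)]
    exact (extChartAt 𝓘(ℝ, E) (1 : G)).map_target hx
  have h1 := hasFDerivAt_extChartAt_comp (hasMFDerivAt_dLeft (E := E) g (1 : G)) hgs
  have h2 : HasFDerivAt (fun y => chartMul (E := E) (G := G) (x, y))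
      (fderiv ℝ (chartMul (E := E) (G := G)) (x, c) ∘L ContinuousLinearMap.inr ℝ E E) c :=
    hdx.hasFDerivAt.comp c (hasFDerivAt_prodMk_right x c)
  have h3 := congrArg (fun L : E →L[ℝ] E => L v) (h1.unique h2)
  simpa using h3

theorem eventually_dRight_chart :
    ∀ᶠ x in 𝓝 (extChartAt 𝓘(ℝ, E) (1 : G) 1), ∀ v : E,
      dChart (1 : G) ((extChartAt 𝓘(ℝ, E) (1 : G)).symm x)
        (dRight ((extChartAt 𝓘(ℝ, E) (1 : G)).symm x) 1 v) =
      fderiv ℝ (chartMul (E := E) (G := G)) (extChartAt 𝓘(ℝ, E) (1 : G) 1, x) (v, 0) := by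
  set c := extChartAt 𝓘(ℝ, E) (1 : G) 1 with hc
  have hd : ∀ᶠ p in 𝓝 (c, c), DifferentiableAt ℝ (chartMul (E := E) (G := G)) p := by
    filter_upwards [((contDiffAt_chartMul (E := E) (G := G)).of_le
      (n := ∞) (m := 1) ENat.LEInfty.out).eventually (by simp)] with p hp
    exact hp.differentiableAt (by simp)
  have hd' : ∀ᶠ x in 𝓝 c, DifferentiableAt ℝ (chartMul (E := E) (G := G)) (c, x) :=
    (Continuous.prodMk_right c).continuousAt.eventually hd
  filter_upwards [extChartAt_target_mem_nhds (I := 𝓘(ℝ, E)) (1 : G), hd'] with x hx hdx v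
  set g := (extChartAt 𝓘(ℝ, E) (1 : G)).symm x with hg
  have hgs : 1 * g ∈ (chartAt E (1 : G)).source := by
    rw [one_mul, ← extChartAt_source 𝓘(ℝ, E)]
    exact (extChartAt 𝓘(ℝ, E) (1 : G)).map_target hx
  have h1 := hasFDerivAt_extChartAt_comp (hasMFDerivAt_dRight (E := E) g (1 : G)) hgs
  have h2 : HasFDerivAt (fun y => chartMul (E := E) (G := G) (y, x))
      (fderiv ℝ (chartMul (E := E) (G := G)) (c, x) ∘L ContinuousLinearMap.inl ℝ E E) c :=
    HasFDerivAt.comp c (f := fun y => (y, x)) hdx.hasFDerivAt (hasFDerivAt_prodMk_left c x)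
  have h3 := congrArg (fun L : E →L[ℝ] E => L v) (h1.unique h2)
  simpa using h3

theorem hasFDerivAt_AdL_chart :
    HasFDerivAt (fun x => AdL ℝ (E := E) ((extChartAt 𝓘(ℝ, E) (1 : G)).symm x))
      (dAd ℝ (E := E) G)
      (extChartAt 𝓘(ℝ, E) (1 : G) 1) := by
  have h1 := hasMFDerivAt_extChartAt_symm_self (E := E) (1 : G)
  have hs : (extChartAt 𝓘(ℝ, E) (1 : G)).symm (extChartAt 𝓘(ℝ, E) (1 : G) 1) = 1 :=
    extChartAt_to_inv 1
  have h2 : HasMFDerivAt 𝓘(ℝ, E) 𝓘(ℝ, E →L[ℝ] E) (fun g : G => AdL ℝ (E := E) g)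
      ((extChartAt 𝓘(ℝ, E) (1 : G)).symm (extChartAt 𝓘(ℝ, E) (1 : G) 1))
      (dAd ℝ (E := E) G) := by
    rw [hs]; exact hasMFDerivAt_dAd ℝ
  exact hasMFDerivAt_iff_hasFDerivAt.1 (HasMFDerivAt.comp _ h2 h1)

/-- In the chart `dRight_comp_AdL` reads ∂₁m(c, x)(Ad(x) w) = ∂₂m(x, c) w near c. The product rule
at x = c, in direction v, gives the formula. -/
theorem mfderiv_AdL_eq_chart (v w : E) :
    let c := extChartAt 𝓘(ℝ, E) (1 : G) 1
    (dAd ℝ (E := E) G) v w =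
      fderiv ℝ (fderiv ℝ (chartMul (E := E) (G := G))) (c, c) (v, 0) (0, w) -
      fderiv ℝ (fderiv ℝ (chartMul (E := E) (G := G))) (c, c) (0, v) (w, 0) := by
  intro c
  have hs : (extChartAt 𝓘(ℝ, E) (1 : G)).symm c = 1 := extChartAt_to_inv 1
  set M := fderiv ℝ (chartMul (E := E) (G := G))
  have hM : DifferentiableAt ℝ M (c, c) :=
    ((contDiffAt_chartMul (E := E) (G := G)).fderiv_right (m := 1)
      (by rw [one_add_one_eq_two]; exact ENat.LEInfty.out)).differentiableAt (by simp)
  have hL : HasFDerivAt (fun x => M (x, c))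
      (fderiv ℝ M (c, c) ∘L ContinuousLinearMap.inl ℝ E E) c :=
    HasFDerivAt.comp c (f := fun x => (x,c)) hM.hasFDerivAt (hasFDerivAt_prodMk_left c c)
  have hR : HasFDerivAt (fun x => M (c, x))
      (fderiv ℝ M (c, c) ∘L ContinuousLinearMap.inr ℝ E E) c :=
    hM.hasFDerivAt.comp c (hasFDerivAt_prodMk_right c c)
  have hA := hasFDerivAt_AdL_chart (E := E) (G := G)
  have hAw := hA.clm_apply (hasFDerivAt_const w c)
  have hAw0 : HasFDerivAt (fun x => (AdL ℝ (E := E) ((extChartAt 𝓘(ℝ, E) (1 : G)).symm x) w, (0 : E)))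
      _ c := hAw.prodMk (hasFDerivAt_const (0 : E) c)
  have h1 := hR.clm_apply hAw0
  have h2 := hL.clm_apply (hasFDerivAt_const ((0 : E), w) c)
  have heq : (fun x => M (c, x) (AdL ℝ (E := E) ((extChartAt 𝓘(ℝ, E) (1 : G)).symm x) w, (0 : E)))
      =ᶠ[𝓝 c] fun x => M (x, c) (0, w) := by
    filter_upwards [eventually_dLeft_chart (E := E) (G := G),
      eventually_dRight_chart (E := E) (G := G)] with x hx1 hx2
    rw [← hx1, ← hx2]
    exact congrArg (dChart _ _) (congrArg (fun L : E →L[ℝ] E => L w) (dRight_comp_AdL _))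
  have h3 := congrArg (fun L : E →L[ℝ] E => L v) (h1.unique (h2.congr_of_eventuallyEq heq))
  -- Since m(·, c) is the identity to first order, the product-rule term carrying the derivative of
  -- Ad appears without any factor.
  have hid : ∀ u : E, M (c, c) (u, 0) = u := by
    intro u
    have h4 := (eventually_dRight_chart (E := E) (G := G)).self_of_nhds u
    have h6 := (hasMFDerivAt_extChartAt_self (E := E) (1 : G)).mfderiv
    have h7 : (extChartAt 𝓘(ℝ, E) (1 : G)).symm (extChartAt 𝓘(ℝ, E) (1 : G) 1) = 1 := hs
    rw [h7, dRight_one] at h4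
    rw [show dChart (E := E) (1 : G) 1 = ContinuousLinearMap.id ℝ E from h6] at h4
    exact h4.symm
  simp [hid, AdL_one] at h3
  have hs' : (chartAt E (1 : G)).symm c = 1 := by simpa using hs
  rw [hs', AdL_one] at h3
  exact eq_sub_of_add_eq h3

theorem dLeft_one : dLeft (E := E) (1 : G) 1 = ContinuousLinearMap.id ℝ E :=
  hasMFDerivAt_unique (hasMFDerivAt_dLeft (E := E) 1 1)
    ((hasMFDerivAt_id (I := 𝓘(ℝ, E)) (1 : G)).congr_of_eventuallyEq
      (Eventually.of_forall (by simp)))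

/-- The bracket of the fields x ↦ ∂₂m(x, c)v and x ↦ ∂₂m(x, c)w at c is D²m((v,0),(0,w)) -
D²m((w,0),(0,v)). By symmetry of the second derivative this is the expression found for the
derivative of Ad. -/
theorem bracket_eq_dAd (v w : GroupLieAlgebra 𝓘(ℝ, E) G) :
    ⁅v, w⁆ = dAd ℝ (E := E) G v w := by
  have hc : dChart (E := E) (1 : G) 1 = ContinuousLinearMap.id ℝ E :=
    (hasMFDerivAt_extChartAt_self (E := E) (1 : G)).mfderiv
  have hs : (extChartAt 𝓘(ℝ, E) (1 : G)).symm (extChartAt 𝓘(ℝ, E) (1 : G) 1) = 1 :=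
    extChartAt_to_inv 1
  set c := extChartAt 𝓘(ℝ, E) (1 : G) 1 with hcdef
  have key : ∀ u : GroupLieAlgebra 𝓘(ℝ, E) G,
      VectorField.mpullbackWithin 𝓘(ℝ, E) 𝓘(ℝ, E) (extChartAt 𝓘(ℝ, E) (1 : G)).symm
        (mulInvariantVectorField u) (range 𝓘(ℝ, E)) =ᶠ[𝓝 c]
      fun x => fderiv ℝ (chartMul (E := E) (G := G)) (x, c) (0, u) := by
    intro u
    filter_upwards [eventually_dLeft_chart (E := E) (G := G),
      extChartAt_target_mem_nhds (I := 𝓘(ℝ, E)) (1 : G)] with x hx hxt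
    rw [← hx u, VectorField.mpullbackWithin_apply]
    have h1 := mfderiv_extChartAt_comp_mfderivWithin_extChartAt_symm hxt
    have h2 := mfderivWithin_extChartAt_symm_comp_mfderiv_extChartAt hxt
    rw [ContinuousLinearMap.inverse_eq h2 h1]
    rfl
  have hval : ∀ u : E, fderiv ℝ (chartMul (E := E) (G := G)) (c, c) (0, u) = u := by
    intro u
    have h4 := (eventually_dLeft_chart (E := E) (G := G)).self_of_nhds u
    rw [hs, hc, dLeft_one] at h4
    exact h4.symm
  have hM : DifferentiableAt ℝ (fderiv ℝ (chartMul (E := E) (G := G))) (c, c) :=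
    ((contDiffAt_chartMul (E := E) (G := G)).fderiv_right (m := 1)
      (by rw [one_add_one_eq_two]; exact ENat.LEInfty.out)).differentiableAt (by simp)
  have hder : ∀ u : E, fderiv ℝ (fun x => fderiv ℝ (chartMul (E := E) (G := G)) (x, c) (0, u)) c =
      (fderiv ℝ (fderiv ℝ (chartMul (E := E) (G := G))) (c, c) ∘L
        ContinuousLinearMap.inl ℝ E E).flip (0, u) := by
    intro u
    have hL : HasFDerivAt (fun x => fderiv ℝ (chartMul (E := E) (G := G)) (x, c))
        (fderiv ℝ (fderiv ℝ (chartMul (E := E) (G := G))) (c, c) ∘L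
          ContinuousLinearMap.inl ℝ E E) c :=
      HasFDerivAt.comp c (f := fun x => (x, c)) hM.hasFDerivAt (hasFDerivAt_prodMk_left c c)
    have := (hL.clm_apply (hasFDerivAt_const ((0 : E), u) c)).fderiv
    simpa using this
  have hsymm : IsSymmSndFDerivAt ℝ (chartMul (E := E) (G := G)) (c, c) :=
    (contDiffAt_chartMul (E := E) (G := G)).isSymmSndFDerivAt (by
      rw [minSmoothness_of_isRCLikeNormedField]; exact ENat.LEInfty.out)
  rw [GroupLieAlgebra.bracket_def, ← VectorField.mlieBracketWithin_univ,
    VectorField.mlieBracketWithin_apply]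
  have hinv : (mfderiv 𝓘(ℝ, E) 𝓘(ℝ, E) (extChartAt 𝓘(ℝ, E) (1 : G)) 1).inverse =
      ContinuousLinearMap.id ℝ E := by
    rw [show mfderiv 𝓘(ℝ, E) 𝓘(ℝ, E) (extChartAt 𝓘(ℝ, E) (1 : G)) 1 =
      ContinuousLinearMap.id ℝ E from hc]
    exact ContinuousLinearMap.inverse_id
  rw [hinv]
  have hset : ((extChartAt 𝓘(ℝ, E) (1 : G)).symm ⁻¹' univ ∩ range 𝓘(ℝ, E)) = univ := by simp
  rw [hset]
  let P : E → E → E := fun u => VectorField.mpullbackWithin 𝓘(ℝ, E) 𝓘(ℝ, E)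
    (extChartAt 𝓘(ℝ, E) (1 : G)).symm
    (mulInvariantVectorField (u : GroupLieAlgebra 𝓘(ℝ, E) G)) (range 𝓘(ℝ, E))
  have hP : ∀ u : E, P u =ᶠ[𝓝 c] fun x => fderiv ℝ (chartMul (E := E) (G := G)) (x, c) (0, u) :=
    key
  change VectorField.lieBracketWithin ℝ (P v) (P w) univ c = _
  have main : ∀ v w : E, VectorField.lieBracket ℝ
      (fun x => fderiv ℝ (chartMul (E := E) (G := G)) (x, c) (0, v))
      (fun x => fderiv ℝ (chartMul (E := E) (G := G)) (x, c) (0, w)) c =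
      dAd ℝ (E := E) G v w := by
    intro v w
    rw [mfderiv_AdL_eq_chart, VectorField.lieBracket, hder, hder, hval, hval]
    simp only [ContinuousLinearMap.flip_apply, ContinuousLinearMap.comp_apply,
      ContinuousLinearMap.inl_apply]
    rw [hsymm.eq (w, 0) (0, v)]
  rw [VectorField.lieBracketWithin_univ,
    Filter.EventuallyEq.lieBracket_vectorField_eq (hP v) (hP w)]
  exact main v w

end Chart

/-! ### Logarithmic derivatives of curves in a Lie group -/

section Curves
variable {E : Type*} [NormedAddCommGroup E] [NormedSpace ℝ E]
  {G : Type*} [TopologicalSpace G] [ChartedSpace E G] [Group G]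

/-- The linear map `r ↦ r v`. -/
def lineMap (v : E) : ℝ →L[ℝ] E := (1 : ℝ →L[ℝ] ℝ).smulRight v

theorem lineMap_apply (v : E) (r : ℝ) : lineMap v r = r • v := by simp [lineMap]

theorem eq_lineMap (L : ℝ →L[ℝ] E) : L = lineMap (L 1) := by
  ext; simp [lineMap]

omit [Group G] in
theorem HasMFDerivAt.curve_congr {c : ℝ → G} {L L' : ℝ →L[ℝ] E} {t : ℝ}
    (h : HasMFDerivAt 𝓘(ℝ, ℝ) 𝓘(ℝ, E) c t L) (e : L = L') :
    HasMFDerivAt 𝓘(ℝ, ℝ) 𝓘(ℝ, E) c t L' := e ▸ h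

/-- The curve `c` has logarithmic derivative `ξ` at `t`, i.e. `c'(t) = d(L_{c(t)}) ξ`. -/
def HasLogDerivAt (c : ℝ → G) (ξ : E) (t : ℝ) : Prop :=
  HasMFDerivAt 𝓘(ℝ, ℝ) 𝓘(ℝ, E) c t
    (lineMap (E := E) (dLeft (E := E) (c t) 1 ξ))

theorem HasLogDerivAt.const (g : G) (t : ℝ) : HasLogDerivAt (fun _ => g) (0 : E) t := by
  have h : lineMap (dLeft (E := E) g 1 (0 : E)) = 0 := by ext; simp [lineMap]
  unfold HasLogDerivAt
  rw [h]
  exact hasMFDerivAt_const g t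

variable [LieGroup 𝓘(ℝ, E) ∞ G]

theorem dLeft_comp_dLeft (g h k : G) :
    (dLeft (E := E) g (h * k)) ∘L (dLeft h k) = dLeft (g * h) k := by
  have h2 := (hasMFDerivAt_dLeft (E := E) g (h * k)).comp k (hasMFDerivAt_dLeft h k)
  have h3 : ((fun x : G => g * x) ∘ fun x => h * x) = fun x => g * h * x := by
    ext x; simp [mul_assoc]
  rw [h3] at h2
  exact hasMFDerivAt_unique h2 (hasMFDerivAt_dLeft (g * h) k)

theorem dRight_comp_dLeft (a b : G) :
    (dRight (E := E) b a) ∘L (dLeft a 1) = dLeft (a * b) 1 ∘L AdL ℝ b⁻¹ := by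
  have h0 : HasMFDerivAt 𝓘(ℝ, E) 𝓘(ℝ, E) (fun x : G => x * b) (a * 1) (dRight (E := E) b a) := by
    rw [mul_one]; exact hasMFDerivAt_dRight b a
  have h1 := h0.comp (1 : G) (hasMFDerivAt_dLeft a 1)
  have h0' : HasMFDerivAt 𝓘(ℝ, E) 𝓘(ℝ, E) (fun x : G => a * b * x) (b⁻¹ * 1 * b⁻¹⁻¹)
      (dLeft (E := E) (a * b) 1) := by
    rw [show b⁻¹ * 1 * b⁻¹⁻¹ = 1 by simp]; exact hasMFDerivAt_dLeft (a * b) 1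
  have h2 := h0'.comp (1 : G) (hasMFDerivAt_AdL b⁻¹)
  have h3 : ((fun x : G => x * b) ∘ fun x => a * x) =
      ((fun x : G => a * b * x) ∘ fun x => b⁻¹ * x * b⁻¹⁻¹) := by
    ext x; simp [mul_assoc]
  rw [h3] at h1
  exact hasMFDerivAt_unique h1 h2

theorem AdL_mul (g h : G) : AdL ℝ (E := E) (g * h) = AdL ℝ g ∘L AdL ℝ h := by
  have h0 : HasMFDerivAt 𝓘(ℝ, E) 𝓘(ℝ, E) (fun x : G => g * x * g⁻¹) (h * 1 * h⁻¹)
      (AdL ℝ (E := E) g) := by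
    rw [show h * 1 * h⁻¹ = 1 by simp]; exact hasMFDerivAt_AdL g
  have h1 := h0.comp (1 : G) (hasMFDerivAt_AdL h)
  have h2 : ((fun x : G => g * x * g⁻¹) ∘ fun x => h * x * h⁻¹) =
      fun x => (g * h) * x * (g * h)⁻¹ := by
    ext x; simp [mul_assoc]
  rw [h2] at h1
  exact hasMFDerivAt_unique (hasMFDerivAt_AdL (g * h)) h1

theorem AdL_apply_AdL_inv (g : G) (X : E) : AdL ℝ g (AdL ℝ g⁻¹ X) = X := by
  rw [← ContinuousLinearMap.comp_apply, ← AdL_mul, mul_inv_cancel, AdL_one]; rfl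

theorem hasLogDerivAt_of_hasMFDerivAt {c : ℝ → G} {L : ℝ →L[ℝ] E} {t : ℝ}
    (h : HasMFDerivAt 𝓘(ℝ, ℝ) 𝓘(ℝ, E) c t L) :
    HasLogDerivAt c (dLeft (c t)⁻¹ (c t) (L 1)) t := by
  have h1 : dLeft (E := E) (c t) 1 (dLeft (c t)⁻¹ (c t) (L 1)) = L 1 := by
    have h2 := dLeft_comp_dLeft (E := E) (c t) (c t)⁻¹ (c t)
    rw [inv_mul_cancel, mul_inv_cancel] at h2
    rw [← ContinuousLinearMap.comp_apply, h2]
    have h3 : dLeft (E := E) (1 : G) (c t) = ContinuousLinearMap.id ℝ E :=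
      hasMFDerivAt_unique (hasMFDerivAt_dLeft (E := E) 1 (c t))
        ((hasMFDerivAt_id (I := 𝓘(ℝ, E)) (c t)).congr_of_eventuallyEq
          (Eventually.of_forall (by simp)))
    rw [h3]; rfl
  unfold HasLogDerivAt
  rwa [h1, ← eq_lineMap]

theorem HasLogDerivAt.unique {c : ℝ → G} {ξ η : E} {t : ℝ}
    (h1 : HasLogDerivAt c ξ t) (h2 : HasLogDerivAt c η t) : ξ = η := by
  have h3 : dLeft (E := E) (c t) 1 ξ = dLeft (c t) 1 η := by
    have := congrArg (fun L : ℝ →L[ℝ] E => L 1) (hasMFDerivAt_unique h1 h2)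
    simpa only [lineMap_apply, one_smul] using this
  have h4 := congrArg (dLeft (E := E) (c t)⁻¹ (c t)) h3
  have h5 := dLeft_comp_dLeft (E := E) (c t)⁻¹ (c t) 1
  rw [mul_one, inv_mul_cancel, dLeft_one] at h5
  rw [← ContinuousLinearMap.comp_apply, ← ContinuousLinearMap.comp_apply, h5] at h4
  exact h4

theorem hasMFDerivAt_mul (a b : G) :
    HasMFDerivAt (𝓘(ℝ, E).prod 𝓘(ℝ, E)) 𝓘(ℝ, E) (fun p : G × G => p.1 * p.2) (a, b)
      ((dRight (E := E) b a).coprod (dLeft (E := E) a b)) := by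
  have hm : MDifferentiableAt (𝓘(ℝ, E).prod 𝓘(ℝ, E)) 𝓘(ℝ, E) (fun p : G × G => p.1 * p.2)
      (a, b) := (contMDiff_mul 𝓘(ℝ, E) ∞).mdifferentiableAt (by simp)
  have h : mfderiv (𝓘(ℝ, E).prod 𝓘(ℝ, E)) 𝓘(ℝ, E) (fun p : G × G => p.1 * p.2) (a, b) =
      (dRight (E := E) b a).coprod (dLeft (E := E) a b) := by
    ext v
    exact mfderiv_prod_eq_add_apply hm
  have h1 := hm.hasMFDerivAt
  exact h ▸ h1

/-- Right translation by b carries the left-trivialized velocity ξ to Ad(b⁻¹)ξ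
(`dRight_comp_dLeft`), while left translation leaves it unchanged. -/
theorem HasLogDerivAt.mul {c₁ c₂ : ℝ → G} {ξ₁ ξ₂ : E} {t : ℝ}
    (h₁ : HasLogDerivAt c₁ ξ₁ t) (h₂ : HasLogDerivAt c₂ ξ₂ t) :
    HasLogDerivAt (fun s => c₁ s * c₂ s) (AdL ℝ (c₂ t)⁻¹ ξ₁ + ξ₂) t := by
  have h3 : HasMFDerivAt 𝓘(ℝ, ℝ) 𝓘(ℝ, E) (fun s => c₁ s * c₂ s) t
      (((dRight (E := E) (c₂ t) (c₁ t)).coprod (dLeft (E := E) (c₁ t) (c₂ t))) ∘L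
      ((lineMap (dLeft (E := E) (c₁ t) 1 ξ₁)).prod (lineMap (dLeft (E := E) (c₂ t) 1 ξ₂)))) :=
    HasMFDerivAt.comp t (hasMFDerivAt_mul (E := E) (c₁ t) (c₂ t)) (HasMFDerivAt.prodMk h₁ h₂)
  have h7 := congrArg (fun L : E →L[ℝ] E => L ξ₁) (dRight_comp_dLeft (E := E) (c₁ t) (c₂ t))
  have h8 := congrArg (fun L : E →L[ℝ] E => L ξ₂) (dLeft_comp_dLeft (E := E) (c₁ t) (c₂ t) 1)
  simp only [mul_one, ContinuousLinearMap.comp_apply] at h7 h8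
  have h9 : ((dRight (E := E) (c₂ t) (c₁ t)).coprod (dLeft (E := E) (c₁ t) (c₂ t))) ∘L
      ((lineMap (dLeft (E := E) (c₁ t) 1 ξ₁)).prod (lineMap (dLeft (E := E) (c₂ t) 1 ξ₂))) =
      lineMap (dLeft (E := E) (c₁ t * c₂ t) 1 (AdL ℝ (c₂ t)⁻¹ ξ₁ + ξ₂)) := by
    ext
    simp [lineMap_apply, h7, h8]
  exact HasMFDerivAt.curve_congr h3 h9

/-- A charted space is T1, and a T1 topological group is Hausdorff. Global uniqueness of integral
curves needs this, and it is not among the hypotheses. -/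
theorem t2Space_of_lieGroup (E : Type*) [NormedAddCommGroup E] [NormedSpace ℝ E]
    (G : Type*) [TopologicalSpace G] [ChartedSpace E G] [Group G] [LieGroup 𝓘(ℝ, E) ∞ G] :
    T2Space G := by
  have : IsTopologicalGroup G := topologicalGroup_of_lieGroup 𝓘(ℝ, E) ∞
  have : T1Space G := ChartedSpace.t1Space E G
  infer_instance

theorem HasLogDerivAt.inv {c : ℝ → G} {ξ : E} {t : ℝ} (h : HasLogDerivAt c ξ t) :
    HasLogDerivAt (fun s => (c s)⁻¹) (-AdL ℝ (c t) ξ) t := by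
  have hm : MDifferentiableAt 𝓘(ℝ, E) 𝓘(ℝ, E) (fun p : G => p⁻¹) (c t) :=
    (contMDiff_inv 𝓘(ℝ, E) ∞).mdifferentiableAt (by simp)
  -- Smoothness of inversion gives only the existence of a logarithmic derivative; its value is then
  -- forced by the product rule for c · c⁻¹ = 1.
  obtain ⟨η, h3⟩ : ∃ η : E, HasLogDerivAt (fun s => (c s)⁻¹) η t :=
    ⟨_, hasLogDerivAt_of_hasMFDerivAt (hm.hasMFDerivAt.comp t h)⟩
  have h4 := h.mul h3
  simp only [mul_inv_cancel, inv_inv] at h4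
  have h6 := h4.unique (HasLogDerivAt.const 1 t)
  rwa [← eq_neg_iff_add_eq_zero.2 ((add_comm _ _).trans h6)]

theorem eq_const_of_hasLogDerivAt_zero {c : ℝ → G} (h : ∀ t, HasLogDerivAt c (0 : E) t) (t : ℝ) :
    c t = c 0 := by
  have : T2Space G := t2Space_of_lieGroup E G
  have h1 : IsMIntegralCurve (I := 𝓘(ℝ, E)) c
      (mulInvariantVectorField (0 : GroupLieAlgebra 𝓘(ℝ, E) G)) := h
  have h2 : IsMIntegralCurve (I := 𝓘(ℝ, E)) (fun _ => c 0)
    (mulInvariantVectorField (0 : GroupLieAlgebra 𝓘(ℝ, E) G)) := HasLogDerivAt.const (c 0)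
  have hv := (contMDiff_mulInvariantVectorField (I := 𝓘(ℝ, E)) (G := G) 0).of_le
    (m := 1) (by rw [minSmoothness_of_isRCLikeNormedField]; norm_num)
  exact congrFun (isMIntegralCurve_Ioo_eq_of_contMDiff_boundaryless (t₀ := 0) hv h1 h2 rfl) t

/-- The curve c₁ c₂⁻¹ has logarithmic derivative Ad(c₂)ξ - Ad(c₂)ξ = 0, so it is constant. This is
the tool by which identities between products of exponentials are proved. -/
theorem eq_of_hasLogDerivAt {c₁ c₂ : ℝ → G} {ξ : ℝ → E} (h₁ : ∀ t, HasLogDerivAt c₁ (ξ t) t)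
    (h₂ : ∀ t, HasLogDerivAt c₂ (ξ t) t) (h0 : c₁ 0 = c₂ 0) (t : ℝ) : c₁ t = c₂ t := by
  have h : ∀ t, HasLogDerivAt (fun s => c₁ s * (c₂ s)⁻¹) (0 : E) t := by
    intro t
    have := (h₁ t).mul (h₂ t).inv
    simpa using this
  have := eq_const_of_hasLogDerivAt_zero h t
  rw [h0, mul_inv_cancel] at this
  exact mul_inv_eq_one.1 this

end Curves

/-! ### The exponential map -/

section Exp
variable {E : Type*} [NormedAddCommGroup E] [NormedSpace ℝ E]
  {G : Type*} [TopologicalSpace G] [ChartedSpace E G] [Group G]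

theorem HasLogDerivAt.comp {c : ℝ → G} {ξ : E} {f : ℝ → ℝ} {f' t : ℝ}
    (h : HasLogDerivAt c ξ (f t)) (hf : HasDerivAt f f' t) :
    HasLogDerivAt (fun s => c (f s)) (f' • ξ) t := by
  have h1 : HasMFDerivAt 𝓘(ℝ, ℝ) 𝓘(ℝ, ℝ) f t (lineMap f') := hf.hasFDerivAt.hasMFDerivAt
  have h2 : HasMFDerivAt 𝓘(ℝ, ℝ) 𝓘(ℝ, E) (fun s => c (f s)) t
      (lineMap (E := E) (dLeft (E := E) (c (f t)) 1 ξ) ∘L lineMap f') := HasMFDerivAt.comp t h h1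
  have h3 : lineMap (dLeft (E := E) (c (f t)) 1 ξ) ∘L lineMap f' =
      lineMap (dLeft (E := E) (c (f t)) 1 (f' • ξ)) := by
    ext; simp [lineMap_apply]
  exact HasMFDerivAt.curve_congr h2 h3

variable [LieGroup 𝓘(ℝ, E) ∞ G]

/-- The exponential map of `G`, as a map on the model space. -/
def gexp (X : E) : G := lieExp (E := E) X

theorem HasLogDerivAt.const_mul {c : ℝ → G} {ξ : E} {t : ℝ} (g : G) (h : HasLogDerivAt c ξ t) :
    HasLogDerivAt (fun s => g * c s) ξ t := by
  simpa using (HasLogDerivAt.const g t).mul h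

theorem hasLogDerivAt_iff_one_dLeft {c : ℝ → G} {ξ : E} {t : ℝ} (hc : c t = 1) :
    HasLogDerivAt c ξ t ↔ HasMFDerivAt 𝓘(ℝ, ℝ) 𝓘(ℝ, E) c t (lineMap (E := E) ξ) := by
  unfold HasLogDerivAt
  have : dLeft (E := E) (c t) 1 ξ = ξ := by rw [hc, dLeft_one]; rfl
  rw [this]

theorem IsOneParameterSubgroup.hasLogDerivAt {X : E} {φ : ℝ → G}
    (h : IsOneParameterSubgroup (E := E) X φ) (t : ℝ) : HasLogDerivAt φ X t := by
  have h0 : φ 0 = 1 := by simpa using h.map_add 0 0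
  have h1 : HasMFDerivAt 𝓘(ℝ, ℝ) 𝓘(ℝ, E) φ 0 (lineMap (E := E) X) := by
    have h2 := (h.contMDiff.mdifferentiableAt (x := 0) (by simp)).hasMFDerivAt
    have h3 : mfderiv 𝓘(ℝ, ℝ) 𝓘(ℝ, E) φ 0 = lineMap X :=
      (eq_lineMap (E := E) _).trans (congrArg lineMap h.velocity)
    exact HasMFDerivAt.curve_congr h2 h3
  have h2 : HasLogDerivAt φ X (t + -t) := by
    rw [add_neg_cancel]; exact (hasLogDerivAt_iff_one_dLeft h0).2 h1
  have h3 := (HasLogDerivAt.comp (f := fun s => s + -t) h2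
    ((hasDerivAt_id t).add_const (-t))).const_mul (φ t)
  have h4 : (fun s => φ t * φ (s + -t)) = φ := by
    ext s; rw [← h.map_add]; congr 1; ring
  rw [h4, one_smul] at h3
  exact h3

variable [CompleteSpace E]

/-- Left-invariant fields are complete: left translates of one local integral curve through 1 give
integral curves through all points with a common lifetime ε, and such curves can be prolonged
indefinitely. -/
theorem exists_curve_hasLogDerivAt (X : E) :
    ∃ φ : ℝ → G, φ 0 = 1 ∧ ∀ t, HasLogDerivAt φ X t := by
  have : T2Space G := t2Space_of_lieGroup E G
  have hv := (contMDiff_mulInvariantVectorField (I := 𝓘(ℝ, E)) (G := G)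
    (X : GroupLieAlgebra 𝓘(ℝ, E) G)).of_le
    (m := 1) (by rw [minSmoothness_of_isRCLikeNormedField]; norm_num)
  obtain ⟨γ, h0, hγ⟩ := exists_isMIntegralCurveAt_of_contMDiffAt_boundaryless (t₀ := 0)
    (hv.contMDiffAt (x := 1))
  rw [isMIntegralCurveAt_iff'] at hγ
  obtain ⟨ε, hε, hγ⟩ := hγ
  have hγ' : ∀ t ∈ Ioo (-ε) ε, HasLogDerivAt γ X t := by
    intro t ht
    have hb : Metric.ball (0 : ℝ) ε ∈ 𝓝 t := Metric.isOpen_ball.mem_nhds (by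
      rw [Real.ball_eq_Ioo]; simpa using ht)
    exact (hγ t (mem_of_mem_nhds hb)).hasMFDerivAt hb
  refine exists_isMIntegralCurve_of_isMIntegralCurveOn hv hε (fun x => ?_) 1
  refine ⟨fun t => x * γ t, by simp [h0], fun t ht => ?_⟩
  exact HasMFDerivAt.hasMFDerivWithinAt ((hγ' t ht).const_mul x)

/-- In the chart φ solves the autonomous equation f' = V(f) with V smooth at f(0), and solutions
inherit the regularity of V. -/
theorem contDiffAt_chart_of_hasLogDerivAt {X : E} {φ : ℝ → G} (h0 : φ 0 = 1)
    (h : ∀ t, HasLogDerivAt φ X t) :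
    ContDiffAt ℝ ∞ (fun t => extChartAt 𝓘(ℝ, E) (1 : G) (φ t)) 0 := by
  set c := extChartAt 𝓘(ℝ, E) (1 : G) 1 with hc
  set f : ℝ → E := fun t => extChartAt 𝓘(ℝ, E) (1 : G) (φ t) with hf
  have hf0 : f 0 = c := by simp [hf, h0, hc]
  set V : E → E := fun x => fderiv ℝ (chartMul (E := E) (G := G)) (x, c) (0, X) with hV
  have hφc : ContinuousAt φ 0 := (h 0).1
  have hfc : ContinuousAt f 0 := by
    refine ContinuousAt.comp (g := extChartAt 𝓘(ℝ, E) (1 : G)) ?_ hφc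
    rw [h0]; exact continuousAt_extChartAt 1
  have hsrc : ∀ᶠ t in 𝓝 (0 : ℝ), φ t ∈ (extChartAt 𝓘(ℝ, E) (1 : G)).source :=
    hφc.eventually (by rw [h0]; exact extChartAt_source_mem_nhds (1 : G))
  have hder : ∀ᶠ t in 𝓝 (0 : ℝ), HasDerivAt f (V (f t)) t := by
    have hE := eventually_dLeft_chart (E := E) (G := G)
    rw [← hc, ← hf0] at hE
    filter_upwards [hsrc, hfc.eventually hE] with t ht hEt
    have hinv : (extChartAt 𝓘(ℝ, E) (1 : G)).symm (f t) = φ t :=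
      (extChartAt 𝓘(ℝ, E) (1 : G)).left_inv ht
    have h1 := hEt X
    rw [hinv, hf0] at h1
    have h2 : HasMFDerivAt 𝓘(ℝ, E) 𝓘(ℝ, E) (extChartAt 𝓘(ℝ, E) (1 : G)) (φ t)
        (dChart (E := E) (1 : G) (φ t)) :=
      (mdifferentiableAt_extChartAt (by rwa [extChartAt_source] at ht)).hasMFDerivAt
    have h3 : HasFDerivAt f (dChart (E := E) (1 : G) (φ t) ∘L
        lineMap (dLeft (E := E) (φ t) 1 X)) t :=
      hasMFDerivAt_iff_hasFDerivAt.1 (HasMFDerivAt.comp t h2 (h t))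
    have h4 := h3.hasDerivAt
    simp only [ContinuousLinearMap.comp_apply, lineMap_apply, one_smul] at h4
    rwa [h1] at h4
  have hVc : ContDiffAt ℝ ∞ V c := by
    have h1 : ContDiffAt ℝ ∞ (fderiv ℝ (chartMul (E := E) (G := G))) (c, c) :=
      (contDiffAt_chartMul (E := E) (G := G)).fderiv_right (m := ∞) le_rfl
    have h2 : ContDiffAt ℝ ∞ (fun x : E => (x, c)) c := contDiffAt_id.prodMk contDiffAt_const
    exact (ContDiffAt.comp c (f := fun x : E => (x, c)) h1 h2).clm_apply contDiffAt_const
  -- The neighbourhood on which V is of class Cⁿ may depend on n, so each n is treated separately.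
  rw [contDiffAt_infty] at hVc ⊢
  intro n
  obtain ⟨u, hu, hVu⟩ := (hVc n).contDiffOn le_rfl (by simp)
  have hfu : ∀ᶠ t in 𝓝 (0 : ℝ), f t ∈ u := hfc.eventually (by rwa [hf0])
  obtain ⟨ε, hε, hball⟩ := Metric.eventually_nhds_iff_ball.1 (hder.and hfu)
  have hsub : Icc (-(ε / 2)) (ε / 2) ⊆ Metric.ball (0 : ℝ) ε := by
    intro t ht
    rw [Real.ball_eq_Ioo]
    constructor <;> linarith [ht.1, ht.2]
  have h1 := ODE.contDiffOn_enat_Icc_of_hasDerivWithinAt (n := n) (f := fun _ => V) (α := f) (u := u)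
    (tmin := -(ε / 2)) (tmax := ε / 2)
    (hVu.comp contDiffOn_snd (fun p hp => hp.2))
    (fun t ht => (hball t (hsub ht)).1.hasDerivWithinAt) (fun t ht => (hball t (hsub ht)).2)
  exact h1.contDiffAt (Icc_mem_nhds (by linarith) (by linarith))

theorem contMDiff_of_hasLogDerivAt {X : E} {φ : ℝ → G} (h0 : φ 0 = 1)
    (hadd : ∀ s t, φ (s + t) = φ s * φ t)
    (h : ∀ t, HasLogDerivAt φ X t) : ContMDiff 𝓘(ℝ, ℝ) 𝓘(ℝ, E) ∞ φ := by
  have hzero : ContMDiffAt 𝓘(ℝ, ℝ) 𝓘(ℝ, E) ∞ φ 0 := by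
    have h1 : ContMDiffAt 𝓘(ℝ, ℝ) 𝓘(ℝ, E) ∞ (fun t => extChartAt 𝓘(ℝ, E) (1 : G) (φ t)) 0 :=
      (contDiffAt_chart_of_hasLogDerivAt h0 h).contMDiffAt
    have h2 : ContMDiffAt 𝓘(ℝ, E) 𝓘(ℝ, E) ∞ (extChartAt 𝓘(ℝ, E) (1 : G)).symm
        (extChartAt 𝓘(ℝ, E) (1 : G) (φ 0)) := by
      rw [h0]
      exact (contMDiffOn_extChartAt_symm (1 : G)).contMDiffAt (extChartAt_target_mem_nhds 1)
    have hφc : ContinuousAt φ 0 := HasMFDerivAt.continuousAt (h 0)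
    have hsrc : ∀ᶠ t in 𝓝 (0 : ℝ), φ t ∈ (extChartAt 𝓘(ℝ, E) (1 : G)).source :=
      hφc.eventually (by rw [h0]; exact extChartAt_source_mem_nhds (1 : G))
    refine (ContMDiffAt.comp (0 : ℝ) h2 h1).congr_of_eventuallyEq ?_
    filter_upwards [hsrc] with t ht
    exact ((extChartAt 𝓘(ℝ, E) (1 : G)).left_inv ht).symm
  intro t
  have h1 : φ = fun s => φ t * φ (s - t) := by
    ext s; rw [← hadd]; congr 1; ring
  rw [h1]
  refine contMDiffAt_const.mul (ContMDiffAt.comp (I' := 𝓘(ℝ, ℝ)) t (g := φ) (f := fun s => s - t) ?_ ?_)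
  · rwa [sub_self]
  · exact (contDiff_id.sub contDiff_const).contDiffAt.contMDiffAt

omit [CompleteSpace E] in
theorem map_add_of_hasLogDerivAt {X : E} {φ : ℝ → G} (h0 : φ 0 = 1)
    (h : ∀ t, HasLogDerivAt φ X t) (s t : ℝ) : φ (s + t) = φ s * φ t := by
  refine eq_of_hasLogDerivAt (ξ := fun _ => X) (c₁ := fun t => φ (s + t))
    (c₂ := fun t => φ s * φ t) (fun t => ?_) (fun t => (h t).const_mul _) (by simp [h0]) t
  have := HasLogDerivAt.comp (f := fun t => s + t) (h (s + t)) ((hasDerivAt_id t).const_add s)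
  simpa using this

theorem isOneParameterSubgroup_of_hasLogDerivAt {X : E} {φ : ℝ → G} (h0 : φ 0 = 1)
    (h : ∀ t, HasLogDerivAt φ X t) : IsOneParameterSubgroup (E := E) X φ where
  contMDiff := contMDiff_of_hasLogDerivAt h0 (map_add_of_hasLogDerivAt h0 h) h
  map_add := map_add_of_hasLogDerivAt h0 h
  velocity := by
    have h1 := ((hasLogDerivAt_iff_one_dLeft h0).1 (h 0)).mfderiv
    refine (congrArg (fun L : ℝ →L[ℝ] E => L 1) h1).trans ?_
    simp [lineMap_apply]

/-- The definition of `lieExp` chooses some one-parameter subgroup; uniqueness of curves with a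
given logarithmic derivative makes the choice immaterial. -/
theorem gexp_eq_of_hasLogDerivAt {X : E} {φ : ℝ → G} (h0 : φ 0 = 1)
    (h : ∀ t, HasLogDerivAt φ X t) : gexp (G := G) X = φ 1 := by
  have hex : ∃ φ : ℝ → G, IsOneParameterSubgroup (E := E) X φ :=
    ⟨φ, isOneParameterSubgroup_of_hasLogDerivAt h0 h⟩
  have h1 := hex.choose_spec
  refine (dif_pos hex).trans ?_
  refine eq_of_hasLogDerivAt (ξ := fun _ => X) h1.hasLogDerivAt h ?_ 1
  rw [h0]; simpa using h1.map_add 0 0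

theorem hasLogDerivAt_gexp_smul (X : E) (t : ℝ) :
    HasLogDerivAt (fun s : ℝ => gexp (G := G) (s • X : E)) X t := by
  obtain ⟨φ, h0, h⟩ := exists_curve_hasLogDerivAt (G := G) X
  have : (fun s : ℝ => gexp (G := G) (s • X : E)) = φ := by
    ext s
    rw [gexp_eq_of_hasLogDerivAt (φ := fun r => φ (r * s)) (by simp [h0])]
    · simp
    · intro t
      have := HasLogDerivAt.comp (f := fun r => r * s) (h (t * s)) ((hasDerivAt_id t).mul_const s)
      simpa using this
  rw [this]; exact h t

theorem gexp_zero : gexp (G := G) (0 : E) = 1 :=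
  gexp_eq_of_hasLogDerivAt (φ := fun _ => 1) rfl (HasLogDerivAt.const 1)

theorem hasLogDerivAt_gexp_comp (X : E) {f : ℝ → ℝ} {f' t : ℝ} (hf : HasDerivAt f f' t) :
    HasLogDerivAt (fun s : ℝ => gexp (G := G) (f s • X : E)) (f' • X) t :=
  HasLogDerivAt.comp (f := f) (hasLogDerivAt_gexp_smul X (f t)) hf

theorem gexp_add_smul (X : E) (s t : ℝ) :
    gexp (G := G) ((s + t) • X : E) = gexp (s • X : E) * gexp (t • X : E) :=
  map_add_of_hasLogDerivAt (φ := fun s : ℝ => gexp (G := G) (s • X : E))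
    (by simp [gexp_zero]) (hasLogDerivAt_gexp_smul X) s t

theorem gexp_neg (X : E) : gexp (G := G) (-X : E) = (gexp (G := G) X)⁻¹ := by
  have := gexp_add_smul (G := G) X (-1) 1
  simp only [neg_add_cancel, zero_smul, gexp_zero, neg_smul, one_smul] at this
  exact eq_inv_of_mul_eq_one_left this.symm

theorem map_gexp {F H : Type*} [NormedAddCommGroup F] [NormedSpace ℝ F] [CompleteSpace F]
    [TopologicalSpace H] [ChartedSpace F H] [Group H] [LieGroup 𝓘(ℝ, F) ∞ H]
    (f : G →* H) {L : E →L[ℝ] F} (hf : HasMFDerivAt 𝓘(ℝ, E) 𝓘(ℝ, F) f 1 L) (X : E) :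
    f (gexp X) = gexp (L X) := by
  rw [gexp_eq_of_hasLogDerivAt (φ := fun t : ℝ => f (gexp (t • X : E)))
    (by simp [gexp_zero])]
  · simp
  intro t
  have hc := hasLogDerivAt_gexp_smul (G := G) X 0
  rw [hasLogDerivAt_iff_one_dLeft (by simp [gexp_zero])] at hc
  have hf' : HasMFDerivAt 𝓘(ℝ, E) 𝓘(ℝ, F) f (gexp (G := G) ((0 : ℝ) • X : E)) L := by
    rwa [zero_smul, gexp_zero]
  have h1 : HasMFDerivAt 𝓘(ℝ, ℝ) 𝓘(ℝ, F) (fun t : ℝ => f (gexp (t • X : E))) 0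
      (L ∘L lineMap X) := HasMFDerivAt.comp (0 : ℝ) hf' hc
  have h2 : L ∘L lineMap X = lineMap (L X) := by ext; simp [lineMap_apply]
  replace h1 := (hasLogDerivAt_iff_one_dLeft (c := fun t : ℝ => f (gexp (t • X : E)))
    (by simp [gexp_zero])).2 (HasMFDerivAt.curve_congr h1 h2)
  have h3 : HasLogDerivAt (fun t : ℝ => f (gexp (t • X : E))) (L X) (t + -t) := by
    rwa [add_neg_cancel]
  have h4 := (HasLogDerivAt.comp (f := fun s => s + -t) h3
    ((hasDerivAt_id t).add_const (-t))).const_mul (f (gexp (t • X : E)))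
  rw [one_smul] at h4
  convert h4 using 2 with s
  rw [← map_mul, ← gexp_add_smul]; congr 3; ring

theorem conj_gexp (g : G) (X : E) : g * gexp X * g⁻¹ = gexp (AdL ℝ (E := E) g X) := 
  map_gexp (MulAut.conj g).toMonoidHom (hasMFDerivAt_AdL g) X

theorem hasDerivAt_AdL_gexp (X : E) (t : ℝ) :
    HasDerivAt (fun s : ℝ => AdL ℝ (E := E) (gexp (G := G) (s • X : E)))
      (AdL ℝ (E := E) (gexp (G := G) (t • X : E)) ∘L dAd ℝ (E := E) G X) t := by
  have hc := hasLogDerivAt_gexp_smul (G := G) X 0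
  rw [hasLogDerivAt_iff_one_dLeft (by simp [gexp_zero])] at hc
  have hf' : HasMFDerivAt 𝓘(ℝ, E) 𝓘(ℝ, E →L[ℝ] E) (fun g : G => AdL ℝ (E := E) g)
      (gexp (G := G) ((0 : ℝ) • X : E)) (dAd ℝ (E := E) G) := by
    rw [zero_smul, gexp_zero]; exact hasMFDerivAt_dAd ℝ
  have h1 : HasMFDerivAt 𝓘(ℝ, ℝ) 𝓘(ℝ, E →L[ℝ] E)
      (fun t : ℝ => AdL ℝ (E := E) (gexp (G := G) (t • X : E))) 0
      (dAd ℝ (E := E) G ∘L lineMap X) := HasMFDerivAt.comp (0 : ℝ) hf' hc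
  have h2 : HasDerivAt (fun t : ℝ => AdL ℝ (E := E) (gexp (G := G) (t • X : E)))
      (dAd ℝ (E := E) G X) (t - t) := by
    rw [sub_self]
    have h3 : HasFDerivAt (fun t : ℝ => AdL ℝ (E := E) (gexp (G := G) (t • X : E)))
      (dAd ℝ (E := E) G ∘L lineMap X) 0 := hasMFDerivAt_iff_hasFDerivAt.1 h1
    have h4 : (dAd ℝ (E := E) G ∘L lineMap X) (1 : ℝ) = dAd ℝ (E := E) G X := by
      simp [lineMap_apply]
    exact h4 ▸ h3.hasDerivAt
  have h3 : HasDerivAt (fun s : ℝ => AdL ℝ (E := E) (gexp (G := G) ((s - t) • X : E)))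
      (dAd ℝ (E := E) G X) t := HasDerivAt.comp_sub_const t t h2
  have h4 := ((ContinuousLinearMap.compL ℝ E E E)
    (AdL ℝ (E := E) (gexp (G := G) (t • X : E)))).hasFDerivAt.comp_hasDerivAt t h3
  have h5 : (fun s : ℝ => AdL ℝ (E := E) (gexp (G := G) (s • X : E))) =
      (ContinuousLinearMap.compL ℝ E E E (AdL ℝ (E := E) (gexp (G := G) (t • X : E)))) ∘
        fun s : ℝ => AdL ℝ (E := E) (gexp (G := G) ((s - t) • X : E)) := by
    funext s
    simp only [Function.comp, ContinuousLinearMap.compL_apply]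
    rw [← AdL_mul, ← gexp_add_smul, add_sub_cancel]
  rw [h5]
  exact h4

/-- Ad(exp(-sX)) v(s) has derivative zero. Thus Ad(exp sX) is evaluated by exhibiting a solution of
v' = [X, v], without an operator exponential. -/
theorem AdL_gexp_eq {X : E} {v : ℝ → E} (hv : ∀ s, HasDerivAt v (dAd ℝ (E := E) G X (v s)) s)
    (s : ℝ) : AdL ℝ (gexp (G := G) (s • X : E)) (v 0) = v s := by
  have h : ∀ s, HasDerivAt (fun s : ℝ => AdL ℝ (E := E) (gexp (G := G) ((-s) • X : E)) (v s)) 0 s := by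
    intro s
    have h1 := HasDerivAt.scomp s (hasDerivAt_AdL_gexp (G := G) X (-s)) (hasDerivAt_neg s)
    have h2 := h1.clm_apply (hv s)
    simpa using h2
  have h1 := is_const_of_deriv_eq_zero (fun s => (h s).differentiableAt) (fun s => (h s).deriv) s 0
  simp only [neg_zero, zero_smul, gexp_zero, AdL_one] at h1
  change _ = v 0 at h1
  rw [← h1, neg_smul, gexp_neg, AdL_apply_AdL_inv]

theorem AdL_gexp_of_dAd_eq_zero {X Y : E} (h : dAd ℝ (E := E) G X Y = 0) :
    AdL ℝ (gexp (G := G) X) Y = Y := by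
  have := AdL_gexp_eq (G := G) (X := X) (v := fun _ => Y)
    (fun s => by rw [h]; exact hasDerivAt_const s Y) 1
  simpa using this

theorem commute_gexp {X Y : E} (h : dAd ℝ (E := E) G X Y = 0) :
    Commute (gexp (G := G) X) (gexp (G := G) Y) := by
  have := conj_gexp (gexp (G := G) X) Y
  rw [AdL_gexp_of_dAd_eq_zero h] at this
  exact mul_inv_eq_iff_eq_mul.1 this

omit [CompleteSpace E] in
theorem dAd_swap (X Y : E) : dAd ℝ (E := E) G X Y = -dAd ℝ (E := E) G Y X := by
  have h1 := bracket_eq_dAd (G := G) X Y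
  have h2 := bracket_eq_dAd (G := G) Y X
  exact h1.symm.trans ((VectorField.mlieBracket_swap_apply).trans (congrArg Neg.neg h2))

theorem gexp_add {X Y : E} (h : dAd ℝ (E := E) G X Y = 0) :
    gexp (G := G) (X + Y : E) = gexp X * gexp Y := by
  rw [gexp_eq_of_hasLogDerivAt
    (φ := fun t : ℝ => gexp (t • X : E) * gexp (t • Y : E)) (by simp [gexp_zero])]
  · simp
  intro t
  have h1 := (hasLogDerivAt_gexp_smul (G := G) X t).mul (hasLogDerivAt_gexp_smul (G := G) Y t)
  have h2 : dAd ℝ (E := E) G (-(t • Y)) X = 0 := by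
    rw [dAd_swap (G := G)]; simp [h]
  rwa [← gexp_neg (G := G), AdL_gexp_of_dAd_eq_zero h2] at h1

end Exp

/-! ### The rank-one decomposition -/

section SL2
variable {E : Type*} [NormedAddCommGroup E] [NormedSpace ℝ E] [CompleteSpace E]
  {G : Type*} [TopologicalSpace G] [ChartedSpace E G] [Group G] [LieGroup 𝓘(ℝ, E) ∞ G]

omit [CompleteSpace E] [LieGroup 𝓘(ℝ, E) ∞ G] in
theorem HasLogDerivAt.congr {c : ℝ → G} {ξ η : E} {t : ℝ} (h : HasLogDerivAt c ξ t) (e : ξ = η) :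
    HasLogDerivAt c η t :=
  e ▸ h

theorem AdL_gexp_rotation {X p q : E} (hp : dAd ℝ (E := E) G X p = (2 : ℝ) • q)
    (hq : dAd ℝ (E := E) G X q = -((2 : ℝ) • p)) (s : ℝ) :
    AdL ℝ (gexp (G := G) (s • X)) p = Real.cos (2 * s) • p + Real.sin (2 * s) • q := by
  have h := AdL_gexp_eq (G := G) (X := X)
    (v := fun s => Real.cos (2 * s) • p + Real.sin (2 * s) • q) (fun s => ?_) s
  · simpa using h
  · have h0 : HasDerivAt (fun s : ℝ => 2 * s) 2 s := by simpa using (hasDerivAt_id s).const_mul 2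
    have h1 := (h0.cos.smul_const p).add (h0.sin.smul_const q)
    refine h1.congr_deriv ?_
    simp only [map_add, map_smul, hp, hq]
    module

theorem AdL_gexp_boost {X p q : E} (hp : dAd ℝ (E := E) G X p = (2 : ℝ) • q)
    (hq : dAd ℝ (E := E) G X q = (2 : ℝ) • p) (s : ℝ) :
    AdL ℝ (gexp (G := G) (s • X)) p = Real.cosh (2 * s) • p + Real.sinh (2 * s) • q := by
  have h := AdL_gexp_eq (G := G) (X := X)
    (v := fun s => Real.cosh (2 * s) • p + Real.sinh (2 * s) • q) (fun s => ?_) s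
  · simpa using h
  · have h0 : HasDerivAt (fun s : ℝ => 2 * s) 2 s := by simpa using (hasDerivAt_id s).const_mul 2
    have h1 := (h0.cosh.smul_const p).add (h0.sinh.smul_const q)
    refine h1.congr_deriv ?_
    simp only [map_add, map_smul, hp, hq]
    module

theorem hasDerivAt_tanh (w : ℝ) : HasDerivAt Real.tanh (1 / Real.cosh w ^ 2) w := by
  have h1 := (Real.hasDerivAt_sinh w).div (Real.hasDerivAt_cosh w) (Real.cosh_pos w).ne'
  have h2 : Real.tanh = fun x => Real.sinh x / Real.cosh x := by
    ext x; exact Real.tanh_eq_sinh_div_cosh x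
  rw [h2]
  refine h1.congr_deriv ?_
  rw [← Real.cosh_sq_sub_sinh_sq w]; ring

/-- This is the Gudermannian function, which converts the hyperbolic parameter w into the angle 2t:
its cosine is 1 / cosh w and its sine is tanh w. -/
theorem hasDerivAt_arctan_sinh (w : ℝ) :
    HasDerivAt (fun x => Real.arctan (Real.sinh x)) (1 / Real.cosh w) w := by
  have h1 := (Real.hasDerivAt_sinh w).arctan
  refine h1.congr_deriv ?_
  have := Real.cosh_pos w
  rw [← Real.cosh_sq']
  field_simp

theorem cos_arctan_sinh (w : ℝ) : Real.cos (Real.arctan (Real.sinh w)) = 1 / Real.cosh w := by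
  rw [Real.cos_arctan, ← Real.cosh_sq', Real.sqrt_sq (Real.cosh_pos w).le]

theorem sin_arctan_sinh (w : ℝ) : Real.sin (Real.arctan (Real.sinh w)) = Real.tanh w := by
  rw [Real.sin_arctan, ← Real.cosh_sq', Real.sqrt_sq (Real.cosh_pos w).le,
    Real.tanh_eq_sinh_div_cosh]

/-- The model is P = e + f, U = e - f, with primes denoting multiplication by i, so that (P' + U')/2
= i e. Listing the real brackets that are used keeps the argument inside a real Lie group. -/
theorem sl2_decomposition {h P U h' P' U' : E}
    (hUP : dAd ℝ (E := E) G U P = (2 : ℝ) • h) (hUh : dAd ℝ (E := E) G U h = -((2 : ℝ) • P))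
    (hUU' : dAd ℝ (E := E) G U U' = 0)
    (hUP' : dAd ℝ (E := E) G U P' = (2 : ℝ) • h')
    (hUh' : dAd ℝ (E := E) G U h' = -((2 : ℝ) • P'))
    (hh'P : dAd ℝ (E := E) G h' P = (2 : ℝ) • U')
    (hh'U' : dAd ℝ (E := E) G h' U' = -((2 : ℝ) • P))
    (hU'P' : dAd ℝ (E := E) G U' P' = -((2 : ℝ) • h))
    (hU'h : dAd ℝ (E := E) G U' h = -((2 : ℝ) • P'))
    (hU'U' : dAd ℝ (E := E) G U' U' = 0) (w : ℝ) :
    gexp (G := G) (Real.tanh w • (1 / 2 : ℝ) • (P' + U')) =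
      gexp ((-(1 / 2) * Real.log (Real.cosh w)) • h) * gexp ((-(Real.pi / 4)) • U) *
        gexp ((1 / 2 * Real.arctan (Real.sinh w)) • h') *
        (gexp ((Real.pi / 4) • U) * gexp ((w / 2) • U')) := by
  have hπ : 2 * (Real.pi / 4) = Real.pi / 2 := by ring
  have a1 : AdL ℝ (gexp (G := G) ((Real.pi / 4) • U)) h = -P := by
    have := AdL_gexp_rotation (G := G) (X := U) (p := h) (q := -P) (by rw [hUh]; module)
      (by rw [map_neg, hUP]) (Real.pi / 4)
    rw [this, hπ]; simp
  have a2 : AdL ℝ (gexp (G := G) ((Real.pi / 4) • U)) P' = h' := by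
    have := AdL_gexp_rotation (G := G) hUP' hUh' (Real.pi / 4)
    rw [this, hπ]; simp
  have a3 : AdL ℝ (gexp (G := G) ((Real.pi / 4) • U)) U' = U' :=
    AdL_gexp_of_dAd_eq_zero (by simp [hUU'])
  have a4 : ∀ s : ℝ, AdL ℝ (gexp (G := G) (s • U')) U' = U' := fun s =>
    AdL_gexp_of_dAd_eq_zero (by simp [hU'U'])
  have a5 : ∀ s : ℝ, AdL ℝ (gexp (G := G) (s • U')) P' =
      Real.cosh (2 * s) • P' + Real.sinh (2 * s) • -h := fun s =>
    AdL_gexp_boost (by rw [hU'P']; module) (by rw [map_neg, hU'h]; module) s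
  have a6 : ∀ s : ℝ, AdL ℝ (gexp (G := G) (s • h')) P =
      Real.cos (2 * s) • P + Real.sin (2 * s) • U' := fun s => AdL_gexp_rotation hh'P hh'U' s
  -- The two K_ℂ-factors are moved to the left side. Both sides then equal exp(-(π/4)U) at w = 0 and
  -- have the logarithmic derivative ½ sech w h' + ½ tanh w sech w P - ½ tanh² w U'.
  have key : ∀ w : ℝ, gexp (G := G) (Real.tanh w • (1 / 2 : ℝ) • (P' + U')) *
      gexp ((-(w / 2)) • U') * gexp ((-(Real.pi / 4)) • U) =
      gexp ((-(1 / 2) * Real.log (Real.cosh w)) • h) * gexp ((-(Real.pi / 4)) • U) *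
        gexp ((1 / 2 * Real.arctan (Real.sinh w)) • h') := by
    refine eq_of_hasLogDerivAt (ξ := fun w => (1 / 2 * (1 / Real.cosh w)) • h' +
      (1 / 2 * (Real.tanh w * (1 / Real.cosh w))) • P - (1 / 2 * Real.tanh w ^ 2) • U')
      (fun w => ?_) (fun w => ?_) ?_
    · have d1 := hasLogDerivAt_gexp_comp (G := G) ((1 / 2 : ℝ) • (P' + U')) (hasDerivAt_tanh w)
      have d0 : HasDerivAt (fun w : ℝ => -(w / 2)) (-(1 / 2)) w :=
        ((hasDerivAt_id w).div_const 2).neg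
      have d2 := hasLogDerivAt_gexp_comp (G := G) U' d0
      have d3 := (d1.mul d2).mul (HasLogDerivAt.const (E := E) (gexp ((-(Real.pi / 4)) • U)) w)
      refine d3.congr ?_
      have e1 : (gexp (G := G) ((-(Real.pi / 4)) • U))⁻¹ = gexp ((Real.pi / 4) • U) := by
        rw [← gexp_neg]; simp
      have e2 : (gexp (G := G) ((-(w / 2)) • U'))⁻¹ = gexp ((w / 2) • U') := by
        rw [← gexp_neg]; simp
      have e3 : 2 * (w / 2) = w := by ring
      simp only [e1, e2, map_smul, map_add, map_neg, a1, a2, a3, a4, a5, e3]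
      have hc := Real.cosh_pos w
      have t1 : Real.tanh w * (1 / Real.cosh w) = 1 / Real.cosh w ^ 2 * Real.sinh w := by
        rw [Real.tanh_eq_sinh_div_cosh]; field_simp
      have t2 : Real.tanh w ^ 2 = 1 - 1 / Real.cosh w ^ 2 := by
        rw [Real.tanh_eq_sinh_div_cosh]; field_simp; rw [Real.cosh_sq]; ring
      have t3 : 1 / Real.cosh w = 1 / Real.cosh w ^ 2 * Real.cosh w := by field_simp
      rw [t1, t2]
      nth_rewrite 1 [t3]
      module
    · have d1 := hasLogDerivAt_gexp_comp (G := G) h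
        (((Real.hasDerivAt_cosh w).log (Real.cosh_pos w).ne').const_mul (-(1 / 2)))
      have d2 := hasLogDerivAt_gexp_comp (G := G) h' ((hasDerivAt_arctan_sinh w).const_mul (1 / 2))
      have d3 := (d1.mul (HasLogDerivAt.const (E := E) (gexp ((-(Real.pi / 4)) • U)) w)).mul d2
      refine d3.congr ?_
      have e1 : (gexp (G := G) ((-(Real.pi / 4)) • U))⁻¹ = gexp ((Real.pi / 4) • U) := by
        rw [← gexp_neg]; simp
      have e2 : (gexp (G := G) ((1 / 2 * Real.arctan (Real.sinh w)) • h'))⁻¹ =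
          gexp ((-(1 / 2 * Real.arctan (Real.sinh w))) • h') := by
        rw [← gexp_neg]; simp
      have e3 : 2 * (-(1 / 2 * Real.arctan (Real.sinh w))) = -Real.arctan (Real.sinh w) := by ring
      simp only [e1, e2, map_smul, map_neg, add_zero, a1, a6, e3, Real.cos_neg,
        Real.sin_neg, cos_arctan_sinh, sin_arctan_sinh]
      rw [← Real.tanh_eq_sinh_div_cosh]
      module
    · simp [gexp_zero]
  have e1 : gexp (G := G) ((-(Real.pi / 4)) • U) = (gexp ((Real.pi / 4) • U))⁻¹ := by
    rw [← gexp_neg]; simp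
  have e2 : gexp (G := G) ((-(w / 2)) • U') = (gexp ((w / 2) • U'))⁻¹ := by
    rw [← gexp_neg]; simp
  rw [← key w, e1, e2]
  group

omit [CompleteSpace E] in
theorem AdL_map {F H : Type*} [NormedAddCommGroup F] [NormedSpace ℝ F]
    [TopologicalSpace H] [ChartedSpace F H] [Group H] [LieGroup 𝓘(ℝ, F) ∞ H]
    (f : G →* H) {L : E →L[ℝ] F} (hf : HasMFDerivAt 𝓘(ℝ, E) 𝓘(ℝ, F) f 1 L) (g : G) (Y : E) :
    AdL ℝ (f g) (L Y) = L (AdL ℝ g Y) := by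
  have h0 : HasMFDerivAt 𝓘(ℝ, E) 𝓘(ℝ, F) f (g * 1 * g⁻¹) L := by
    rwa [show g * 1 * g⁻¹ = 1 by simp]
  have h1 : HasMFDerivAt 𝓘(ℝ, F) 𝓘(ℝ, F) (fun x : H => f g * x * (f g)⁻¹) (f 1)
      (AdL ℝ (E := F) (f g)) := by
    rw [map_one]; exact hasMFDerivAt_AdL (f g)
  have h2 := h1.comp (1 : G) hf
  have h3 := h0.comp (1 : G) (hasMFDerivAt_AdL g)
  have h4 : ((fun x : H => f g * x * (f g)⁻¹) ∘ f) = (f ∘ fun x => g * x * g⁻¹) := by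
    ext x; simp
  rw [h4] at h2
  exact congrArg (fun M : E →L[ℝ] F => M Y) (hasMFDerivAt_unique h2 h3)

/-- Differentiate Ad(exp(s L X)) (L Y) = L (Ad(exp(s X)) Y) at s = 0. -/
theorem dAd_map {F H : Type*} [NormedAddCommGroup F] [NormedSpace ℝ F] [CompleteSpace F]
    [TopologicalSpace H] [ChartedSpace F H] [Group H] [LieGroup 𝓘(ℝ, F) ∞ H]
    (f : G →* H) {L : E →L[ℝ] F} (hf : HasMFDerivAt 𝓘(ℝ, E) 𝓘(ℝ, F) f 1 L) (X Y : E) :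
    dAd ℝ (E := F) H (L X) (L Y) = L (dAd ℝ (E := E) G X Y) := by
  have h1 : ∀ s : ℝ, AdL ℝ (gexp (G := H) (s • L X)) (L Y) = L (AdL ℝ (gexp (G := G) (s • X)) Y) := by
    intro s
    rw [← map_smul, ← map_gexp f hf]
    exact AdL_map f hf _ _
  have h2 := (hasDerivAt_AdL_gexp (G := H) (L X) 0).clm_apply (hasDerivAt_const (0 : ℝ) (L Y))
  have h3 := L.hasFDerivAt.comp_hasDerivAt (0 : ℝ)
    ((hasDerivAt_AdL_gexp (G := G) X 0).clm_apply (hasDerivAt_const (0 : ℝ) Y))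
  have h4 := h2.unique (h3.congr_of_eventuallyEq (Eventually.of_forall h1))
  simpa [gexp_zero, AdL_one] using h4

end SL2

/-! ### Complex linearity of Ad and the decomposition in a complex group -/

section Complex
variable {F : Type*} [NormedAddCommGroup F] [NormedSpace ℂ F]
  {H : Type*} [TopologicalSpace H] [ChartedSpace F H] [Group H] [LieGroup 𝓘(ℂ, F) ∞ H]
  [LieGroup 𝓘(ℝ, F) ∞ H]

/-- Conjugation is holomorphic, so its real derivative is the restriction of scalars of its complex
one. -/
theorem AdL_smul_complex (g : H) (c : ℂ) (Y : F) :
    AdL ℝ (E := F) g (c • Y) = c • AdL ℝ (E := F) g Y := by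
  have h0 : MDifferentiableAt 𝓘(ℂ, F) 𝓘(ℂ, F) (fun x : H => g * x * g⁻¹) 1 := by
    have h1 : ContMDiff 𝓘(ℂ, F) 𝓘(ℂ, F) ∞ (fun x : H => g * x * g⁻¹) :=
      (contMDiff_const.mul contMDiff_id).mul contMDiff_const
    exact (h1 1).mdifferentiableAt (by simp)
  have h1 : AdL ℝ (E := F) g = (AdL ℂ (E := F) g).restrictScalars ℝ :=
    hasMFDerivAt_unique (hasMFDerivAt_AdL g) (hasMFDerivAt_restrictScalars h0.hasMFDerivAt)
  have h2 : ∀ Z : F, AdL ℝ (E := F) g Z = AdL ℂ (E := F) g Z := fun Z => by rw [h1]; rfl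
  rw [h2, h2, map_smul]

variable [CompleteSpace F]

theorem dAd_smul_complex_right (c : ℂ) (X Y : F) :
    dAd ℝ (E := F) H X (c • Y) = c • dAd ℝ (E := F) H X Y := by
  have h1 := (hasDerivAt_AdL_gexp (G := H) X 0).clm_apply (hasDerivAt_const (0 : ℝ) (c • Y))
  have h2 := ((hasDerivAt_AdL_gexp (G := H) X 0).clm_apply
    (hasDerivAt_const (0 : ℝ) Y)).const_smul c
  have h3 := h1.unique (h2.congr_of_eventuallyEq
    (Eventually.of_forall fun s => AdL_smul_complex _ c Y))
  simpa [gexp_zero, AdL_one] using h3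

theorem dAd_smul_complex_left (c : ℂ) (X Y : F) :
    dAd ℝ (E := F) H (c • X) Y = c • dAd ℝ (E := F) H X Y := by
  rw [dAd_swap, dAd_smul_complex_right, dAd_swap Y X, smul_neg, neg_neg]

theorem sl2_decomposition_complex {h e f : F} (he : dAd ℝ (E := F) H h e = (2 : ℝ) • e)
    (hf : dAd ℝ (E := F) H h f = -((2 : ℝ) • f)) (hef : dAd ℝ (E := F) H e f = h) (w : ℝ) :
    gexp (G := H) (Real.tanh w • Complex.I • e) =
      gexp ((-(1 / 2) * Real.log (Real.cosh w)) • h) * gexp ((-(Real.pi / 4)) • (e - f)) *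
        gexp ((1 / 2 * Real.arctan (Real.sinh w)) • Complex.I • h) *
        (gexp ((Real.pi / 4) • (e - f)) * gexp ((w / 2) • Complex.I • (e - f))) := by
  have hself : ∀ X : F, dAd ℝ (E := F) H X X = 0 := fun X => by
    have h := dAd_swap (G := H) X X
    rw [eq_neg_iff_add_eq_zero, ← two_smul ℝ] at h
    simpa using h
  have hfe : dAd ℝ (E := F) H f e = -h := by rw [dAd_swap, hef]
  have heh : dAd ℝ (E := F) H e h = -((2 : ℝ) • e) := by rw [dAd_swap, he]
  have hfh : dAd ℝ (E := F) H f h = (2 : ℝ) • f := by rw [dAd_swap, hf, neg_neg]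
  have hI : ∀ X : F, Complex.I • Complex.I • X = -X := fun X => by
    rw [smul_smul, Complex.I_mul_I, neg_one_smul]
  have hUP : dAd ℝ (E := F) H (e - f) (e + f) = (2 : ℝ) • h := by
    simp only [map_sub, map_add, _root_.sub_apply, hself, hef, hfe]; module
  have hUh : dAd ℝ (E := F) H (e - f) h = -((2 : ℝ) • (e + f)) := by
    simp only [map_sub, _root_.sub_apply, heh, hfh]; module
  have hhP : dAd ℝ (E := F) H h (e + f) = (2 : ℝ) • (e - f) := by
    simp only [map_add, he, hf]; module
  have hhU : dAd ℝ (E := F) H h (e - f) = (2 : ℝ) • (e + f) := by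
    simp only [map_sub, he, hf]; module
  have := sl2_decomposition (G := H) (h := h) (P := e + f) (U := e - f) (h' := Complex.I • h)
    (P' := Complex.I • (e + f)) (U' := Complex.I • (e - f)) hUP hUh
    (by rw [dAd_smul_complex_right, hself, smul_zero])
    (by rw [dAd_smul_complex_right, hUP, smul_comm])
    (by rw [dAd_smul_complex_right, hUh, smul_neg, smul_comm])
    (by rw [dAd_smul_complex_left, hhP, smul_comm])
    (by rw [dAd_smul_complex_left, dAd_smul_complex_right, hhU, hI])
    (by rw [dAd_smul_complex_left, dAd_smul_complex_right, hUP, hI])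
    (by rw [dAd_smul_complex_left, hUh, smul_neg, smul_comm])
    (by rw [dAd_smul_complex_left, dAd_smul_complex_right, hself, smul_zero, smul_zero]) w
  rw [← this]
  congr 2
  rw [← smul_add, smul_comm (1 / 2 : ℝ)]
  congr 1
  module

end Complex

/-! ### Compatibility of exponentials and brackets with the complexification -/

section Complexification
variable {E : Type*} [NormedAddCommGroup E] [NormedSpace ℝ E] [CompleteSpace E]
  {G : Type*} [TopologicalSpace G] [ChartedSpace E G] [Group G] [LieGroup 𝓘(ℝ, E) ∞ G]
  {F : Type*} [NormedAddCommGroup F] [NormedSpace ℂ F]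
  {GC : Type*} [TopologicalSpace GC] [ChartedSpace F GC] [Group GC]

/-- The derivative of `ι` at `1` as a continuous linear map between the model spaces. -/
def dL (ι : G →* GC) : E →L[ℝ] F := mfderiv 𝓘(ℝ, E) 𝓘(ℝ, F) ι 1

omit [CompleteSpace E] [LieGroup 𝓘(ℝ, E) ∞ G] in
theorem IsComplexification.hasMFDerivAt {ι : G →* GC}
    (hι : IsComplexification (E := E) (F := F) ι) :
    HasMFDerivAt 𝓘(ℝ, E) 𝓘(ℝ, F) ι 1 (dL (E := E) (F := F) ι) :=
  ((hι.contMDiff 1).mdifferentiableAt (by simp)).hasMFDerivAt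

variable [LieGroup 𝓘(ℝ, F) ∞ GC] [CompleteSpace F]

theorem IsComplexification.map_gexp {ι : G →* GC}
    (hι : IsComplexification (E := E) (F := F) ι) (X : E) :
    ι (gexp X) = gexp (dL (E := E) (F := F) ι X) :=
  CrownDomain.map_gexp ι hι.hasMFDerivAt X

theorem IsComplexification.dAd_dL {ι : G →* GC}
    (hι : IsComplexification (E := E) (F := F) ι) (X Y : GroupLieAlgebra 𝓘(ℝ, E) G) :
    dAd ℝ (E := F) GC (dL (E := E) (F := F) ι X) (dL (E := E) (F := F) ι Y) =
      dL (E := E) (F := F) ι (⁅X, Y⁆ : GroupLieAlgebra 𝓘(ℝ, E) G) :=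
  (dAd_map ι hι.hasMFDerivAt X Y).trans
    (congrArg (dL (E := E) (F := F) ι) (bracket_eq_dAd X Y).symm)

omit [LieGroup 𝓘(ℝ, F) ∞ GC] [CompleteSpace F] in
theorem gexp_mem_KC {ι : G →* GC}
    {θ : GroupLieAlgebra 𝓘(ℝ, E) G →ₗ⁅ℝ⁆ GroupLieAlgebra 𝓘(ℝ, E) G}
    {X Y : GroupLieAlgebra 𝓘(ℝ, E) G} (hX : X ∈ partK θ) (hY : Y ∈ partK θ) :
    gexp (G := GC) (dL (E := E) (F := F) ι X + Complex.I • dL (E := E) (F := F) ι Y) ∈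
      KC (F := F) ι θ :=
  Subgroup.subset_closure ⟨X, hX, Y, hY, rfl⟩

end Complexification

/-! ### Several commuting triples -/

section StronglyOrthogonal
variable {F : Type*} [NormedAddCommGroup F] [NormedSpace ℂ F]
  {H : Type*} [TopologicalSpace H] [ChartedSpace F H] [Group H] [LieGroup 𝓘(ℂ, F) ∞ H]
  [LieGroup 𝓘(ℝ, F) ∞ H] [CompleteSpace F]

/-- The product over commuting `𝔰𝔩(2)`-triples of the decompositions `sl2_decomposition_complex`. -/
theorem exists_decomposition_of_commuting {σ : Type*} [DecidableEq σ] {h e f : σ → F}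
    (he : ∀ j, dAd ℝ (E := F) H (h j) (e j) = (2 : ℝ) • e j)
    (hf : ∀ j, dAd ℝ (E := F) H (h j) (f j) = -((2 : ℝ) • f j))
    (hef : ∀ j, dAd ℝ (E := F) H (e j) (f j) = h j)
    (hcomm : ∀ i j, i ≠ j → ∀ X ∈ ({h i, e i, f i} : Set F), ∀ Y ∈ ({h j, e j, f j} : Set F),
      dAd ℝ (E := F) H X Y = 0)
    (A K : Subgroup H) (hAh : ∀ j (c : ℝ), gexp (c • h j) ∈ A)
    (hAU : ∀ j (c : ℝ), gexp (c • (e j - f j)) ∈ A)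
    (hKU : ∀ j (c : ℝ), gexp (c • (e j - f j)) ∈ K)
    (hKU' : ∀ j (c : ℝ), gexp (c • Complex.I • (e j - f j)) ∈ K) (w : σ → ℝ) (s : Finset σ) :
    ∃ a ∈ A, ∃ k ∈ K,
      gexp (G := H) (∑ j ∈ s, Real.tanh (w j) • Complex.I • e j) =
        a * gexp (∑ j ∈ s, (1 / 2 * Real.arctan (Real.sinh (w j))) • Complex.I • h j) * k ∧
      ∀ Z : F, (∀ j ∈ s, ∀ X ∈ ({h j, e j, f j} : Set F), dAd ℝ (E := F) H X Z = 0) →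
        Commute k (gexp Z) := by
  induction s using Finset.induction_on with
  | empty => exact ⟨1, A.one_mem, 1, K.one_mem, by simp [gexp_zero], fun Z _ => Commute.one_left _⟩
  | insert i s hi ih =>
    obtain ⟨a, ha, k, hk, hd, hc⟩ := ih
    have hne : ∀ j ∈ s, j ≠ i := fun j hj hji => hi (hji ▸ hj)
    have hmem : ∀ j, h j ∈ ({h j, e j, f j} : Set F) ∧ e j ∈ ({h j, e j, f j} : Set F) ∧
      f j ∈ ({h j, e j, f j} : Set F) := fun j => by simp
    have hch : ∀ j ∈ s, ∀ X ∈ ({h j, e j, f j} : Set F), dAd ℝ (E := F) H X (h i) = 0 :=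
      fun j hj X hX => hcomm j i (hne j hj) X hX _ (hmem i).1
    have hce : ∀ j ∈ s, ∀ X ∈ ({h j, e j, f j} : Set F), dAd ℝ (E := F) H X (e i) = 0 :=
      fun j hj X hX => hcomm j i (hne j hj) X hX _ (hmem i).2.1
    have hcf : ∀ j ∈ s, ∀ X ∈ ({h j, e j, f j} : Set F), dAd ℝ (E := F) H X (f i) = 0 :=
      fun j hj X hX => hcomm j i (hne j hj) X hX _ (hmem i).2.2
    have hcU : ∀ j ∈ s, ∀ X ∈ ({h j, e j, f j} : Set F), dAd ℝ (E := F) H X (e i - f i) = 0 :=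
      fun j hj X hX => by rw [map_sub, hce j hj X hX, hcf j hj X hX, sub_zero]
    have hsum : ∀ (c : σ → ℝ) (X : σ → F) (Y : F),
        (∀ j ∈ s, dAd ℝ (E := F) H (X j) Y = 0) →
        dAd ℝ (E := F) H (∑ j ∈ s, c j • Complex.I • X j) Y = 0 := by
      intro c X Y hXY
      rw [map_sum, _root_.sum_apply]
      refine Finset.sum_eq_zero fun j hj => ?_
      rw [map_smul, _root_.smul_apply, dAd_smul_complex_left, hXY j hj, smul_zero, smul_zero]
    have h1 := gexp_add (G := H)
      (X := ∑ j ∈ s, Real.tanh (w j) • Complex.I • e j)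
      (Y := Real.tanh (w i) • Complex.I • e i)
      (hsum _ _ _ fun j hj => by
        rw [map_smul, dAd_smul_complex_right, hce j hj _ (hmem j).2.1, smul_zero, smul_zero])
    have h2 := gexp_add (G := H)
      (X := ∑ j ∈ s, (1 / 2 * Real.arctan (Real.sinh (w j))) • Complex.I • h j)
      (Y := (1 / 2 * Real.arctan (Real.sinh (w i))) • Complex.I • h i)
      (hsum _ _ _ fun j hj => by
        rw [map_smul, dAd_smul_complex_right, hch j hj _ (hmem j).1, smul_zero, smul_zero])
    have h3 := sl2_decomposition_complex (H := H) (he i) (hf i) (hef i) (w i)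
    set ah := gexp (G := H) ((-(1 / 2) * Real.log (Real.cosh (w i))) • h i)
    set au := gexp (G := H) ((-(Real.pi / 4)) • (e i - f i))
    set ti := gexp (G := H) ((1 / 2 * Real.arctan (Real.sinh (w i))) • Complex.I • h i)
    set ts := gexp (G := H) (∑ j ∈ s, (1 / 2 * Real.arctan (Real.sinh (w j))) • Complex.I • h j)
    set k1 := gexp (G := H) ((Real.pi / 4) • (e i - f i))
    set k2 := gexp (G := H) ((w i / 2) • Complex.I • (e i - f i))
    -- The K_ℂ-part k collected so far must pass the new factors so that real factors stay left and
    -- K_ℂ-factors right. The commutation clause in the statement is carried through the induction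
    -- for this purpose.
    have c1 : Commute k ah := hc _ fun j hj X hX => by rw [map_smul, hch j hj X hX, smul_zero]
    have c2 : Commute k au := hc _ fun j hj X hX => by rw [map_smul, hcU j hj X hX, smul_zero]
    have c3 : Commute k ti := hc _ fun j hj X hX => by
      rw [map_smul, dAd_smul_complex_right, hch j hj X hX, smul_zero, smul_zero]
    have c4 : Commute ts ah := commute_gexp (hsum _ _ _ fun j hj => by
      rw [map_smul, hch j hj _ (hmem j).1, smul_zero])
    have c5 : Commute ts au := commute_gexp (hsum _ _ _ fun j hj => by
      rw [map_smul, hcU j hj _ (hmem j).1, smul_zero])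
    refine ⟨a * (ah * au), A.mul_mem ha (A.mul_mem (hAh _ _) (hAU _ _)), k * (k1 * k2),
      K.mul_mem hk (K.mul_mem (hKU _ _) (hKU' _ _)), ?_, ?_⟩
    · rw [Finset.sum_insert hi, Finset.sum_insert hi, add_comm, h1, add_comm (_ • _ • h i), h2, hd,
        h3]
      calc a * ts * k * (ah * au * ti * (k1 * k2))
          = a * ts * (k * (ah * au * ti)) * (k1 * k2) := by group
        _ = a * ts * (ah * au * ti * k) * (k1 * k2) := by
          rw [((c1.mul_right c2).mul_right c3).eq]
        _ = a * (ts * (ah * au)) * ti * k * (k1 * k2) := by group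
        _ = a * (ah * au * ts) * ti * k * (k1 * k2) := by rw [(c4.mul_right c5).eq]
        _ = a * (ah * au) * (ts * ti) * (k * (k1 * k2)) := by group
    · intro Z hZ
      have hU : dAd ℝ (E := F) H (e i - f i) Z = 0 := by
        rw [map_sub, _root_.sub_apply, hZ i (Finset.mem_insert_self _ _) _ (hmem i).2.1,
          hZ i (Finset.mem_insert_self _ _) _ (hmem i).2.2, sub_zero]
      refine (hc Z fun j hj => hZ j (Finset.mem_insert_of_mem hj)).mul_left
        (Commute.mul_left (commute_gexp ?_) (commute_gexp ?_))
      · rw [map_smul, _root_.smul_apply, hU, smul_zero]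
      · rw [map_smul, _root_.smul_apply, dAd_smul_complex_left, hU, smul_zero, smul_zero]

end StronglyOrthogonal

/-! ### From decompositions to equality of G-orbits -/

section Orbits
variable {E : Type*} [NormedAddCommGroup E] [NormedSpace ℝ E] [CompleteSpace E]
  {G : Type*} [TopologicalSpace G] [ChartedSpace E G] [Group G] [LieGroup 𝓘(ℝ, E) ∞ G]
  {F : Type*} [NormedAddCommGroup F] [NormedSpace ℂ F] [CompleteSpace F]
  {GC : Type*} [TopologicalSpace GC] [ChartedSpace F GC] [Group GC] [LieGroup 𝓘(ℂ, F) ∞ GC]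

omit [CompleteSpace F] [LieGroup 𝓘(ℂ, F) ∞ GC] in
theorem orbitExp_singleton_subset {ι : G →* GC}
    {θ : GroupLieAlgebra 𝓘(ℝ, E) G →ₗ⁅ℝ⁆ GroupLieAlgebra 𝓘(ℝ, E) G}
    {X Y : GroupLieAlgebra 𝓘(ℝ, E) G} {a : G} {k : GC} (hk : k ∈ KC (F := F) ι θ)
    (h : complexExp (F := F) (Complex.I • dLie ι X) =
      ι a * complexExp (F := F) (Complex.I • dLie ι Y) * k) :
    orbitExp (F := F) ι θ {X} ⊆ orbitExp (F := F) ι θ {Y} := by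
  rintro _ ⟨g, _, rfl, rfl⟩
  refine ⟨g * a, Y, rfl, ?_⟩
  rw [h, QuotientGroup.eq]
  simp only [map_mul, mul_inv_rev, mul_assoc, inv_mul_cancel_left]
  simpa using hk

omit [CompleteSpace F] [LieGroup 𝓘(ℂ, F) ∞ GC] in
theorem orbitExp_singleton_eq {ι : G →* GC}
    {θ : GroupLieAlgebra 𝓘(ℝ, E) G →ₗ⁅ℝ⁆ GroupLieAlgebra 𝓘(ℝ, E) G}
    {X Y : GroupLieAlgebra 𝓘(ℝ, E) G} {a : G} {k : GC} (hk : k ∈ KC (F := F) ι θ)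
    (h : complexExp (F := F) (Complex.I • dLie ι X) =
      ι a * complexExp (F := F) (Complex.I • dLie ι Y) * k) :
    orbitExp (F := F) ι θ {X} = orbitExp (F := F) ι θ {Y} := by
  refine (orbitExp_singleton_subset hk h).antisymm
    (orbitExp_singleton_subset (a := a⁻¹) (k := k⁻¹) (inv_mem hk) ?_)
  rw [h, map_inv]; group

/-- `𝔰𝔩(2)`-triples `(H_j, E_j, -θ E_j)` which commute for different `j`. -/
structure IsCommutingSl2Family {𝔤 : Type*} [LieRing 𝔤] [LieAlgebra ℝ 𝔤] (θ : 𝔤 →ₗ⁅ℝ⁆ 𝔤)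
    {σ : Type*} (h e : σ → 𝔤) : Prop where
  triple : ∀ j, IsSl2Triple (h j) (e j) (-θ (e j))
  lie_eq_zero : ∀ i j, i ≠ j → ∀ X ∈ ({h i, e i, -θ (e i)} : Set 𝔤),
    ∀ Y ∈ ({h j, e j, -θ (e j)} : Set 𝔤), ⁅X, Y⁆ = 0

theorem orbitExp_eq_of_isCommutingSl2Family {ι : G →* GC}
    (hι : IsComplexification (E := E) (F := F) ι)
    {θ : GroupLieAlgebra 𝓘(ℝ, E) G →ₗ⁅ℝ⁆ GroupLieAlgebra 𝓘(ℝ, E) G} (hθ : ∀ X, θ (θ X) = X)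
    {n : ℕ} {h e : Fin n → GroupLieAlgebra 𝓘(ℝ, E) G} (hfam : IsCommutingSl2Family θ h e)
    (t : Fin n → ℝ) (ht : ∀ j, |t j| < Real.pi / 4) :
    orbitExp (F := F) ι θ {∑ j, Real.sin (2 * t j) • e j} =
      orbitExp (F := F) ι θ {∑ j, t j • h j} := by
  have : LieGroup 𝓘(ℝ, F) ∞ GC := lieGroup_restrictScalars
  let L : GroupLieAlgebra 𝓘(ℝ, E) G →ₗ[ℝ] F := (dL (E := E) (F := F) ι).toLinearMap
  have hb : ∀ X Y Z : GroupLieAlgebra 𝓘(ℝ, E) G, ⁅X, Y⁆ = Z →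
      dAd ℝ (E := F) GC (L X) (L Y) = L Z := fun X Y Z hZ => by
    rw [← hZ]; exact hι.dAd_dL X Y
  let f : Fin n → GroupLieAlgebra 𝓘(ℝ, E) G := fun j => -θ (e j)
  have hKmem : ∀ j (c : ℝ), c • (e j - f j) ∈ partK θ := fun j c => by
    rw [partK, Module.End.mem_eigenspace_iff]
    simp [f, hθ, add_comm]
  have hLU : ∀ j (c : ℝ), c • (L (e j) - L (f j)) = L (c • (e j - f j)) :=
    fun j c => by rw [← map_sub, ← map_smul]
  have hw : ∀ j, ∃ w : ℝ, Real.tanh w = Real.sin (2 * t j) ∧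
      1 / 2 * Real.arctan (Real.sinh w) = t j := by
    intro j
    obtain ⟨h1, h2⟩ := abs_lt.1 (ht j)
    -- This w satisfies arctan(sinh w) = 2t because |2t| < π/2; hence tanh w = sin 2t.
    refine ⟨Real.arsinh (Real.tan (2 * t j)), ?_, ?_⟩
    · rw [← sin_arctan_sinh, Real.sinh_arsinh, Real.arctan_tan] <;> linarith
    · rw [Real.sinh_arsinh, Real.arctan_tan] <;> linarith
  choose w hw1 hw2 using hw
  -- The subgroups are ι(G) and K_ℂ. The element e - f = e + θ e is fixed by θ, so its exponentials
  -- lie in both, and those of its multiples by i lie in K_ℂ.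
  obtain ⟨a, ⟨g, rfl⟩, k, hk, hdec, -⟩ := exists_decomposition_of_commuting (H := GC)
    (h := fun j => L (h j)) (e := fun j => L (e j)) (f := fun j => L (f j))
    (fun j => (hb _ _ ((2 : ℝ) • e j)
      (by rw [(hfam.triple j).lie_h_e_nsmul, ← Nat.cast_smul_eq_nsmul ℝ]; norm_num)).trans
        (map_smul L (2 : ℝ) (e j)))
    (fun j => (hb _ _ (-((2 : ℝ) • f j))
      (by rw [(hfam.triple j).lie_h_f_nsmul, ← Nat.cast_smul_eq_nsmul ℝ]; norm_num [f])).trans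
        (by rw [map_neg, map_smul]))
    (fun j => hb _ _ _ (hfam.triple j).lie_e_f)
    (by
      rintro i j hij X hX Y hY
      have hX' : ∃ X', X' ∈ ({h i, e i, -θ (e i)} : Set (GroupLieAlgebra 𝓘(ℝ, E) G)) ∧ X = L X' := by
        rcases hX with rfl | rfl | rfl
        exacts [⟨h i, by simp, rfl⟩, ⟨e i, by simp, rfl⟩, ⟨f _, by simp [f], rfl⟩]
      have hY' : ∃ Y', Y' ∈ ({h j, e j, -θ (e j)} : Set (GroupLieAlgebra 𝓘(ℝ, E) G)) ∧ Y = L Y' := by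
        rcases hY with rfl | rfl | rfl
        exacts [⟨h j, by simp, rfl⟩, ⟨e j, by simp, rfl⟩, ⟨f _, by simp [f], rfl⟩]
      obtain ⟨X', hX', rfl⟩ := hX'
      obtain ⟨Y', hY', rfl⟩ := hY'
      exact (hb _ _ 0 (hfam.lie_eq_zero i j hij X' hX' Y' hY')).trans (map_zero L))
    ι.range (KC (F := F) ι θ)
    (fun j c => ⟨gexp (E := E) (c • h j), (hι.map_gexp _).trans
      (congrArg gexp (map_smul L c (h j)))⟩)
    (fun j c => ⟨gexp (E := E) (c • (e j - f j)), (hι.map_gexp _).trans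
      (congrArg gexp (hLU j c).symm)⟩)
    (fun j c => by
      have := gexp_mem_KC (F := F) (ι := ι) (θ := θ) (hKmem j c) (zero_mem _)
      change gexp (L _ + Complex.I • L 0) ∈ _ at this
      rwa [map_zero, smul_zero, add_zero, ← hLU] at this)
    (fun j c => by
      have := gexp_mem_KC (F := F) (ι := ι) (θ := θ) (zero_mem _) (hKmem j c)
      change gexp (L 0 + Complex.I • L _) ∈ _ at this
      rwa [map_zero, zero_add, ← hLU, smul_comm] at this)
    w Finset.univ
  have hsum : ∀ (c : Fin n → ℝ) (X : Fin n → GroupLieAlgebra 𝓘(ℝ, E) G),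
      Complex.I • L (∑ j, c j • X j) = ∑ j, c j • Complex.I • L (X j) := by
    intro c X
    simp only [map_sum, map_smul, Finset.smul_sum]
    exact Finset.sum_congr rfl fun j _ => smul_comm _ _ _
  simp only [hw1, hw2] at hdec
  rw [← hsum, ← hsum] at hdec
  exact orbitExp_singleton_eq hk hdec

end Orbits

/-! ### Cartan involutions and restricted root spaces -/

section LieAlg
variable {𝔤 : Type*} [LieRing 𝔤] [LieAlgebra ℝ 𝔤]

namespace IsCartanInvolution
variable {θ : 𝔤 →ₗ⁅ℝ⁆ 𝔤}

/-- A Cartan involution as an automorphism. -/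
def equiv (hθ : IsCartanInvolution θ) : 𝔤 ≃ₗ⁅ℝ⁆ 𝔤 :=
  { θ with
    invFun := θ
    left_inv := hθ.involutive
    right_inv := hθ.involutive }

theorem killingForm_map (hθ : IsCartanInvolution θ) (X Y : 𝔤) :
    killingForm ℝ 𝔤 (θ X) (θ Y) = killingForm ℝ 𝔤 X Y :=
  LieAlgebra.killingForm_of_equiv_apply hθ.equiv X Y

theorem killingForm_map_comm (hθ : IsCartanInvolution θ) (X Y : 𝔤) :
    killingForm ℝ 𝔤 Y (θ X) = killingForm ℝ 𝔤 X (θ Y) := by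
  rw [LieModule.traceForm_comm, ← hθ.killingForm_map, hθ.involutive]

/-- The inner product `-B(X, θ Y)`. -/
@[reducible]
def core (hθ : IsCartanInvolution θ) : InnerProductSpace.Core ℝ 𝔤 where
  inner X Y := -killingForm ℝ 𝔤 X (θ Y)
  conj_inner_symm X Y := by simp [hθ.killingForm_map_comm X Y]
  re_inner_nonneg X := by
    by_cases h : X = 0
    · simp [h]
    · simpa using (hθ.killing_neg X h).le
  add_left X Y Z := by rw [map_add, LinearMap.add_apply, neg_add]
  smul_left X Y r := by simp
  definite X hX := by
    by_contra h
    have := hθ.killing_neg X h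
    simp at hX
    linarith

/-- A commuting family in `𝔭` acts by simultaneously diagonalizable operators. -/
theorem iSup_iInf_eigenspace_ad [FiniteDimensional ℝ 𝔤] (hθ : IsCartanInvolution θ) {σ : Type*}
    (H : σ → 𝔤) (hp : ∀ j, H j ∈ partP θ) (hcomm : ∀ i j, ⁅H i, H j⁆ = 0) :
    ⨆ χ : σ → ℝ, ⨅ j, Module.End.eigenspace (LieAlgebra.ad ℝ 𝔤 (H j)) (χ j) = ⊤ := by
  -- ad H is symmetric for -B(X, θY): invariance of B contributes one sign and θH = -H the other.
  have hsymm : ∀ j X Y, -killingForm ℝ 𝔤 ⁅H j, X⁆ (θ Y) = -killingForm ℝ 𝔤 X (θ ⁅H j, Y⁆) := by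
    intro j X Y
    have h1 : θ (H j) = -H j := by
      have := hp j
      rw [partP, Module.End.mem_eigenspace_iff] at this
      simpa using this
    rw [LieHom.map_lie, h1, ← lie_skew, map_neg, LinearMap.neg_apply,
      LieModule.traceForm_apply_lie_apply, neg_lie, map_neg]
  have hc : ∀ i j, Commute (LieAlgebra.ad ℝ 𝔤 (H i)) (LieAlgebra.ad ℝ 𝔤 (H j)) := by
    intro i j
    refine LinearMap.ext fun X => ?_
    change ⁅H i, ⁅H j, X⁆⁆ = ⁅H j, ⁅H i, X⁆⁆
    rw [leibniz_lie, hcomm, zero_lie, zero_add]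
  let _ := hθ.core
  let _ : NormedAddCommGroup 𝔤 := InnerProductSpace.Core.toNormedAddCommGroup (𝕜 := ℝ)
  let _ : InnerProductSpace ℝ 𝔤 := InnerProductSpace.ofCore hθ.core.toCore
  exact LinearMap.IsSymmetric.iSup_iInf_eq_top_of_commute (𝕜 := ℝ) (E := 𝔤)
    (T := fun j => (LieAlgebra.ad ℝ 𝔤 (H j) : 𝔤 →ₗ[ℝ] 𝔤)) (fun j X Y => hsymm j X Y)
    (fun i j _ => hc i j)

end IsCartanInvolution

section RootSpaces
variable {θ : 𝔤 →ₗ⁅ℝ⁆ 𝔤} {𝔞 : Submodule ℝ 𝔤}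

theorem mem_partP {X : 𝔤} : X ∈ partP θ ↔ θ X = -X := by
  rw [partP, Module.End.mem_eigenspace_iff]; simp

theorem lie_mem_rootSpace {α β : Module.Dual ℝ 𝔞} {X Y : 𝔤} (hX : X ∈ rootSpace 𝔞 α)
    (hY : Y ∈ rootSpace 𝔞 β) : ⁅X, Y⁆ ∈ rootSpace 𝔞 (α + β) := fun H => by
  rw [leibniz_lie, hX H, hY H, smul_lie, lie_smul, LinearMap.add_apply, add_smul]

theorem map_mem_rootSpace (h𝔞 : 𝔞 ≤ partP θ) {α : Module.Dual ℝ 𝔞} {X : 𝔤}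
    (hX : X ∈ rootSpace 𝔞 α) : θ X ∈ rootSpace 𝔞 (-α) := fun H => by
  have h1 := mem_partP.1 (h𝔞 H.2)
  have h2 := congrArg θ (hX H)
  rw [LieHom.map_lie, h1, neg_lie, map_smul] at h2
  rw [LinearMap.neg_apply, neg_smul, ← h2, neg_neg]

theorem lie_eq_zero_of_not_mem_restrictedRoots {α β : Module.Dual ℝ 𝔞} {X Y : 𝔤}
    (hX : X ∈ rootSpace 𝔞 α) (hY : Y ∈ rootSpace 𝔞 β) (h0 : α + β ≠ 0)
    (h : α + β ∉ restrictedRoots 𝔞) : ⁅X, Y⁆ = 0 := by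
  have h1 : rootSpace 𝔞 (α + β) = ⊥ := by
    by_contra h2
    exact h ⟨h0, h2⟩
  have h2 := lie_mem_rootSpace hX hY
  rwa [h1, Submodule.mem_bot] at h2

/-- For `E ∈ 𝔤^α` the element `[E, θ E]` belongs to `𝔞`. -/
theorem IsMaximalFlat.lie_map_mem (h𝔞 : IsMaximalFlat θ 𝔞) (hθ : IsCartanInvolution θ)
    {α : Module.Dual ℝ 𝔞} {X : 𝔤} (hX : X ∈ rootSpace 𝔞 α) : ⁅X, θ X⁆ ∈ 𝔞 := by
  have h1 : ∀ H ∈ 𝔞, ⁅H, ⁅X, θ X⁆⁆ = 0 := fun H hH => by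
    have := lie_mem_rootSpace hX (map_mem_rootSpace h𝔞.le_partP hX) ⟨H, hH⟩
    simpa using this
  have h2 : ⁅X, θ X⁆ ∈ partP θ := by
    rw [mem_partP, LieHom.map_lie, hθ.involutive, lie_skew]
  -- The element [X, θX] lies in 𝔭 and commutes with 𝔞, so adjoining it gives an abelian subspace of
  -- 𝔭, which must be 𝔞.
  have h3 := h𝔞.maximal (𝔞 ⊔ Submodule.span ℝ {⁅X, θ X⁆})
    (sup_le h𝔞.le_partP (by simpa using h2)) (by
      intro A hA B hB
      obtain ⟨a, ha, _, hz, rfl⟩ := Submodule.mem_sup.1 hA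
      obtain ⟨b, hb, _, hw, rfl⟩ := Submodule.mem_sup.1 hB
      obtain ⟨r, rfl⟩ := Submodule.mem_span_singleton.1 hz
      obtain ⟨s, rfl⟩ := Submodule.mem_span_singleton.1 hw
      have h4 : ⁅⁅X, θ X⁆, b⁆ = 0 := by rw [← lie_skew, h1 b hb, neg_zero]
      simp only [add_lie, lie_add, h𝔞.abelian a ha b hb, lie_smul, smul_lie, h1 a ha, h4,
        lie_self, smul_zero, add_zero]) le_sup_left
  rw [← h3]
  exact Submodule.mem_sup_right (Submodule.mem_span_singleton_self _)

end RootSpaces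

end LieAlg

/-! ### Strong orthogonality of the roots 2γ_j -/

section TypeC
variable {𝔤 : Type*} [LieRing 𝔤] [LieAlgebra ℝ 𝔤] {θ : 𝔤 →ₗ⁅ℝ⁆ 𝔤} {𝔞 : Submodule ℝ 𝔤}
  {n : ℕ} {γ : Fin n → Module.Dual ℝ 𝔞} {T : Fin n → 𝔞}

/-- A common form for types C and BC, with i = j allowed. It suffices both for excluding ±2γ_i ±
2γ_j and for bounding the eigenvalues of ad Y. -/
theorem exists_eq_of_mem_restrictedRoots
    (hR : restrictedRoots 𝔞 = typeC γ ∨ restrictedRoots 𝔞 = typeBC γ) {α : Module.Dual ℝ 𝔞}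
    (hα : α ∈ restrictedRoots 𝔞) :
    ∃ (i j : Fin n) (r s : ℝ), |r| ≤ 1 ∧ |s| ≤ 1 ∧ α = r • γ i + s • γ j := by
  have hC : α ∈ typeC γ → ∃ (i j : Fin n) (r s : ℝ), |r| ≤ 1 ∧ |s| ≤ 1 ∧
      α = r • γ i + s • γ j := by
    rintro ⟨-, i, j, h | h | h | h⟩
    · exact ⟨i, j, 1, 1, by simp, by simp, by rw [h]; module⟩
    · exact ⟨i, j, 1, -1, by simp, by simp, by rw [h]; module⟩
    · exact ⟨i, j, -1, 1, by simp, by simp, by rw [h]; module⟩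
    · exact ⟨i, j, -1, -1, by simp, by simp, by rw [h]; module⟩
  rcases hR with h | h
  · exact hC (h ▸ hα)
  · rw [h] at hα
    rcases hα with hα | ⟨i, h | h⟩
    · exact hC hα
    · exact ⟨i, i, 1, 0, by simp, by simp, by rw [h]; module⟩
    · exact ⟨i, i, -1, 0, by simp, by simp, by rw [h]; module⟩

variable (hT : ∀ i j, γ i (T j) = if i = j then 1 else 0)
include hT

theorem gamma_apply_sum (t : Fin n → ℝ) (i : Fin n) : γ i (∑ j, t j • T j) = t i := by
  simp [hT]

theorem two_smul_mem_restrictedRoots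
    (hR : restrictedRoots 𝔞 = typeC γ ∨ restrictedRoots 𝔞 = typeBC γ) (j : Fin n) :
    (2 : ℝ) • γ j ∈ restrictedRoots 𝔞 := by
  have h1 : (2 : ℝ) • γ j ∈ typeC γ := by
    refine ⟨fun h => ?_, j, j, Or.inl (two_smul ℝ _)⟩
    have := congrArg (fun f : Module.Dual ℝ 𝔞 => f (T j)) h
    simp [hT] at this
  rcases hR with h | h
  · exact h ▸ h1
  · exact h ▸ Or.inl h1

/-- Such a combination takes values of absolute value 2 on both T_i and T_j. A root uγ_a + vγ_b with
|u|, |v| ≤ 1 can do so on T_i only if a = b = i, and then it vanishes on T_j. -/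
theorem add_ne_zero_and_not_mem_restrictedRoots
    (hR : restrictedRoots 𝔞 = typeC γ ∨ restrictedRoots 𝔞 = typeBC γ) {i j : Fin n} (hij : i ≠ j)
    {r s : ℝ} (hr : |r| = 2) (hs : |s| = 2) :
    r • γ i + s • γ j ≠ 0 ∧ r • γ i + s • γ j ∉ restrictedRoots 𝔞 := by
  have hr0 : r ≠ 0 := by rintro rfl; simp at hr
  have hi : (r • γ i + s • γ j) (T i) = r := by simp [hT, hij.symm]
  have hj : (r • γ i + s • γ j) (T j) = s := by simp [hT, hij]
  refine ⟨fun h => hr0 (by rw [← hi, h]; rfl), fun h => ?_⟩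
  obtain ⟨a, b, u, v, hu, hv, h⟩ := exists_eq_of_mem_restrictedRoots hR h
  rw [h] at hi hj
  simp only [LinearMap.add_apply, LinearMap.smul_apply, hT, smul_eq_mul, mul_ite, mul_one,
    mul_zero] at hi hj
  rcases eq_or_ne a i with rfl | hai
  · rcases eq_or_ne b a with rfl | hbi
    · simp only [if_neg hij, add_zero] at hj
      rw [← hj] at hs; simp at hs
    · simp only [if_neg hbi, if_true, add_zero] at hi
      rw [hi] at hu; linarith
  · simp only [if_neg hai, zero_add] at hi
    split_ifs at hi
    · rw [hi] at hv; linarith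
    · exact hr0 hi.symm

theorem isCommutingSl2Family_of_isNormalized (h𝔞 : IsMaximalFlat θ 𝔞)
    (hR : restrictedRoots 𝔞 = typeC γ ∨ restrictedRoots 𝔞 = typeBC γ) {e : Fin n → 𝔤}
    (he : ∀ j, IsNormalized θ γ T j (e j)) :
    IsCommutingSl2Family θ (fun j => (T j : 𝔤)) e where
  triple j := (he j).2
  lie_eq_zero i j hij X hX Y hY := by
    have hs : ∀ i j : Fin n, i ≠ j → ∀ r s : ℝ, |r| = 2 → |s| = 2 → ∀ X Y : 𝔤,
        X ∈ rootSpace 𝔞 (r • γ i) → Y ∈ rootSpace 𝔞 (s • γ j) → ⁅X, Y⁆ = 0 :=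
      fun i j hij r s hr hs X Y hX hY =>
        have h := add_ne_zero_and_not_mem_restrictedRoots hT hR hij hr hs
        lie_eq_zero_of_not_mem_restrictedRoots hX hY h.1 h.2
    have hT' : ∀ i j : Fin n, i ≠ j → ∀ s : ℝ, ∀ Y : 𝔤, Y ∈ rootSpace 𝔞 (s • γ j) →
        ⁅(T i : 𝔤), Y⁆ = 0 := fun i j hij s Y hY => by
      rw [hY (T i)]; simp [hT, hij.symm]
    have he2 : ∀ j, e j ∈ rootSpace 𝔞 ((2 : ℝ) • γ j) := fun j => (he j).1
    have hf2 : ∀ j, -θ (e j) ∈ rootSpace 𝔞 ((-2 : ℝ) • γ j) := fun j => by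
      rw [show (-2 : ℝ) • γ j = -((2 : ℝ) • γ j) by module]
      exact neg_mem (map_mem_rootSpace h𝔞.le_partP (he j).1)
    rcases hX with rfl | rfl | rfl
    · rcases hY with rfl | rfl | rfl
      · exact h𝔞.abelian _ (T i).2 _ (T j).2
      · exact hT' i j hij _ _ (he2 j)
      · exact hT' i j hij _ _ (hf2 j)
    · rcases hY with rfl | rfl | rfl
      · rw [← lie_skew, hT' j i hij.symm _ _ (he2 i), neg_zero]
      · exact hs i j hij 2 2 (by simp) (by simp) _ _ (he2 i) (he2 j)
      · exact hs i j hij 2 (-2) (by simp) (by simp) _ _ (he2 i) (hf2 j)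
    · rcases hY with rfl | rfl | rfl
      · rw [← lie_skew, hT' j i hij.symm _ _ (hf2 i), neg_zero]
      · exact hs i j hij (-2) 2 (by simp) (by simp) _ _ (hf2 i) (he2 j)
      · exact hs i j hij (-2) (-2) (by simp) (by simp) _ _ (hf2 i) (hf2 j)

end TypeC

/-! ### Normalized root vectors and the polyhedron Ω in coordinates -/

section Basis
variable {𝔤 : Type*} [LieRing 𝔤] [LieAlgebra ℝ 𝔤] [FiniteDimensional ℝ 𝔤]
  {θ : 𝔤 →ₗ⁅ℝ⁆ 𝔤} {𝔞 : Submodule ℝ 𝔤}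
  {n : ℕ} {γ : Module.Basis (Fin n) ℝ (Module.Dual ℝ 𝔞)} {T : Fin n → 𝔞}
  (hT : ∀ i j, γ i (T j) = if i = j then 1 else 0)
include hT

omit [FiniteDimensional ℝ 𝔤] hT in
theorem eq_of_forall_gamma [FiniteDimensional ℝ 𝔞] {X Y : 𝔞} (h : ∀ i, γ i X = γ i Y) : X = Y := by
  rw [← sub_eq_zero, ← Module.forall_dual_apply_eq_zero_iff ℝ]
  intro f
  have h1 : ∀ i, Module.Dual.eval ℝ 𝔞 (X - Y) (γ i) = (0 : Module.Dual ℝ 𝔞 →ₗ[ℝ] ℝ) (γ i) := by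
    intro i; simp [h i]
  exact congrArg (fun L : Module.Dual ℝ 𝔞 →ₗ[ℝ] ℝ => L f) (γ.ext h1)

theorem eq_sum_gamma (H : 𝔞) : H = ∑ j, γ j H • T j :=
  eq_of_forall_gamma (γ := γ) fun i => by rw [gamma_apply_sum hT]

/-- For 0 ≠ E ∈ 𝔤^{2γ_j} the element Z = [E, θE] lies in 𝔞. By strong orthogonality it kills
𝔤^{2γ_i} for i ≠ j, so γ_i(Z) = 0 and Z is a multiple of T_j. From B(Z, H) = 2γ_j(H) B(E, θE), B(E,
θE) < 0 and B(Z, Z) > 0 the coefficient γ_j(Z) is negative; scaling E by (-γ_j(Z))^{-1/2} makes it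
-1. -/
theorem exists_isNormalized (hθ : IsCartanInvolution θ) (h𝔞 : IsMaximalFlat θ 𝔞)
    (hR : restrictedRoots 𝔞 = typeC γ ∨ restrictedRoots 𝔞 = typeBC γ) (j : Fin n) :
    ∃ E, IsNormalized θ γ T j E := by
  have hroot : ∀ i, ∃ X ∈ rootSpace 𝔞 ((2 : ℝ) • γ i), X ≠ 0 := fun i =>
    (Submodule.ne_bot_iff _).1 (two_smul_mem_restrictedRoots hT hR i).2
  obtain ⟨E, hE, hE0⟩ := hroot j
  have hθE := map_mem_rootSpace h𝔞.le_partP hE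
  set Z : 𝔞 := ⟨⁅E, θ E⁆, h𝔞.lie_map_mem hθ hE⟩ with hZ
  have hZi : ∀ i, i ≠ j → γ i Z = 0 := by
    intro i hij
    obtain ⟨X, hX, hX0⟩ := hroot i
    have h1 : ⁅E, X⁆ = 0 := by
      have h := add_ne_zero_and_not_mem_restrictedRoots hT hR hij.symm (r := 2) (s := 2)
        (by simp) (by simp)
      exact lie_eq_zero_of_not_mem_restrictedRoots hE hX h.1 h.2
    have h2 : ⁅θ E, X⁆ = 0 := by
      have h := add_ne_zero_and_not_mem_restrictedRoots hT hR hij.symm (r := -2) (s := 2)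
        (by simp) (by simp)
      rw [show (-2 : ℝ) • γ j = -((2 : ℝ) • γ j) by module] at h
      exact lie_eq_zero_of_not_mem_restrictedRoots hθE hX h.1 h.2
    have h3 := hX Z
    rw [hZ, lie_lie, h1, h2, lie_zero, lie_zero, sub_zero] at h3
    have h4 := (smul_eq_zero.1 h3.symm).resolve_right hX0
    simpa using h4
  set B := killingForm ℝ 𝔤
  have hB : B E (θ E) < 0 := hθ.killing_neg E hE0
  have hBZ : ∀ H : 𝔞, B Z H = 2 * γ j H * B E (θ E) := by
    intro H
    have h1 := hθE H
    change LieModule.traceForm ℝ 𝔤 𝔤 ⁅E, θ E⁆ H = _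
    rw [LieModule.traceForm_apply_lie_apply, ← lie_skew, h1]
    simp [B]
  have hc : γ j Z < 0 := by
    have h1 := hBZ Z
    have h2 : (Z : 𝔤) ≠ 0 := by
      intro h0
      have h3 := hBZ (T j)
      rw [h0, hT] at h3
      simp at h3
      exact hB.ne h3
    have h4 := hθ.killing_neg Z h2
    rw [mem_partP.1 (h𝔞.le_partP Z.2), map_neg] at h4
    change -(B Z Z) < 0 at h4
    nlinarith
  have hZT : Z = γ j Z • T j := by
    refine eq_of_forall_gamma (γ := γ) fun i => ?_
    rcases eq_or_ne i j with rfl | hij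
    · simp [hT]
    · simp [hT, hij, hZi i hij]
  have hZT' : ⁅E, θ E⁆ = γ j Z • (T j : 𝔤) := congrArg Subtype.val hZT
  have hr : (1 / √(-γ j Z)) * (1 / √(-γ j Z)) * γ j Z = -1 := by
    have h1 : √(-γ j Z) * √(-γ j Z) = -γ j Z := Real.mul_self_sqrt (by linarith)
    have h2 : √(-γ j Z) ≠ 0 := (Real.sqrt_pos.2 (by linarith)).ne'
    field_simp
    rw [pow_two, h1, neg_neg]
  have hE' : (1 / √(-γ j Z)) • E ∈ rootSpace 𝔞 ((2 : ℝ) • γ j) := Submodule.smul_mem _ _ hE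
  refine ⟨(1 / √(-γ j Z)) • E, hE', ?_, ?_, ?_, ?_⟩
  · intro h0
    have h1 : T j = 0 := Subtype.ext h0
    have := hT j j
    rw [h1] at this
    simp at this
  · rw [map_smul, lie_neg, smul_lie, lie_smul, hZT', smul_smul, smul_smul, hr]
    simp
  · rw [hE' (T j), ← Nat.cast_smul_eq_nsmul ℝ]; simp [hT]
  · rw [lie_neg, map_mem_rootSpace h𝔞.le_partP hE' (T j), ← Nat.cast_smul_eq_nsmul ℝ]; simp [hT]

/-- Put Y = (2/π) ∑ t_j T_j. The roots 2γ_j give the condition |γ_j(Y)| < 1/2, and under it every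
other root value rγ_i(Y) + sγ_j(Y) with |r|, |s| ≤ 1 lies in ]-1, 1[ as well. That the spectrum
consists of values of roots and 0 comes from joint diagonalization. -/
theorem sum_mem_smul_Omega_iff (hθ : IsCartanInvolution θ) (h𝔞 : IsMaximalFlat θ 𝔞)
    (hR : restrictedRoots 𝔞 = typeC γ ∨ restrictedRoots 𝔞 = typeBC γ) (t : Fin n → ℝ) :
    ∑ j, t j • (T j : 𝔤) ∈ (Real.pi / 2) • Omega (𝔞 : Set 𝔤) ↔ ∀ j, |t j| < Real.pi / 4 := by
  have hπ := Real.pi_pos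
  have hne : (Real.pi / 2) ≠ 0 := by positivity
  rw [Set.mem_smul_set_iff_inv_smul_mem₀ hne]
  set Y : 𝔞 := (Real.pi / 2)⁻¹ • ∑ j, t j • T j with hY
  have hYc : (Real.pi / 2)⁻¹ • ∑ j, t j • (T j : 𝔤) = Y := by simp [hY]
  have hYγ : ∀ i, γ i Y = (Real.pi / 2)⁻¹ * t i := fun i => by
    rw [hY, map_smul, gamma_apply_sum hT, smul_eq_mul]
  rw [hYc]
  constructor
  · rintro ⟨-, h⟩ j
    obtain ⟨X, hX, hX0⟩ := (Submodule.ne_bot_iff _).1 (two_smul_mem_restrictedRoots hT hR j).2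
    have h1 : Module.End.HasEigenvalue (LieAlgebra.ad ℝ 𝔤 Y) (2 * γ j Y) :=
      Module.End.hasEigenvalue_of_hasEigenvector ⟨Module.End.mem_eigenspace_iff.2 (hX Y), hX0⟩
    obtain ⟨h2, h3⟩ := h (Module.End.hasEigenvalue_iff_mem_spectrum.1 h1)
    rw [hYγ] at h2 h3
    field_simp at h2 h3
    rw [abs_lt]
    constructor <;> linarith
  · intro ht
    refine ⟨Y.2, fun μ hμ => ?_⟩
    obtain ⟨X, hX⟩ := (Module.End.hasEigenvalue_iff_mem_spectrum.2 hμ).exists_hasEigenvector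
    suffices h : ∃ α : Module.Dual ℝ 𝔞, rootSpace 𝔞 α ≠ ⊥ ∧ α Y = μ by
      obtain ⟨α, hα, rfl⟩ := h
      rcases eq_or_ne α 0 with rfl | hα0
      · simp
      obtain ⟨i, j, r, s, hr, hs, rfl⟩ := exists_eq_of_mem_restrictedRoots hR ⟨hα0, hα⟩
      have h1 : ∀ (r : ℝ) i, |r| ≤ 1 → |r * γ i Y| < 1 / 2 := by
        intro r i hr
        rw [abs_mul, hYγ, abs_mul, abs_of_pos (a := (Real.pi / 2)⁻¹) (by positivity)]
        have h2 := ht i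
        have h3 : (Real.pi / 2)⁻¹ * |t i| < 1 / 2 := by
          rw [inv_mul_lt_iff₀ (by positivity)]; linarith
        have h4 : 0 ≤ (Real.pi / 2)⁻¹ * |t i| := by positivity
        exact (mul_le_of_le_one_left h4 hr).trans_lt h3
      have h2 := abs_lt.1 (h1 r i hr)
      have h3 := abs_lt.1 (h1 s j hs)
      simp only [LinearMap.add_apply, LinearMap.smul_apply, smul_eq_mul]
      constructor <;> linarith
    by_contra hcon
    push Not at hcon
    have htop := hθ.iSup_iInf_eigenspace_ad (fun j => (T j : 𝔤)) (fun j => h𝔞.le_partP (T j).2)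
      (fun i j => h𝔞.abelian _ (T i).2 _ (T j).2)
    -- If μ were no such value, ad Y - μ would be an invertible scalar on each joint eigenspace of
    -- the ad T_j, hence surjective, hence injective in finite dimension, although μ is an
    -- eigenvalue.
    have hrange : LinearMap.range (LieAlgebra.ad ℝ 𝔤 Y - algebraMap ℝ (Module.End ℝ 𝔤) μ) = ⊤ := by
      rw [eq_top_iff, ← htop, iSup_le_iff]
      intro χ W hW
      have hW' : W ∈ rootSpace 𝔞 (∑ j, χ j • γ j) := by
        intro H
        rw [eq_sum_gamma hT H]
        simp only [Submodule.mem_iInf, Module.End.mem_eigenspace_iff] at hW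
        have hWj : ∀ j, ⁅(T j : 𝔤), W⁆ = χ j • W := hW
        simp [sum_lie, hWj, hT, Finset.sum_smul, smul_smul, mul_comm]
      by_cases hW0 : W = 0
      · rw [hW0]; exact zero_mem _
      have hne := hcon _ ((Submodule.ne_bot_iff _).2 ⟨W, hW', hW0⟩)
      refine ⟨((∑ j, χ j • γ j) Y - μ)⁻¹ • W, ?_⟩
      have h1 : ⁅(Y : 𝔤), W⁆ = (∑ j, χ j • γ j) Y • W := hW' Y
      rw [map_smul, LinearMap.sub_apply, LieAlgebra.ad_apply, h1, Module.algebraMap_end_apply,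
        ← sub_smul, smul_smul, inv_mul_cancel₀ (sub_ne_zero.2 hne), one_smul]
    have hinj := LinearMap.ker_eq_bot.2
      ((LinearMap.injective_iff_surjective).2 (LinearMap.range_eq_top.1 hrange))
    refine hX.2 ((Submodule.mem_bot ℝ).1 (hinj ▸ ?_))
    rw [LinearMap.mem_ker, LinearMap.sub_apply, hX.apply_eq_smul, Module.algebraMap_end_apply,
      sub_self]

end Basis

/-! ### The crown in the general case -/

section Crowns
variable {E : Type*} [NormedAddCommGroup E] [NormedSpace ℝ E] [FiniteDimensional ℝ E]
  [CompleteSpace E] {G : Type*} [TopologicalSpace G] [ChartedSpace E G] [Group G]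
  [LieGroup 𝓘(ℝ, E) ∞ G]
  {F : Type*} [NormedAddCommGroup F] [NormedSpace ℂ F] [CompleteSpace F]
  {GC : Type*} [TopologicalSpace GC] [ChartedSpace F GC] [Group GC] [LieGroup 𝓘(ℂ, F) ∞ GC]
  {ι : G →* GC} {θ : GroupLieAlgebra 𝓘(ℝ, E) G →ₗ⁅ℝ⁆ GroupLieAlgebra 𝓘(ℝ, E) G}
  {𝔞 : Submodule ℝ (GroupLieAlgebra 𝓘(ℝ, E) G)} {n : ℕ}

omit [FiniteDimensional ℝ E] [CompleteSpace F] [LieGroup 𝓘(ℂ, F) ∞ GC] in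
theorem mem_orbitExp_iff {S : Set (GroupLieAlgebra 𝓘(ℝ, E) G)} {x : GC ⧸ KC (F := F) ι θ} :
    x ∈ orbitExp (F := F) ι θ S ↔ ∃ Y ∈ S, x ∈ orbitExp (F := F) ι θ {Y} := by
  constructor
  · rintro ⟨g, Y, hY, h⟩
    exact ⟨Y, hY, g, _, rfl, h⟩
  · rintro ⟨Y, hY, g, _, rfl, h⟩
    exact ⟨g, _, hY, h⟩

omit [FiniteDimensional ℝ E] in
-- With k = exp X one has exp(i Ad(k)Y) = k exp(iY) k⁻¹; the left factor is absorbed by G and the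
-- right one by K_ℂ.
theorem orbitExp_Ad_gexp (hι : IsComplexification (E := E) (F := F) ι)
    {X : GroupLieAlgebra 𝓘(ℝ, E) G} (hX : X ∈ partK θ) (Y : GroupLieAlgebra 𝓘(ℝ, E) G) :
    orbitExp (F := F) ι θ {Ad (lieExp X : G) Y} = orbitExp (F := F) ι θ {Y} := by
  have : LieGroup 𝓘(ℝ, F) ∞ GC := lieGroup_restrictScalars
  have hK : ι (gexp (E := E) X) ∈ KC (F := F) ι θ := by
    have h1 := gexp_mem_KC (F := F) (ι := ι) hX (zero_mem _)
    have h2 : dL (E := E) (F := F) ι (0 : E) = 0 := map_zero _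
    have h3 : dL (E := E) (F := F) ι X + Complex.I • dL (E := E) (F := F) ι (0 : E) =
      dL (E := E) (F := F) ι X := by rw [h2, smul_zero, add_zero]
    have h4 : ι (gexp (E := E) X) = gexp (dL (E := E) (F := F) ι X + Complex.I • dL (E := E) (F := F)
      ι (0 : E)) := (hι.map_gexp X).trans (congrArg gexp h3.symm)
    exact h4 ▸ h1
  refine orbitExp_singleton_eq (a := gexp (E := E) X) (inv_mem hK) ?_
  refine Eq.trans ?_ (conj_gexp (ι (gexp (E := E) X)) _).symm
  refine congrArg (gexp (E := F)) ?_
  exact ((congrArg (Complex.I • ·) (AdL_map ι hι.hasMFDerivAt (gexp (E := E) X) Y)).symm).trans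
    (AdL_smul_complex _ _ _).symm

variable {γ : Module.Basis (Fin n) ℝ (Module.Dual ℝ 𝔞)} {T : Fin n → 𝔞}

omit [FiniteDimensional ℝ E] in
theorem orbitExp_sum_sin_eq (hι : IsComplexification (E := E) (F := F) ι)
    (hθ : IsCartanInvolution θ) (h𝔞 : IsMaximalFlat θ 𝔞)
    (hR : restrictedRoots 𝔞 = typeC γ ∨ restrictedRoots 𝔞 = typeBC γ)
    (hT : ∀ i j, γ i (T j) = if i = j then 1 else 0) {t : Fin n → ℝ}
    (ht : ∀ j, |t j| < Real.pi / 4) {e : Fin n → GroupLieAlgebra 𝓘(ℝ, E) G}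
    (he : ∀ j, IsNormalized θ γ T j (e j)) :
    orbitExp (F := F) ι θ {∑ j, Real.sin (2 * t j) • e j} =
      orbitExp (F := F) ι θ {∑ j, t j • (T j : GroupLieAlgebra 𝓘(ℝ, E) G)} :=
  orbitExp_eq_of_isCommutingSl2Family hι hθ.involutive
    (isCommutingSl2Family_of_isNormalized hT h𝔞 hR he) t ht

theorem crown_eq_orbitExp_LambdaPP (hι : IsComplexification (E := E) (F := F) ι)
    (hθ : IsCartanInvolution θ) (h𝔞 : IsMaximalFlat θ 𝔞)
    (hR : restrictedRoots 𝔞 = typeC γ ∨ restrictedRoots 𝔞 = typeBC γ)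
    (hT : ∀ i j, γ i (T j) = if i = j then 1 else 0) :
    crown (F := F) ι θ 𝔞 = orbitExp (F := F) ι θ (LambdaPP θ γ T) := by
  have : FiniteDimensional ℝ (GroupLieAlgebra 𝓘(ℝ, E) G) := inferInstanceAs (FiniteDimensional ℝ E)
  ext x
  rw [crown, mem_orbitExp_iff, mem_orbitExp_iff]
  constructor
  · rintro ⟨Y, hY, hx⟩
    obtain ⟨Y', hY', hYY'⟩ := hY
    have hYa : Y ∈ 𝔞 := hYY' ▸ 𝔞.smul_mem _ hY'.1
    have hsum : Y = ∑ j, γ j ⟨Y, hYa⟩ • (T j : GroupLieAlgebra 𝓘(ℝ, E) G) := by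
      have := congrArg Subtype.val (eq_sum_gamma hT ⟨Y, hYa⟩)
      simpa using this
    have hY : Y ∈ (Real.pi / 2) • Omega (𝔞 : Set (GroupLieAlgebra 𝓘(ℝ, E) G)) := ⟨Y', hY', hYY'⟩
    rw [hsum] at hY hx
    have ht := (sum_mem_smul_Omega_iff hT hθ h𝔞 hR _).1 hY
    choose e he using exists_isNormalized hT hθ h𝔞 hR
    refine ⟨_, ⟨fun j => Real.sin (2 * γ j ⟨Y, hYa⟩), e, he, fun j => ?_, rfl⟩,
      (orbitExp_sum_sin_eq hι hθ h𝔞 hR hT ht he).symm ▸ hx⟩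
    obtain ⟨h1, h2⟩ := abs_lt.1 (ht j)
    have hc : 0 < Real.cos (2 * γ j ⟨Y, hYa⟩) :=
      Real.cos_pos_of_mem_Ioo ⟨by linarith, by linarith⟩
    rw [← sq_lt_one_iff_abs_lt_one, Real.sin_sq]
    nlinarith
  · rintro ⟨Y, ⟨y, e, he, hy, rfl⟩, hx⟩
    -- The parameter t = arcsin(y)/2 inverts y = sin 2t; the strict bound on |y| yields the strict
    -- bound on |t|.
    have ht : ∀ j, |Real.arcsin (y j) / 2| < Real.pi / 4 := fun j => by
      obtain ⟨h1, h2⟩ := abs_lt.1 (hy j)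
      have h3 := Real.neg_pi_div_two_lt_arcsin.2 h1
      have h4 := Real.arcsin_lt_pi_div_two.2 h2
      rw [abs_lt]; constructor <;> linarith
    have hs : ∀ j, Real.sin (2 * (Real.arcsin (y j) / 2)) = y j := fun j => by
      obtain ⟨h1, h2⟩ := abs_lt.1 (hy j)
      rw [mul_div_cancel₀ _ two_ne_zero, Real.sin_arcsin h1.le h2.le]
    refine ⟨_, (sum_mem_smul_Omega_iff hT hθ h𝔞 hR _).2 ht, ?_⟩
    rw [← orbitExp_sum_sin_eq hι hθ h𝔞 hR hT ht he]
    simpa only [hs] using hx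

omit [FiniteDimensional ℝ E] in
theorem orbitExp_LambdaP_eq (hι : IsComplexification (E := E) (F := F) ι) :
    orbitExp (F := F) ι θ (LambdaP θ γ T) = orbitExp (F := F) ι θ (LambdaPP θ γ T) := by
  ext x
  rw [mem_orbitExp_iff, mem_orbitExp_iff]
  constructor
  · rintro ⟨_, ⟨_, ⟨X, hX, rfl⟩, Y, hY, rfl⟩, hx⟩
    exact ⟨Y, hY, orbitExp_Ad_gexp hι hX.2 Y ▸ hx⟩
  · rintro ⟨Y, hY, hx⟩
    refine ⟨_, ⟨_, ⟨0, zero_mem _, rfl⟩, Y, hY, rfl⟩, ?_⟩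
    rwa [orbitExp_Ad_gexp hι (zero_mem _) Y]

end Crowns

/-! ### The symplectic group: orthogonal diagonalization -/

namespace Sp

open Matrix

variable {n : ℕ}

section Orthogonal

theorem exists_orthogonal_diagonal {Z : Matrix (Fin n) (Fin n) ℝ} (hZ : Z.IsSymm) :
    ∃ (k : Matrix (Fin n) (Fin n) ℝ) (t : Fin n → ℝ), k * kᵀ = 1 ∧ Z = k * diagonal t * kᵀ := by
  have hH : Z.IsHermitian := by
    rw [Matrix.IsHermitian, conjTranspose_eq_transpose_of_trivial]; exact hZ
  have h1 := hH.spectral_theorem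
  have h2 := Unitary.coe_mul_star_self hH.eigenvectorUnitary
  rw [Unitary.conjStarAlgAut_apply, star_eq_conjTranspose,
    conjTranspose_eq_transpose_of_trivial] at h1
  rw [Unitary.coe_star, star_eq_conjTranspose, conjTranspose_eq_transpose_of_trivial] at h2
  exact ⟨_, _, h2, h1⟩

/-- Multiplying the first column of an orthogonal diagonalizer by its determinant ±1 makes the
determinant 1. The sign matrix commutes with the diagonal part, so the diagonalization survives. -/
theorem exists_specialOrthogonal_diagonal (hn : 1 ≤ n) {Z : Matrix (Fin n) (Fin n) ℝ}
    (hZ : Z.IsSymm) : ∃ k ∈ specialOrthogonalGroup (Fin n) ℝ, ∃ t : Fin n → ℝ,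
      Z = k * diagonal t * kᵀ := by
  obtain ⟨k, t, hk, rfl⟩ := exists_orthogonal_diagonal hZ
  have hdet : k.det * k.det = 1 := by
    have := congrArg det hk
    rwa [det_mul, det_transpose, det_one] at this
  let s : Fin n → ℝ := fun i => if i = ⟨0, hn⟩ then k.det else 1
  have hs : ∀ i, s i * s i = 1 := fun i => by
    simp only [s]; split_ifs <;> simp [hdet]
  have hsd : diagonal s * diagonal t * diagonal s = diagonal t := by
    rw [diagonal_mul_diagonal, diagonal_mul_diagonal]
    congr 1; ext i
    rw [mul_right_comm, hs, one_mul]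
  refine ⟨k * diagonal s, ?_, t, ?_⟩
  · rw [mem_specialOrthogonalGroup_iff, mem_orthogonalGroup_iff]
    constructor
    · rw [transpose_mul, diagonal_transpose, Matrix.mul_assoc, ← Matrix.mul_assoc (diagonal s),
        diagonal_mul_diagonal]
      simp only [hs, diagonal_one, Matrix.one_mul, hk]
    · rw [det_mul, det_diagonal]
      simp [s, hdet]
  · rw [transpose_mul, diagonal_transpose]
    conv_lhs => rw [← hsd]
    simp only [Matrix.mul_assoc]

open scoped Matrix.Norms.L2Operator in
theorem opNorm_conj_diagonal_lt_one_iff {k : Matrix (Fin n) (Fin n) ℝ} (hk : k * kᵀ = 1)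
    (t : Fin n → ℝ) : opNorm (k * diagonal t * kᵀ) < 1 ↔ ∀ i, |t i| < 1 := by
  have hk' : kᵀ * k = 1 := mul_eq_one_comm.1 hk
  have hu : k ∈ unitary (Matrix (Fin n) (Fin n) ℝ) := by
    rw [Unitary.mem_iff, star_eq_conjTranspose, conjTranspose_eq_transpose_of_trivial]
    exact ⟨hk', hk⟩
  have hu' : kᵀ ∈ unitary (Matrix (Fin n) (Fin n) ℝ) := by
    rw [← conjTranspose_eq_transpose_of_trivial]; exact Unitary.star_mem hu
  have h1 : opNorm (k * diagonal t * kᵀ) = ‖k * diagonal t * kᵀ‖ := rfl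
  rw [h1, CStarRing.norm_mul_mem_unitary _ hu', CStarRing.norm_mem_unitary_mul _ hu,
    l2_opNorm_diagonal, pi_norm_lt_iff one_pos]
  simp [Real.norm_eq_abs]

end Orthogonal

/-! ### Matrices with diagonal blocks and their exponentials -/

section Blocks

/-- The block matrix `(a, b; c, d)` with diagonal blocks. -/
def diagBlocks (a b c d : Fin n → ℂ) : Matrix (Fin n ⊕ Fin n) (Fin n ⊕ Fin n) ℂ :=
  fromBlocks (diagonal a) (diagonal b) (diagonal c) (diagonal d)

theorem diagBlocks_mul (a b c d a' b' c' d' : Fin n → ℂ) :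
    diagBlocks a b c d * diagBlocks a' b' c' d' =
      diagBlocks (a * a' + b * c') (a * b' + b * d') (c * a' + d * c') (c * b' + d * d') := by
  simp only [diagBlocks, fromBlocks_multiply, diagonal_mul_diagonal, diagonal_add]
  rfl

theorem diagBlocks_one : diagBlocks (n := n) 1 0 0 1 = 1 := by
  simp [diagBlocks]

theorem exp_diagBlocks_diagonal (a d : Fin n → ℂ) :
    NormedSpace.exp (diagBlocks a 0 0 d) =
      diagBlocks (fun i => Complex.exp (a i)) 0 0 (fun i => Complex.exp (d i)) := by
  simp only [diagBlocks, diagonal_zero', fromBlocks_diagonal]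
  rw [exp_diagonal, Pi.exp_def]
  congr 1
  ext i
  rcases i with i | i <;> simp [Complex.exp_eq_exp_ℂ]

/-- In each coordinate plane the generator has the eigenvectors (1, ±i) with eigenvalues ±iz. The
matrix S of these vectors reduces the claim to a diagonal exponential. -/
theorem exp_diagBlocks_rotation (z : Fin n → ℂ) :
    NormedSpace.exp (diagBlocks 0 z (-z) 0) =
      diagBlocks (fun i => Complex.cos (z i)) (fun i => Complex.sin (z i))
        (fun i => -Complex.sin (z i)) (fun i => Complex.cos (z i)) := by
  have hI := Complex.I_mul_I
  set S : Matrix (Fin n ⊕ Fin n) (Fin n ⊕ Fin n) ℂ :=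
    diagBlocks 1 1 (fun _ => Complex.I) (fun _ => -Complex.I) with hS
  have h1 : S * diagBlocks (fun _ => 1 / 2) (fun _ => -Complex.I / 2) (fun _ => 1 / 2)
      (fun _ => Complex.I / 2) = 1 := by
    rw [hS, diagBlocks_mul, ← diagBlocks_one]
    congr 1 <;> ext i <;> simp <;> first | ring1 | linear_combination (-1 : ℂ) * hI
  have hinv := inv_eq_right_inv h1
  have hu : IsUnit S := (Matrix.isUnit_iff_isUnit_det _).2 (isUnit_det_of_right_inverse h1)
  have h2 : diagBlocks 0 z (-z) 0 =
      S * diagBlocks (fun i => z i * Complex.I) 0 0 (fun i => -z i * Complex.I) * S⁻¹ := by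
    rw [hinv, hS, diagBlocks_mul, diagBlocks_mul]
    congr 1 <;> ext i <;> simp <;>
      first | ring1 | linear_combination (z i) * hI | linear_combination (-z i) * hI
  rw [h2, exp_conj _ _ hu, exp_diagBlocks_diagonal, hinv, hS, diagBlocks_mul, diagBlocks_mul]
  congr 1 <;> ext i <;> simp [Complex.cos, Complex.sin] <;> ring_nf <;> (simp; ring)

theorem exp_fromBlocks_upper (B : Matrix (Fin n) (Fin n) ℂ) :
    NormedSpace.exp (fromBlocks 0 B 0 0) =
      (fromBlocks 1 B 0 1 : Matrix (Fin n ⊕ Fin n) (Fin n ⊕ Fin n) ℂ) := by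
  have h2 : (fromBlocks 0 B 0 0 : Matrix (Fin n ⊕ Fin n) (Fin n ⊕ Fin n) ℂ) ^ 2 = 0 := by
    rw [pow_two, fromBlocks_multiply]; simp
  have h3 : ∀ k ∉ Finset.range 2, ((k.factorial : ℚ)⁻¹) •
      (fromBlocks 0 B 0 0 : Matrix (Fin n ⊕ Fin n) (Fin n ⊕ Fin n) ℂ) ^ k = 0 := by
    intro k hk
    rw [pow_eq_zero_of_le (by simp at hk; omega) h2, smul_zero]
  rw [NormedSpace.exp_eq_tsum ℚ]
  simp only []
  rw [tsum_eq_sum h3]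
  simp [Finset.sum_range_succ, ← fromBlocks_one, fromBlocks_add]

end Blocks

end Sp

/-! ### Elements of K_ℂ -/

namespace Sp

open Matrix

variable {n : ℕ}

theorem mem_sp_iff {X : Matrix (Fin n ⊕ Fin n) (Fin n ⊕ Fin n) ℝ} :
    X ∈ LieAlgebra.Symplectic.sp (Fin n) ℝ ↔ Xᵀ * J (Fin n) ℝ = -(J (Fin n) ℝ * X) := by
  rw [LieAlgebra.Symplectic.sp, mem_skewAdjointMatricesLieSubalgebra,
    mem_skewAdjointMatricesSubmodule, Matrix.IsSkewAdjoint, Matrix.IsAdjointPair, Matrix.mul_neg]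

theorem fromBlocks_mem_sp {A B C : Matrix (Fin n) (Fin n) ℝ} (hB : B.IsSymm) (hC : C.IsSymm) :
    fromBlocks A B C (-Aᵀ) ∈ LieAlgebra.Symplectic.sp (Fin n) ℝ := by
  rw [mem_sp_iff, J, fromBlocks_transpose, fromBlocks_multiply, fromBlocks_multiply, fromBlocks_neg]
  simp [hB.eq, hC.eq]

theorem toC_mul (A B : Matrix (Fin n ⊕ Fin n) (Fin n ⊕ Fin n) ℝ) :
    toC (A * B) = toC A * toC B :=
  Matrix.map_mul (f := Complex.ofRealHom)

theorem toC_one : toC (1 : Matrix (Fin n ⊕ Fin n) (Fin n ⊕ Fin n) ℝ) = 1 :=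
  Matrix.map_one Complex.ofReal (by simp) (by simp)

theorem toC_mem (g : G n) : toC g.1 ∈ symplecticGroup (Fin n) ℂ :=
  SymplecticGroup.map_mem g.2 Complex.ofRealHom

/-- The inclusion of `Sp(n, ℝ)` into `Sp(n, ℂ)`. -/
def ofReal : G n →* GC n where
  toFun g := ⟨toC g.1, toC_mem g⟩
  map_one' := Subtype.ext toC_one
  map_mul' g h := Subtype.ext (toC_mul g.1 h.1)

theorem mem_KC_of_exp {Z W : Matrix (Fin n) (Fin n) ℝ} (hZ : Z.IsSymm) (hW : W.IsSymm) {h : GC n}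
    (hh : h.1 = NormedSpace.exp
      (toC (fromBlocks 0 Z (-Z) 0) + Complex.I • toC (fromBlocks 0 W (-W) 0))) : h ∈ KC n := by
  have hmem : ∀ Z : Matrix (Fin n) (Fin n) ℝ, Z.IsSymm →
      fromBlocks 0 Z (-Z) 0 ∈ LieAlgebra.Symplectic.sp (Fin n) ℝ := fun Z hZ => by
    simpa using fromBlocks_mem_sp (A := 0) hZ hZ.neg
  have hskew : ∀ Z : Matrix (Fin n) (Fin n) ℝ, Z.IsSymm →
      (fromBlocks 0 Z (-Z) 0)ᵀ = -fromBlocks 0 Z (-Z) 0 := fun Z hZ => by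
    rw [fromBlocks_transpose, fromBlocks_neg]; simp [hZ.eq]
  exact Subgroup.subset_closure
    ⟨⟨_, hmem Z hZ⟩, ⟨_, hmem W hW⟩, hskew Z hZ, hskew W hW, hh⟩

/-- Since (α + iβ)(α - iβ) = 1, the number α + iβ is nonzero, and z = -i log(α + iβ) has cosine α
and sine β. The matrix is therefore the exponential of a complex rotation generator. -/
theorem mem_KC_of_diagBlocks {α β : Fin n → ℂ} (hαβ : ∀ i, α i * α i + β i * β i = 1) {h : GC n}
    (hh : h.1 = diagBlocks α β (-β) α) : h ∈ KC n := by
  have hz : ∀ i, ∃ z : ℂ, Complex.cos z = α i ∧ Complex.sin z = β i := by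
    intro i
    have hI := Complex.I_mul_I
    have h1 : (α i + Complex.I * β i) * (α i - Complex.I * β i) = 1 := by
      linear_combination hαβ i - β i * β i * hI
    have h2 : α i + Complex.I * β i ≠ 0 := left_ne_zero_of_mul_eq_one h1
    have h3 : Complex.exp (-Complex.I * Complex.log (α i + Complex.I * β i) * Complex.I) =
        α i + Complex.I * β i := by
      rw [show -Complex.I * Complex.log (α i + Complex.I * β i) * Complex.I =
        Complex.log (α i + Complex.I * β i) by
          linear_combination (-Complex.log (α i + Complex.I * β i)) * hI, Complex.exp_log h2]
    have h4 : Complex.exp (-(-Complex.I * Complex.log (α i + Complex.I * β i)) * Complex.I) =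
        α i - Complex.I * β i := by
      rw [neg_mul, Complex.exp_neg, h3]
      exact (eq_inv_of_mul_eq_one_right h1).symm
    refine ⟨-Complex.I * Complex.log (α i + Complex.I * β i), ?_, ?_⟩
    · rw [Complex.cos, h3, h4]; ring
    · rw [Complex.sin, h3, h4]; linear_combination (-β i) * hI
  choose z hc hs using hz
  refine mem_KC_of_exp (isSymm_diagonal fun i => (z i).re) (isSymm_diagonal fun i => (z i).im) ?_
  have h1 : toC (fromBlocks 0 (diagonal fun i => (z i).re) (-(diagonal fun i => (z i).re)) 0) +
      Complex.I • toC (fromBlocks 0 (diagonal fun i => (z i).im) (-(diagonal fun i => (z i).im)) 0) =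
      diagBlocks 0 z (-z) 0 := by
    have hz' : ∀ i, ((z i).re : ℂ) + Complex.I * (z i).im = z i := fun i => by
      rw [mul_comm]; exact Complex.re_add_im (z i)
    simp only [toC, diagBlocks, fromBlocks_map, fromBlocks_smul, fromBlocks_add]
    congr 1
    · ext i j; simp
    · ext i j
      rcases eq_or_ne i j with rfl | hij
      · simpa using hz' i
      · simp [hij]
    · ext i j
      rcases eq_or_ne i j with rfl | hij
      · simp
        linear_combination -hz' i
      · simp [hij]
    · ext i j; simp
  rw [hh, h1, exp_diagBlocks_rotation]
  simp only [hc, hs]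
  rfl

/-- In an eigenbasis s is diagonal with entries ±1. Rotating by the angle π in the plane of
coordinates i and n + i produces an entry -1 in both diagonal blocks, whatever the determinant of s.
-/
theorem mem_KC_of_orthogonal_involution {s : Matrix (Fin n) (Fin n) ℝ} (hs : s.IsSymm)
    (hs2 : s * s = 1) {h : GC n} (hh : h.1 = toC (fromBlocks s 0 0 s)) : h ∈ KC n := by
  obtain ⟨k, t, hk, rfl⟩ := exists_orthogonal_diagonal hs
  have hk' : kᵀ * k = 1 := mul_eq_one_comm.1 hk
  have ht : ∀ i, t i * t i = 1 := by
    have h1 : kᵀ * (k * diagonal t * kᵀ * (k * diagonal t * kᵀ)) * k = 1 := by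
      rw [hs2, Matrix.mul_one, hk']
    have h2 : kᵀ * (k * diagonal t * kᵀ * (k * diagonal t * kᵀ)) * k =
        (kᵀ * k) * diagonal t * (kᵀ * k) * diagonal t * (kᵀ * k) := by noncomm_ring
    rw [h2, hk', Matrix.one_mul, Matrix.mul_one, Matrix.mul_one, diagonal_mul_diagonal,
      ← diagonal_one] at h1
    exact fun i => congrFun (diagonal_injective h1) i
  let a : Fin n → ℝ := fun i => if t i = 1 then 0 else Real.pi
  have hcos : ∀ i, Real.cos (a i) = t i := fun i => by
    simp only [a]
    split_ifs with h1
    · rw [h1, Real.cos_zero]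
    · rw [Real.cos_pi, (mul_self_eq_one_iff.1 (ht i)).resolve_left h1]
  have hsin : ∀ i, Real.sin (a i) = 0 := fun i => by
    simp only [a]; split_ifs <;> simp
  have hZ : (k * diagonal a * kᵀ).IsSymm := by
    rw [IsSymm, transpose_mul, transpose_mul, transpose_transpose, diagonal_transpose,
      Matrix.mul_assoc]
  refine mem_KC_of_exp hZ isSymm_zero ?_
  set K : Matrix (Fin n ⊕ Fin n) (Fin n ⊕ Fin n) ℂ := toC (fromBlocks k 0 0 k) with hKdef
  have hK1 : K * toC (fromBlocks kᵀ 0 0 kᵀ) = 1 := by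
    rw [hKdef, ← toC_mul, fromBlocks_multiply, ← toC_one, ← fromBlocks_one]
    simp [hk]
  have hinv := inv_eq_right_inv hK1
  have hu : IsUnit K := (Matrix.isUnit_iff_isUnit_det _).2 (isUnit_det_of_right_inverse hK1)
  have hreal : ∀ b c : Fin n → ℝ, diagBlocks (fun i => (b i : ℂ)) (fun i => (c i : ℂ))
      (fun i => -(c i : ℂ)) (fun i => (b i : ℂ)) =
      toC (fromBlocks (diagonal b) (diagonal c) (-diagonal c) (diagonal b)) := by
    intro b c
    simp only [toC, diagBlocks, fromBlocks_map]
    congr 1 <;> ext i j <;> rcases eq_or_ne i j with rfl | hij <;> simp_all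
  have h1 : toC (fromBlocks 0 (k * diagonal a * kᵀ) (-(k * diagonal a * kᵀ)) 0) +
      Complex.I • toC (fromBlocks 0 0 (-0) 0) =
      K * diagBlocks 0 (fun i => (a i : ℂ)) (-fun i => (a i : ℂ)) 0 * K⁻¹ := by
    have h2 := hreal 0 a
    simp only [Pi.zero_apply, Complex.ofReal_zero] at h2
    have h3 : diagBlocks (n := n) 0 (fun i => (a i : ℂ)) (-fun i => (a i : ℂ)) 0 =
      toC (fromBlocks 0 (diagonal a) (-diagonal a) 0) := by
      refine Eq.trans ?_ (h2.trans ?_)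
      · rfl
      · simp
    rw [h3, hinv, hKdef, ← toC_mul, ← toC_mul, fromBlocks_multiply, fromBlocks_multiply]
    have h4 : toC (fromBlocks 0 0 (-0) 0 : Matrix (Fin n ⊕ Fin n) (Fin n ⊕ Fin n) ℝ) = 0 := by
      ext i j; rcases i with i | i <;> rcases j with j | j <;> simp [toC]
    rw [h4]
    simp only [Matrix.mul_zero, Matrix.zero_mul, add_zero, zero_add, smul_zero, Matrix.mul_neg,
      Matrix.neg_mul, neg_zero]
  rw [hh, h1, exp_conj _ _ hu, exp_diagBlocks_rotation]
  simp only [← Complex.ofReal_cos, ← Complex.ofReal_sin, hcos, hsin]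
  have h2 := hreal t 0
  simp only [Pi.zero_apply] at h2
  rw [h2, hinv, hKdef, ← toC_mul, ← toC_mul, fromBlocks_multiply, fromBlocks_multiply]
  simp

/-- The block diagonal embedding `k ↦ (k, 0; 0, k)` of `O(n)`. -/
def ofOrthogonal : unitary (Matrix (Fin n) (Fin n) ℝ) →* G n where
  toFun k := ⟨fromBlocks k.1 0 0 k.1, by
    have h := Unitary.coe_mul_star_self k
    rw [Unitary.coe_star, star_eq_conjTranspose, conjTranspose_eq_transpose_of_trivial] at h
    rw [SymplecticGroup.mem_iff, J, fromBlocks_transpose, fromBlocks_multiply, fromBlocks_multiply]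
    simp [h]⟩
  map_one' := Subtype.ext (by simp)
  map_mul' k l := Subtype.ext (by simp [fromBlocks_multiply])

/-- By the Cartan–Dieudonné theorem O(n) is generated by reflections, and these are symmetric
involutions. So even the elements of determinant -1 lie in the analytic subgroup. -/
theorem ofReal_ofOrthogonal_mem_KC (k : unitary (Matrix (Fin n) (Fin n) ℝ)) :
    ofReal (ofOrthogonal k) ∈ KC n := by
  let Ψ : unitary (Matrix (Fin n) (Fin n) ℝ) ≃*
      (EuclideanSpace ℝ (Fin n) ≃ₗᵢ[ℝ] EuclideanSpace ℝ (Fin n)) :=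
    (Unitary.mapEquiv (.ofClass (toEuclideanCLM (n := Fin n) (𝕜 := ℝ)))).toMulEquiv.trans
      Unitary.linearIsometryEquiv
  let f : (EuclideanSpace ℝ (Fin n) ≃ₗᵢ[ℝ] EuclideanSpace ℝ (Fin n)) →* GC n :=
    (ofReal.comp ofOrthogonal).comp Ψ.symm.toMonoidHom
  have htop : (KC n).comap f = ⊤ := by
    rw [eq_top_iff, ← LinearIsometryEquiv.reflections_generate, Subgroup.closure_le]
    rintro _ ⟨v, rfl⟩
    set r := Ψ.symm (Submodule.reflection (ℝ ∙ v)ᗮ)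
    have hr : r * r = 1 := by
      rw [← map_mul, Submodule.reflection_mul_reflection, map_one]
    have hr1 : r.1 * r.1 = 1 := congrArg Subtype.val hr
    have hr2 : star r.1 = r.1 := by
      have h1 := Unitary.coe_star_mul_self r
      calc star r.1 = star r.1 * (r.1 * r.1) := by rw [hr1, mul_one]
        _ = r.1 := by rw [← mul_assoc, h1, one_mul]
    rw [star_eq_conjTranspose, conjTranspose_eq_transpose_of_trivial] at hr2
    exact mem_KC_of_orthogonal_involution hr2 hr1 rfl
  have h1 : Ψ k ∈ (KC n).comap f := htop ▸ Subgroup.mem_top _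
  have h2 : f (Ψ k) = ofReal (ofOrthogonal k) := by
    simp [f]
  rwa [Subgroup.mem_comap, h2] at h1

end Sp

/-! ### A Hermitian form detecting the crown -/

namespace Sp

open Matrix
open scoped ComplexOrder

variable {n : ℕ}

section CrownForm

/-- The Hermitian form `-(J A + A J)`, where `A = hᴴ J h`; it is positive definite for
`h.x₀` in the crown. -/
def crownForm (h : Matrix (Fin n ⊕ Fin n) (Fin n ⊕ Fin n) ℂ) :
    Matrix (Fin n ⊕ Fin n) (Fin n ⊕ Fin n) ℂ :=
  -(J (Fin n) ℂ * (hᴴ * J (Fin n) ℂ * h) + hᴴ * J (Fin n) ℂ * h * J (Fin n) ℂ)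

theorem toC_J : toC (J (Fin n) ℝ) = J (Fin n) ℂ := map_J (Fin n) Complex.ofRealHom

/-- For skew-symmetric X the symplectic condition XᵀJ = -JX becomes XJ = JX; commuting with J then
passes to exponentials and to the group they generate. -/
theorem commute_J_of_mem_KC {k : GC n} (hk : k ∈ KC n) : Commute k.1 (J (Fin n) ℂ) := by
  induction hk using Subgroup.closure_induction with
  | mem x hx =>
    obtain ⟨X, Y, hX, hY, h⟩ := hx
    have key : ∀ X : LieG n, X.1ᵀ = -X.1 → Commute (toC X.1) (J (Fin n) ℂ) := by
      intro X hX
      have h1 := mem_sp_iff.1 X.2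
      rw [hX, Matrix.neg_mul, neg_inj] at h1
      have h2 := congrArg toC h1
      rwa [toC_mul, toC_mul, toC_J] at h2
    rw [h]
    exact ((key X hX).add_left ((key Y hY).smul_left _)).exp_left
  | one => exact Commute.one_left _
  | mul x y _ _ hx hy => exact hx.mul_left hy
  | inv x _ hx =>
    have h1 : (x⁻¹).1 * x.1 = 1 := congrArg Subtype.val (inv_mul_cancel x)
    have h2 : x.1 * (x⁻¹).1 = 1 := congrArg Subtype.val (mul_inv_cancel x)
    calc (x⁻¹).1 * J (Fin n) ℂ = (x⁻¹).1 * (J (Fin n) ℂ * x.1) * (x⁻¹).1 := by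
          rw [mul_assoc, mul_assoc, h2, mul_one]
      _ = (x⁻¹).1 * (x.1 * J (Fin n) ℂ) * (x⁻¹).1 := by rw [hx.eq]
      _ = J (Fin n) ℂ * (x⁻¹).1 := by rw [← mul_assoc, h1, one_mul]

theorem J_conjTranspose : (J (Fin n) ℂ)ᴴ = -J (Fin n) ℂ := by
  rw [J, fromBlocks_conjTranspose, fromBlocks_neg]; simp

/-- Because J is skew-Hermitian, kᴴ commutes with J too, so both factors can be pulled out past J.
Hence definiteness depends only on the coset modulo K_ℂ. -/
theorem crownForm_mul_right (h : Matrix (Fin n ⊕ Fin n) (Fin n ⊕ Fin n) ℂ)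
    {k : Matrix (Fin n ⊕ Fin n) (Fin n ⊕ Fin n) ℂ} (hk : Commute k (J (Fin n) ℂ)) :
    crownForm (h * k) = kᴴ * crownForm h * k := by
  have h1 : kᴴ * J (Fin n) ℂ = J (Fin n) ℂ * kᴴ := by
    have := congrArg conjTranspose hk.eq
    rw [conjTranspose_mul, conjTranspose_mul, J_conjTranspose, Matrix.neg_mul, Matrix.mul_neg,
      neg_inj] at this
    exact this.symm
  rw [crownForm, crownForm, conjTranspose_mul]
  have e1 : J (Fin n) ℂ * (kᴴ * hᴴ * J (Fin n) ℂ * (h * k)) =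
      kᴴ * (J (Fin n) ℂ * (hᴴ * J (Fin n) ℂ * h)) * k := by
    simp only [← Matrix.mul_assoc, h1]
  have e2 : kᴴ * hᴴ * J (Fin n) ℂ * (h * k) * J (Fin n) ℂ =
      kᴴ * (hᴴ * J (Fin n) ℂ * h * J (Fin n) ℂ) * k := by
    have := hk.eq
    simp only [Matrix.mul_assoc, this]
  rw [e1, e2]
  simp only [Matrix.mul_neg, Matrix.neg_mul, Matrix.mul_add, Matrix.add_mul]

theorem crownForm_ofReal_mul (g : G n) (h : Matrix (Fin n ⊕ Fin n) (Fin n ⊕ Fin n) ℂ) :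
    crownForm ((ofReal g).1 * h) = crownForm h := by
  have h1 : (ofReal g).1ᴴ * J (Fin n) ℂ * (ofReal g).1 = J (Fin n) ℂ := by
    have h2 : (ofReal g).1ᴴ = toC g.1ᵀ := by
      ext i j; simp [ofReal, toC]
    rw [h2, ← toC_J]
    change toC _ * toC _ * toC g.1 = _
    rw [← toC_mul, ← toC_mul, SymplecticGroup.mem_iff'.1 g.2]
  have h2 : ((ofReal g).1 * h)ᴴ * J (Fin n) ℂ * ((ofReal g).1 * h) = hᴴ * J (Fin n) ℂ * h := by
    rw [conjTranspose_mul]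
    calc _ = hᴴ * ((ofReal g).1ᴴ * J (Fin n) ℂ * (ofReal g).1) * h := by
          simp only [Matrix.mul_assoc]
      _ = _ := by rw [h1]
  rw [crownForm, crownForm, h2]

theorem posDef_crownForm_mul_right {h k : GC n} (hk : k ∈ KC n) (hpos : (crownForm h.1).PosDef) :
    (crownForm (h * k).1).PosDef := by
  have h1 : (k⁻¹).1 * k.1 = 1 := congrArg Subtype.val (inv_mul_cancel k)
  change (crownForm (h.1 * k.1)).PosDef
  rw [crownForm_mul_right _ (commute_J_of_mem_KC hk)]
  refine hpos.conjTranspose_mul_mul_same ?_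
  refine Function.LeftInverse.injective (g := (k⁻¹).1.mulVec) fun x => ?_
  rw [mulVec_mulVec, h1, one_mulVec]

theorem J_eq_diagBlocks : J (Fin n) ℂ = diagBlocks 0 (-1) 1 0 := by
  have h : (-1 : Matrix (Fin n) (Fin n) ℂ) = diagonal (-1) := by
    rw [← diagonal_one, diagonal_neg]; rfl
  simp only [J, diagBlocks, diagonal_zero', diagonal_one', h]

theorem diagBlocks_conjTranspose (a b c d : Fin n → ℂ) :
    (diagBlocks a b c d)ᴴ = diagBlocks (star a) (star c) (star b) (star d) := by
  simp [diagBlocks, fromBlocks_conjTranspose]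

theorem diagBlocks_add (a b c d a' b' c' d' : Fin n → ℂ) :
    diagBlocks a b c d + diagBlocks a' b' c' d' =
      diagBlocks (a + a') (b + b') (c + c') (d + d') := by
  simp only [diagBlocks, fromBlocks_add, diagonal_add]; rfl

theorem diagBlocks_neg (a b c d : Fin n → ℂ) :
    -diagBlocks a b c d = diagBlocks (-a) (-b) (-c) (-d) := by
  simp only [diagBlocks, fromBlocks_neg, diagonal_neg]; rfl

theorem crownForm_torus (t : Fin n → ℝ) :
    crownForm (diagBlocks (fun i => Complex.exp (t i * Complex.I)) 0 0
      (fun i => Complex.exp (-(t i * Complex.I)))) =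
      diagBlocks (fun i => ((2 * Real.cos (2 * t i) : ℝ) : ℂ)) 0 0
        (fun i => ((2 * Real.cos (2 * t i) : ℝ) : ℂ)) := by
  have h1 : ∀ i, star (Complex.exp (t i * Complex.I)) = Complex.exp (-(t i * Complex.I)) := by
    intro i
    rw [Complex.star_def, ← Complex.exp_conj]; simp
  have h2 : ∀ i, star (Complex.exp (-(t i * Complex.I))) = Complex.exp (t i * Complex.I) := by
    intro i
    rw [Complex.star_def, ← Complex.exp_conj]; simp
  have h3 : ∀ i, ((2 * Real.cos (2 * t i) : ℝ) : ℂ) =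
      Complex.exp (t i * Complex.I) * Complex.exp (t i * Complex.I) +
        Complex.exp (-(t i * Complex.I)) * Complex.exp (-(t i * Complex.I)) := by
    intro i
    rw [← Complex.exp_add, ← Complex.exp_add]
    push_cast
    rw [Complex.cos, show 2 * (t i : ℂ) * Complex.I = t i * Complex.I + t i * Complex.I by ring,
      show -(2 * (t i : ℂ)) * Complex.I = -(t i * Complex.I) + -(t i * Complex.I) by ring]
    ring
  rw [crownForm, diagBlocks_conjTranspose, J_eq_diagBlocks]
  simp only [diagBlocks_mul, diagBlocks_add, diagBlocks_neg]
  congr 1 <;> ext i <;> simp only [Pi.add_apply, Pi.mul_apply, Pi.neg_apply, Pi.zero_apply,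
    Pi.one_apply, Pi.star_apply, h1, h2, h3, star_zero] <;> ring

theorem crownForm_upper (s : Fin n → ℝ) :
    crownForm (diagBlocks 1 (fun i => Complex.I * s i) 0 1) =
      diagBlocks (fun _ => 2) (fun i => 2 * Complex.I * s i) (fun i => -(2 * Complex.I * s i))
        (fun _ => 2) := by
  rw [crownForm, diagBlocks_conjTranspose, J_eq_diagBlocks]
  simp only [diagBlocks_mul, diagBlocks_add, diagBlocks_neg]
  congr 1 <;> ext i <;> simp <;> ring

theorem posDef_crownForm_torus {t : Fin n → ℝ} (ht : ∀ i, |t i| < Real.pi / 4) :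
    (crownForm (diagBlocks (fun i => Complex.exp (t i * Complex.I)) 0 0
      (fun i => Complex.exp (-(t i * Complex.I))))).PosDef := by
  rw [crownForm_torus]
  simp only [diagBlocks, diagonal_zero', fromBlocks_diagonal]
  rw [posDef_diagonal_iff]
  have h : ∀ i, (0 : ℂ) < ((2 * Real.cos (2 * t i) : ℝ) : ℂ) := by
    intro i
    obtain ⟨h1, h2⟩ := abs_lt.1 (ht i)
    rw [Complex.zero_lt_real]
    have := Real.cos_pos_of_mem_Ioo (x := 2 * t i) ⟨by linarith, by linarith⟩
    positivity
  rintro (i | i) <;> exact h i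

/-- The principal minor on the coordinates i and n + i is 4(1 - s_i²). -/
theorem abs_lt_one_of_posDef_crownForm_upper {s : Fin n → ℝ}
    (h : (crownForm (diagBlocks 1 (fun i => Complex.I * s i) 0 1)).PosDef) (i : Fin n) :
    |s i| < 1 := by
  rw [crownForm_upper] at h
  have hinj : Function.Injective (![Sum.inl i, Sum.inr i] : Fin 2 → Fin n ⊕ Fin n) := by
    intro a b hab
    fin_cases a <;> fin_cases b <;> simp_all
  have h1 := (h.submatrix hinj).det_pos
  rw [det_fin_two] at h1
  simp [diagBlocks] at h1
  have h2 : (2 * 2 + 2 * Complex.I * s i * (2 * Complex.I * s i) : ℂ) =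
      ((4 * (1 - s i ^ 2) : ℝ) : ℂ) := by
    push_cast
    linear_combination (4 * (s i : ℂ) ^ 2) * Complex.I_mul_I
  rw [h2, Complex.zero_lt_real] at h1
  rw [← sq_lt_one_iff_abs_lt_one]
  linarith

end CrownForm

end Sp

/-! ### Ω, the crown and the decomposition for Sp(n) -/

namespace Sp

open Matrix
open scoped ComplexOrder

variable {n : ℕ}

section Omega

instance : FiniteDimensional ℝ (LieG n) :=
  Module.Finite.of_injective
    ({ toFun := Subtype.val, map_add' := fun _ _ => rfl, map_smul' := fun _ _ => rfl } :
      LieG n →ₗ[ℝ] Matrix (Fin n ⊕ Fin n) (Fin n ⊕ Fin n) ℝ) Subtype.val_injective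

theorem lie_diagonal_apply {Y X : LieG n} {d : Fin n ⊕ Fin n → ℝ} (hY : Y.1 = diagonal d)
    (a b : Fin n ⊕ Fin n) : (⁅Y, X⁆ : LieG n).1 a b = (d a - d b) * X.1 a b := by
  change (Y.1 * X.1 - X.1 * Y.1) a b = _
  rw [hY, Matrix.sub_apply, diagonal_mul, mul_diagonal]
  ring

/-- For diagonal Y with entries d, ad Y multiplies the entry (a, b) by d_a - d_b. The unit matrix in
the place (j, n + j) gives the eigenvalue 2t_j; conversely a nonzero entry of any eigenvector shows
that its eigenvalue is such a difference. -/
theorem mem_smul_Omega_iff {Y : LieG n} :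
    Y ∈ (Real.pi / 2) • Omega (partA n) ↔
      ∃ t : Fin n → ℝ, Y.1 = fromBlocks (diagonal t) 0 0 (-diagonal t) ∧
        ∀ i, |t i| < Real.pi / 4 := by
  have hπ := Real.pi_pos
  have hdiag : ∀ t : Fin n → ℝ, (fromBlocks (diagonal t) 0 0 (-diagonal t) :
      Matrix (Fin n ⊕ Fin n) (Fin n ⊕ Fin n) ℝ) = diagonal (Sum.elim t (-t)) := by
    intro t; rw [← fromBlocks_diagonal, diagonal_neg]; rfl
  constructor
  · rintro ⟨Y, ⟨⟨t, ht⟩, hs⟩, rfl⟩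
    refine ⟨(Real.pi / 2) • t, ?_, fun j => ?_⟩
    · change (Real.pi / 2) • Y.1 = _
      rw [ht, fromBlocks_smul, diagonal_smul, smul_neg, smul_zero]
    · have hX : fromBlocks 0 (diagonal (Pi.single j 1)) 0 (-0ᵀ) ∈
          LieAlgebra.Symplectic.sp (Fin n) ℝ :=
        fromBlocks_mem_sp (isSymm_diagonal _) isSymm_zero
      set X : LieG n := ⟨_, hX⟩ with hXdef
      have hX0 : X ≠ 0 := by
        intro h
        have := congrFun (congrFun (congrArg Subtype.val h) (Sum.inl j)) (Sum.inr j)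
        simp [hXdef] at this
      have h1 : Module.End.HasEigenvalue (LieAlgebra.ad ℝ (LieG n) Y) (2 * t j) := by
        refine Module.End.hasEigenvalue_of_hasEigenvector
          ⟨Module.End.mem_eigenspace_iff.2 (Subtype.ext ?_), hX0⟩
        ext a b
        rw [LieAlgebra.ad_apply, lie_diagonal_apply (ht.trans (hdiag t))]
        change _ = 2 * t j * X.1 a b
        rcases a with a | a <;> rcases b with b | b <;> simp [hXdef]
        rcases eq_or_ne a b with rfl | hab
        · rcases eq_or_ne a j with rfl | haj
          · simp; ring
          · simp [haj]
        · simp [hab]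
      obtain ⟨h2, h3⟩ := hs (Module.End.hasEigenvalue_iff_mem_spectrum.1 h1)
      rw [Pi.smul_apply, smul_eq_mul, abs_lt]
      constructor <;> nlinarith
  · rintro ⟨t, ht, h⟩
    rw [Set.mem_smul_set_iff_inv_smul_mem₀ (by positivity)]
    have hY : ((Real.pi / 2)⁻¹ • Y).1 = fromBlocks (diagonal ((Real.pi / 2)⁻¹ • t)) 0 0
        (-diagonal ((Real.pi / 2)⁻¹ • t)) := by
      change (Real.pi / 2)⁻¹ • Y.1 = _
      rw [ht, fromBlocks_smul, diagonal_smul, smul_neg, smul_zero]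
    refine ⟨⟨_, hY⟩, fun μ hμ => ?_⟩
    obtain ⟨X, hX, hX0⟩ := (Module.End.hasEigenvalue_iff_mem_spectrum.2 hμ).exists_hasEigenvector
    rw [Module.End.mem_eigenspace_iff, LieAlgebra.ad_apply] at hX
    obtain ⟨a, b, hab⟩ : ∃ a b, X.1 a b ≠ 0 := by
      by_contra! hcon
      exact hX0 (Subtype.ext (Matrix.ext hcon))
    have h1 := lie_diagonal_apply (X := X) (hY.trans (hdiag _)) a b
    rw [hX] at h1
    have h2 := mul_right_cancel₀ hab h1
    have h3 : ∀ i, |((Real.pi / 2)⁻¹ • t) i| < 1 / 2 := by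
      intro i
      rw [Pi.smul_apply, smul_eq_mul, abs_mul, abs_of_pos (a := (Real.pi / 2)⁻¹) (by positivity),
        inv_mul_lt_iff₀ (by positivity)]
      linarith [h i]
    have h4 : ∀ a, |Sum.elim ((Real.pi / 2)⁻¹ • t) (-((Real.pi / 2)⁻¹ • t)) a| < 1 / 2 := by
      rintro (i | i)
      · exact h3 i
      · simpa only [Sum.elim_inr, Pi.neg_apply, abs_neg] using h3 i
    have h5 := abs_lt.1 (h4 a)
    have h6 := abs_lt.1 (h4 b)
    rw [h2]
    constructor <;> linarith

end Omega

section Crown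

theorem diagBlocks_mem {a b c d : Fin n → ℂ} (h : ∀ i, a i * d i - c i * b i = 1) :
    diagBlocks a b c d ∈ symplecticGroup (Fin n) ℂ := by
  rw [diagBlocks, SymplecticGroup.fromBlocks_mem_iff]
  simp only [diagonal_transpose, diagonal_mul_diagonal, diagonal_sub, h, diagonal_one]
  simp [mul_comm]

/-- The element `exp(i diag(t, -t))` of `Sp(n, ℂ)`. -/
def torus (t : Fin n → ℝ) : GC n :=
  ⟨diagBlocks (fun i => Complex.exp (t i * Complex.I)) 0 0
      (fun i => Complex.exp (-(t i * Complex.I))),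
    diagBlocks_mem fun i => by simp [← Complex.exp_add]⟩

theorem exp_smul_toC_torus (t : Fin n → ℝ) :
    NormedSpace.exp (Complex.I • toC (fromBlocks (diagonal t) 0 0 (-diagonal t))) =
      (torus t).1 := by
  have h : Complex.I • toC (fromBlocks (diagonal t) 0 0 (-diagonal t)) =
      diagBlocks (fun i => t i * Complex.I) 0 0 (fun i => -(t i * Complex.I)) := by
    simp only [toC, diagBlocks, fromBlocks_map, fromBlocks_smul]
    congr 1 <;> ext i j <;> rcases eq_or_ne i j with rfl | hij <;> simp_all [mul_comm]
  rw [h, exp_diagBlocks_diagonal]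
  rfl

/-- The element `exp(i (0, Z; 0, 0))` of `Sp(n, ℂ)`. -/
def upper {Z : Matrix (Fin n) (Fin n) ℝ} (hZ : Z.IsSymm) : GC n :=
  ⟨fromBlocks 1 (Complex.I • Z.map Complex.ofReal) 0 1, by
    rw [SymplecticGroup.fromBlocks_mem_iff]
    have : (Z.map Complex.ofReal)ᵀ = Z.map Complex.ofReal := by rw [← transpose_map, hZ.eq]
    simp [this]⟩

theorem exp_smul_toC_upper {Z : Matrix (Fin n) (Fin n) ℝ} (hZ : Z.IsSymm) :
    NormedSpace.exp (Complex.I • toC (fromBlocks 0 Z 0 0)) = (upper hZ).1 := by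
  have h : Complex.I • toC (fromBlocks 0 Z 0 0) =
      fromBlocks 0 (Complex.I • Z.map Complex.ofReal) 0 0 := by
    simp only [toC, fromBlocks_map, fromBlocks_smul]
    congr 1 <;> ext i j <;> simp
  rw [h, exp_fromBlocks_upper]
  rfl

theorem mem_crown_iff {x : GC n ⧸ KC n} :
    x ∈ crown n ↔ ∃ (g : G n) (t : Fin n → ℝ), (∀ i, |t i| < Real.pi / 4) ∧
      x = (QuotientGroup.mk (ofReal g * torus t) : GC n ⧸ KC n) := by
  constructor
  · rintro ⟨g, Y, hY, h, hh, rfl⟩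
    obtain ⟨t, ht, htπ⟩ := mem_smul_Omega_iff.1 hY
    refine ⟨g, t, htπ, congrArg _ (Subtype.ext ?_)⟩
    rw [hh, ht, exp_smul_toC_torus]; rfl
  · rintro ⟨g, t, ht, rfl⟩
    have hY : fromBlocks (diagonal t) 0 0 (-(diagonal t)ᵀ) ∈ LieAlgebra.Symplectic.sp (Fin n) ℝ :=
      fromBlocks_mem_sp isSymm_zero isSymm_zero
    rw [diagonal_transpose] at hY
    refine ⟨g, ⟨_, hY⟩, mem_smul_Omega_iff.2 ⟨t, rfl, ht⟩, ofReal g * torus t, ?_, rfl⟩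
    rw [exp_smul_toC_torus]; rfl

theorem mk_ofReal_mul_mem_crown (g : G n) {h : GC n}
    (hh : (QuotientGroup.mk h : GC n ⧸ KC n) ∈ crown n) :
    (QuotientGroup.mk (ofReal g * h) : GC n ⧸ KC n) ∈ crown n := by
  obtain ⟨g', t, ht, h1⟩ := mem_crown_iff.1 hh
  refine mem_crown_iff.2 ⟨g * g', t, ht, ?_⟩
  rw [map_mul, mul_assoc]
  rw [QuotientGroup.eq] at h1 ⊢
  simpa [mul_assoc] using h1

theorem posDef_crownForm_of_mem_crown {h : GC n}
    (hh : (QuotientGroup.mk h : GC n ⧸ KC n) ∈ crown n) : (crownForm h.1).PosDef := by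
  obtain ⟨g, t, ht, h1⟩ := mem_crown_iff.1 hh
  rw [eq_comm, QuotientGroup.eq] at h1
  have h2 : (crownForm (ofReal g * torus t).1).PosDef := by
    change (crownForm ((ofReal g).1 * (torus t).1)).PosDef
    rw [crownForm_ofReal_mul]
    exact posDef_crownForm_torus ht
  have h3 := posDef_crownForm_mul_right h1 h2
  rwa [mul_inv_cancel_left] at h3

/-- The decomposition of `exp(i sin(2t) E₁₂)` in `SL(2)`, applied to the coordinates separately. -/
theorem exists_upper_sin_eq {t : Fin n → ℝ} (ht : ∀ i, |t i| < Real.pi / 4) :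
    ∃ g : G n, ∃ k ∈ KC n,
      upper (isSymm_diagonal fun i => Real.sin (2 * t i)) = ofReal g * torus t * k := by
  have hc : ∀ i, 0 < Real.cos (2 * t i) := fun i => by
    obtain ⟨h1, h2⟩ := abs_lt.1 (ht i)
    exact Real.cos_pos_of_mem_Ioo ⟨by linarith, by linarith⟩
  -- With cosh w = 1 / cos 2t, the real factor exp(-½ log(cosh w) h) exp(-(π/4)U) is, in each
  -- coordinate, the matrix (p, -p; q, q).
  let p : Fin n → ℝ := fun i => √(Real.cos (2 * t i)) / √2
  let q : Fin n → ℝ := fun i => 1 / (√2 * √(Real.cos (2 * t i)))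
  have hpq : ∀ i, p i * q i = 1 / 2 := fun i => by
    have h1 : √(Real.cos (2 * t i)) ≠ 0 := (Real.sqrt_pos.2 (hc i)).ne'
    have h2 : √2 * √2 = (2 : ℝ) := Real.mul_self_sqrt zero_le_two
    simp only [p, q]
    field_simp
    rw [pow_two, h2]
  have hqq : ∀ i, 2 * (q i * q i) * Real.cos (2 * t i) = 1 := fun i => by
    have h1 : √(Real.cos (2 * t i)) * √(Real.cos (2 * t i)) = Real.cos (2 * t i) :=
      Real.mul_self_sqrt (hc i).le
    have h2 : √2 * √2 = (2 : ℝ) := Real.mul_self_sqrt zero_le_two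
    have h3 := (hc i).ne'
    simp only [q]
    rw [div_mul_div_comm, mul_mul_mul_comm, h1, h2]
    field_simp
  let e : Fin n → ℂ := fun i => Complex.exp (t i * Complex.I)
  let e' : Fin n → ℂ := fun i => Complex.exp (-(t i * Complex.I))
  have hee : ∀ i, e i * e' i = 1 := fun i => by simp [e, e', ← Complex.exp_add]
  have hcos : ∀ i, (Real.cos (2 * t i) : ℂ) = (e i * e i + e' i * e' i) / 2 := fun i => by
    simp only [e, e', ← Complex.exp_add]
    push_cast
    rw [Complex.cos, show 2 * (t i : ℂ) * Complex.I = t i * Complex.I + t i * Complex.I by ring,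
      show -(2 * (t i : ℂ)) * Complex.I = -(t i * Complex.I) + -(t i * Complex.I) by ring]
  have hsin : ∀ i, Complex.I * (Real.sin (2 * t i) : ℂ) = (e i * e i - e' i * e' i) / 2 := fun i => by
    simp only [e, e', ← Complex.exp_add]
    push_cast
    rw [Complex.sin, show 2 * (t i : ℂ) * Complex.I = t i * Complex.I + t i * Complex.I by ring,
      show -(2 * (t i : ℂ)) * Complex.I = -(t i * Complex.I) + -(t i * Complex.I) by ring]
    linear_combination (Complex.exp (-(t i * Complex.I) + -(t i * Complex.I)) -
      Complex.exp (t i * Complex.I + t i * Complex.I)) / 2 * Complex.I_mul_I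
  have hpqC : ∀ i, (p i : ℂ) * q i = 1 / 2 := fun i => by
    rw [← Complex.ofReal_mul, hpq]; norm_num
  have hqqC : ∀ i, (q i : ℂ) * q i * (e i * e i + e' i * e' i) = 1 := fun i => by
    have h1 := congrArg Complex.ofReal (hqq i)
    rw [Complex.ofReal_mul, hcos] at h1
    push_cast at h1
    linear_combination h1
  have hg : fromBlocks (diagonal p) (diagonal fun i => -p i) (diagonal q) (diagonal q) ∈
      symplecticGroup (Fin n) ℝ := by
    rw [SymplecticGroup.fromBlocks_mem_iff]
    simp only [diagonal_transpose, diagonal_mul_diagonal, diagonal_sub]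
    refine ⟨by simp [mul_comm], by simp [mul_comm], ?_⟩
    rw [← diagonal_one]
    congr 1; ext i
    linear_combination 2 * hpq i
  -- The second row of the product with the torus element is (q e, q e'), and k must carry it to (0,
  -- 1). For a complex rotation this forces β = q e and α = q e'.
  let α : Fin n → ℂ := fun i => q i * e' i
  let β : Fin n → ℂ := fun i => q i * e i
  have hαβ : ∀ i, α i * α i + β i * β i = 1 := fun i => by
    simp only [α, β]; linear_combination hqqC i
  have hk : diagBlocks α β (-β) α ∈ symplecticGroup (Fin n) ℂ :=
    diagBlocks_mem fun i => by rw [Pi.neg_apply]; linear_combination hαβ i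
  refine ⟨⟨_, hg⟩, ⟨_, hk⟩, mem_KC_of_diagBlocks hαβ rfl, Subtype.ext ?_⟩
  have h1 : (ofReal ⟨_, hg⟩ : GC n).1 = diagBlocks (fun i => (p i : ℂ)) (fun i => -(p i : ℂ))
      (fun i => (q i : ℂ)) (fun i => (q i : ℂ)) := by
    change toC (fromBlocks _ _ _ _) = _
    simp only [toC, diagBlocks, fromBlocks_map]
    congr 1 <;> ext i j <;> rcases eq_or_ne i j with rfl | hij <;> simp_all
  have h2 : (upper (isSymm_diagonal fun i => Real.sin (2 * t i)) : GC n).1 =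
      diagBlocks 1 (fun i => Complex.I * (Real.sin (2 * t i) : ℂ)) 0 1 := by
    simp only [upper, diagBlocks, diagonal_one', diagonal_zero']
    congr 1
    ext i j; rcases eq_or_ne i j with rfl | hij <;> simp_all
  change _ = (ofReal ⟨_, hg⟩ : GC n).1 * diagBlocks e 0 0 e' * diagBlocks α β (-β) α
  rw [h1, h2, diagBlocks_mul, diagBlocks_mul]
  congr 1 <;> ext i <;> simp only [Pi.add_apply, Pi.mul_apply, Pi.neg_apply, Pi.zero_apply,
    Pi.one_apply, α, β, hsin]
  · linear_combination (-(2 * e i * e' i)) * hpqC i - hee i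
  · linear_combination (-(e i * e i - e' i * e' i)) * hpqC i
  · ring
  · linear_combination -hqqC i

end Crown

end Sp

/-! ### The domains Λ⁺ and Λ⁺⁺ for Sp(n) -/

namespace Sp

open Matrix

variable {n : ℕ}

theorem opNorm_diagonal_lt_one_iff (t : Fin n → ℝ) : opNorm (diagonal t) < 1 ↔ ∀ i, |t i| < 1 := by
  simpa using opNorm_conj_diagonal_lt_one_iff (k := 1) (by simp) t

theorem upper_diagonal_mem_crown_iff (t : Fin n → ℝ) :
    (QuotientGroup.mk (upper (isSymm_diagonal t)) : GC n ⧸ KC n) ∈ crown n ↔ ∀ i, |t i| < 1 := by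
  constructor
  · intro h
    have h1 := posDef_crownForm_of_mem_crown h
    refine abs_lt_one_of_posDef_crownForm_upper ?_
    have h2 : (upper (isSymm_diagonal t)).1 = diagBlocks 1 (fun i => Complex.I * t i) 0 1 := by
      simp only [upper, diagBlocks, diagonal_one', diagonal_zero']
      congr 1
      ext i j; rcases eq_or_ne i j with rfl | hij <;> simp_all
    exact h2 ▸ h1
  · intro h
    have ht : ∀ i, |Real.arcsin (t i) / 2| < Real.pi / 4 := fun i => by
      obtain ⟨h1, h2⟩ := abs_lt.1 (h i)
      have h3 := Real.neg_pi_div_two_lt_arcsin.2 h1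
      have h4 := Real.arcsin_lt_pi_div_two.2 h2
      rw [abs_lt]; constructor <;> linarith
    have hs : (fun i => Real.sin (2 * (Real.arcsin (t i) / 2))) = t := funext fun i => by
      obtain ⟨h1, h2⟩ := abs_lt.1 (h i)
      rw [mul_div_cancel₀ _ two_ne_zero, Real.sin_arcsin h1.le h2.le]
    obtain ⟨g, k, hk, h1⟩ := exists_upper_sin_eq ht
    simp only [hs] at h1
    refine mem_crown_iff.2 ⟨g, _, ht, ?_⟩
    rw [h1, eq_comm, QuotientGroup.eq]
    simpa [mul_assoc] using hk

/-- Conjugating by the block matrix K of an orthogonal diagonalizer k of Z reduces to diagonal Z: K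
acts from the left as an element of G and lies in K_ℂ, so it disappears on the right. The operator
norm is unchanged by k. -/
theorem expMem_iff {Y : LieG n} {Z : Matrix (Fin n) (Fin n) ℝ} (hZ : Z.IsSymm)
    (hY : Y.1 = fromBlocks 0 Z 0 0) : ExpMem n Y ↔ opNorm Z < 1 := by
  have h1 : ExpMem n Y ↔ (QuotientGroup.mk (upper hZ) : GC n ⧸ KC n) ∈ crown n := by
    constructor
    · rintro ⟨h, hh, hc⟩
      rw [hY, exp_smul_toC_upper hZ] at hh
      exact Subtype.ext hh ▸ hc
    · intro hc
      exact ⟨upper hZ, by rw [hY, exp_smul_toC_upper hZ], hc⟩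
  obtain ⟨k, t, hk, rfl⟩ := exists_orthogonal_diagonal hZ
  rw [h1, opNorm_conj_diagonal_lt_one_iff hk, ← upper_diagonal_mem_crown_iff]
  have hk' : kᵀ * k = 1 := mul_eq_one_comm.1 hk
  have hu : k ∈ unitary (Matrix (Fin n) (Fin n) ℝ) := by
    rw [Unitary.mem_iff, star_eq_conjTranspose, conjTranspose_eq_transpose_of_trivial]
    exact ⟨hk', hk⟩
  set K : G n := ofOrthogonal ⟨k, hu⟩ with hK
  have hKC : ofReal K ∈ KC n := ofReal_ofOrthogonal_mem_KC _
  have h2 : upper hZ * ofReal K = ofReal K * upper (isSymm_diagonal t) := by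
    refine Subtype.ext ?_
    change fromBlocks 1 _ 0 1 * toC (fromBlocks k 0 0 k) =
      toC (fromBlocks k 0 0 k) * fromBlocks 1 _ 0 1
    have h3 : (k * diagonal t * kᵀ).map Complex.ofReal * k.map Complex.ofReal =
        k.map Complex.ofReal * (diagonal t).map Complex.ofReal := by
      have h4 : k * diagonal t * kᵀ * k = k * diagonal t := by
        rw [Matrix.mul_assoc, hk', Matrix.mul_one]
      have h5 : (k * diagonal t * kᵀ * k).map Complex.ofRealHom =
          (k * diagonal t).map Complex.ofRealHom := by rw [h4]
      rw [Matrix.map_mul (L := k * diagonal t * kᵀ), Matrix.map_mul (M := diagonal t)] at h5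
      exact h5
    simp [toC, fromBlocks_map, fromBlocks_multiply, h3]
  have h3 : (QuotientGroup.mk (upper hZ) : GC n ⧸ KC n) =
      QuotientGroup.mk (ofReal K * upper (isSymm_diagonal t)) := by
    rw [← h2, QuotientGroup.eq]
    simpa using hKC
  rw [h3]
  refine ⟨fun h => ?_, mk_ofReal_mul_mem_crown K⟩
  have h4 := mk_ofReal_mul_mem_crown K⁻¹ h
  rwa [map_inv, inv_mul_cancel_left] at h4

theorem mem_connectedComponentIn_zero {S : Set (LieG n)} {Y : LieG n}
    (h : ∀ s ∈ Icc (0 : ℝ) 1, s • Y ∈ S) : Y ∈ connectedComponentIn S 0 := by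
  have hcont : Continuous fun s : ℝ => s • Y :=
    continuous_induced_rng.2 (continuous_id.smul continuous_const : Continuous fun s : ℝ => s • Y.1)
  have hpre : IsPreconnected ((fun s : ℝ => s • Y) '' Icc 0 1) :=
    isPreconnected_Icc.image _ hcont.continuousOn
  refine hpre.subset_connectedComponentIn ⟨0, by simp, zero_smul ℝ Y⟩ ?_
    ⟨1, by simp, one_smul ℝ Y⟩
  rintro _ ⟨s, hs, rfl⟩
  exact h s hs

theorem opNorm_smul_lt_one {Z : Matrix (Fin n) (Fin n) ℝ} (hZ : opNorm Z < 1) {s : ℝ}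
    (hs : s ∈ Icc (0 : ℝ) 1) : opNorm (s • Z) < 1 := by
  have h1 : opNorm (s • Z) = s * opNorm Z := by
    rw [opNorm, map_smul, norm_smul, Real.norm_of_nonneg hs.1]; rfl
  rw [h1]
  exact (mul_le_of_le_one_left (norm_nonneg _) hs.2).trans_lt hZ

theorem smul_expMem {Y : LieG n} {Z : Matrix (Fin n) (Fin n) ℝ} (hZ : Z.IsSymm)
    (hY : Y.1 = fromBlocks 0 Z 0 0) (h : opNorm Z < 1) {s : ℝ} (hs : s ∈ Icc (0 : ℝ) 1) :
    (s • Z).IsSymm ∧ (s • Y).1 = fromBlocks 0 (s • Z) 0 0 ∧ ExpMem n (s • Y) := by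
  have h1 : (s • Z).IsSymm := hZ.smul s
  have h2 : (s • Y).1 = fromBlocks 0 (s • Z) 0 0 := by
    change s • Y.1 = _
    rw [hY, fromBlocks_smul, smul_zero]
  exact ⟨h1, h2, (expMem_iff h1 h2).2 (opNorm_smul_lt_one h hs)⟩

/-- The condition ‖Z‖ < 1 persists along the segment from 0 to Z, so the whole set lies in the
component of 0. -/
theorem LambdaP_eq : LambdaP n = {X | ∃ Z : Matrix (Fin n) (Fin n) ℝ, Z.IsSymm ∧
    X.1 = fromBlocks 0 Z 0 0 ∧ opNorm Z < 1} := by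
  ext Y
  constructor
  · intro hY
    obtain ⟨⟨Z, hZ, hYZ⟩, h⟩ := connectedComponentIn_subset _ _ hY
    exact ⟨Z, hZ, hYZ, (expMem_iff hZ hYZ).1 h⟩
  · rintro ⟨Z, hZ, hYZ, h⟩
    refine mem_connectedComponentIn_zero fun s hs => ?_
    obtain ⟨h1, h2, h3⟩ := smul_expMem hZ hYZ h hs
    exact ⟨⟨_, h1, h2⟩, h3⟩

/-- Here the component is taken in the larger space 𝔫, but the segment from 0 stays in 𝔫⁺ ⊆ 𝔫, where
membership is already decided. -/
theorem LambdaPP_eq : LambdaPP n = {X | ∃ t : Fin n → ℝ,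
    X.1 = fromBlocks 0 (diagonal t) 0 0 ∧ ∀ i, |t i| < 1} := by
  ext Y
  constructor
  · rintro ⟨hY, t, hYt⟩
    obtain ⟨-, h⟩ := connectedComponentIn_subset _ _ hY
    exact ⟨t, hYt, (opNorm_diagonal_lt_one_iff t).1 ((expMem_iff (isSymm_diagonal t) hYt).1 h)⟩
  · rintro ⟨t, hYt, ht⟩
    refine ⟨mem_connectedComponentIn_zero fun s hs => ?_, t, hYt⟩
    obtain ⟨h1, h2, h3⟩ :=
      smul_expMem (isSymm_diagonal t) hYt ((opNorm_diagonal_lt_one_iff t).2 ht) hs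
    exact ⟨⟨0, _, fun _ _ _ => rfl, h1, by rw [h2]; simp⟩, h3⟩

theorem conj_fromBlocks_upper {k : Matrix (Fin n) (Fin n) ℝ} (hk : k * kᵀ = 1)
    (D : Matrix (Fin n) (Fin n) ℝ) :
    (fromBlocks k 0 0 k * fromBlocks 0 D 0 0 * (fromBlocks k 0 0 k)⁻¹ :
      Matrix (Fin n ⊕ Fin n) (Fin n ⊕ Fin n) ℝ) = fromBlocks 0 (k * D * kᵀ) 0 0 := by
  have h1 : (fromBlocks k 0 0 k * fromBlocks kᵀ 0 0 kᵀ :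
      Matrix (Fin n ⊕ Fin n) (Fin n ⊕ Fin n) ℝ) = 1 := by
    rw [fromBlocks_multiply]; simp [hk]
  rw [inv_eq_right_inv h1, fromBlocks_multiply, fromBlocks_multiply]
  simp

theorem LambdaP_eq_conj_LambdaPP (hn : 1 ≤ n) : LambdaP n =
    {X | ∃ k ∈ specialOrthogonalGroup (Fin n) ℝ, ∃ D ∈ LambdaPP n,
      X.1 = fromBlocks k 0 0 k * D.1 * (fromBlocks k 0 0 k)⁻¹} := by
  rw [LambdaP_eq, LambdaPP_eq]
  ext Y
  constructor
  · rintro ⟨Z, hZ, hYZ, h⟩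
    obtain ⟨k, hk, t, rfl⟩ := exists_specialOrthogonal_diagonal hn hZ
    have hk1 : k * kᵀ = 1 := (mem_orthogonalGroup_iff _ _).1 (mem_specialOrthogonalGroup_iff.1 hk).1
    have hD : fromBlocks 0 (diagonal t) 0 (-0ᵀ) ∈ LieAlgebra.Symplectic.sp (Fin n) ℝ :=
      fromBlocks_mem_sp (isSymm_diagonal t) isSymm_zero
    refine ⟨k, hk, ⟨_, hD⟩, ⟨t, by simp, (opNorm_conj_diagonal_lt_one_iff hk1 t).1 h⟩, ?_⟩
    rw [hYZ, ← conj_fromBlocks_upper hk1]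
    simp
  · rintro ⟨k, hk, D, ⟨t, hD, ht⟩, hY⟩
    have hk1 : k * kᵀ = 1 := (mem_orthogonalGroup_iff _ _).1 (mem_specialOrthogonalGroup_iff.1 hk).1
    refine ⟨k * diagonal t * kᵀ, ?_, ?_, (opNorm_conj_diagonal_lt_one_iff hk1 t).2 ht⟩
    · rw [IsSymm, transpose_mul, transpose_mul, transpose_transpose, diagonal_transpose,
        Matrix.mul_assoc]
    · rw [hY, hD, conj_fromBlocks_upper hk1]

theorem orbitExp_mono {S S' : Set (LieG n)} (h : S ⊆ S') : orbitExp n S ⊆ orbitExp n S' := by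
  rintro _ ⟨g, Y, hY, h1⟩
  exact ⟨g, Y, h hY, h1⟩

theorem LambdaPP_subset_LambdaP : LambdaPP n ⊆ LambdaP n := by
  rw [LambdaP_eq, LambdaPP_eq]
  rintro Y ⟨t, hY, ht⟩
  exact ⟨_, isSymm_diagonal t, hY, (opNorm_diagonal_lt_one_iff t).2 ht⟩

theorem orbitExp_LambdaP_subset_crown : orbitExp n (LambdaP n) ⊆ crown n := by
  rintro _ ⟨g, Y, hY, h, hh, rfl⟩
  obtain ⟨-, e, he, hc⟩ := connectedComponentIn_subset _ _ hY
  have h1 : h = ofReal g * e := Subtype.ext (by rw [hh, ← he]; rfl)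
  rw [h1]
  exact mk_ofReal_mul_mem_crown g hc

theorem crown_subset_orbitExp_LambdaPP : crown n ⊆ orbitExp n (LambdaPP n) := by
  intro x hx
  obtain ⟨g, t, ht, rfl⟩ := mem_crown_iff.1 hx
  obtain ⟨g', k, hk, h1⟩ := exists_upper_sin_eq ht
  have hD : fromBlocks 0 (diagonal fun i => Real.sin (2 * t i)) 0 (-0ᵀ) ∈
      LieAlgebra.Symplectic.sp (Fin n) ℝ := fromBlocks_mem_sp (isSymm_diagonal _) isSymm_zero
  rw [transpose_zero, neg_zero] at hD
  -- From upper = g' · torus · k it follows that g · torus = (g g'⁻¹) · upper · k⁻¹.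
  refine ⟨g * g'⁻¹, ⟨_, hD⟩, ?_,
    ofReal (g * g'⁻¹) * upper (isSymm_diagonal fun i => Real.sin (2 * t i)), ?_, ?_⟩
  · rw [LambdaPP_eq]
    refine ⟨_, rfl, fun i => ?_⟩
    obtain ⟨h2, h3⟩ := abs_lt.1 (ht i)
    have hc : 0 < Real.cos (2 * t i) := Real.cos_pos_of_mem_Ioo ⟨by linarith, by linarith⟩
    rw [← sq_lt_one_iff_abs_lt_one, Real.sin_sq]
    nlinarith
  · rw [exp_smul_toC_upper (isSymm_diagonal fun i => Real.sin (2 * t i))]; rfl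
  · rw [h1, QuotientGroup.eq, map_mul, map_inv]
    simpa [mul_assoc] using hk

theorem crown_eq_orbitExp_LambdaP : crown n = orbitExp n (LambdaP n) :=
  (crown_subset_orbitExp_LambdaPP.trans (orbitExp_mono LambdaPP_subset_LambdaP)).antisymm
    orbitExp_LambdaP_subset_crown

theorem crown_eq_orbitExp_LambdaPP : crown n = orbitExp n (LambdaPP n) :=
  crown_subset_orbitExp_LambdaPP.antisymm
    ((orbitExp_mono LambdaPP_subset_LambdaP).trans orbitExp_LambdaP_subset_crown)

end Sp

end CrownDomain

end

theorem mainTheorem10 :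
    -- the general case: `Σ` of type `C_n` or `BC_n`
    (∀ (E : Type*) [NormedAddCommGroup E] [NormedSpace ℝ E] [FiniteDimensional ℝ E] [CompleteSpace E]
      (G : Type*) [TopologicalSpace G] [ChartedSpace E G] [Group G]
      [LieGroup 𝓘(ℝ, E) ∞ G] [ConnectedSpace G]
      (F : Type*) [NormedAddCommGroup F] [NormedSpace ℂ F] [FiniteDimensional ℂ F]
      (GC : Type*) [TopologicalSpace GC] [ChartedSpace F GC] [Group GC]
      [LieGroup 𝓘(ℂ, F) ∞ GC] [ConnectedSpace GC]
      (ι : G →* GC)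
      (θ : GroupLieAlgebra 𝓘(ℝ, E) G →ₗ⁅ℝ⁆ GroupLieAlgebra 𝓘(ℝ, E) G)
      (𝔞 : Submodule ℝ (GroupLieAlgebra 𝓘(ℝ, E) G))
      (n : ℕ) (γ : Module.Basis (Fin n) ℝ (Module.Dual ℝ 𝔞)) (T : Fin n → 𝔞),
      LieAlgebra.IsSimple ℝ (GroupLieAlgebra 𝓘(ℝ, E) G) →
      CrownDomain.IsComplexification (E := E) (F := F) ι →
      CrownDomain.IsCartanInvolution θ →
      CrownDomain.IsMaximalFlat θ 𝔞 →
      1 ≤ n →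
      (CrownDomain.restrictedRoots 𝔞 = CrownDomain.typeC γ ∨
        CrownDomain.restrictedRoots 𝔞 = CrownDomain.typeBC γ) →
      (∀ i j, γ i (T j) = if i = j then 1 else 0) →
      (∀ (t : Fin n → ℝ) (e : Fin n → GroupLieAlgebra 𝓘(ℝ, E) G),
        ∑ j, t j • (T j : GroupLieAlgebra 𝓘(ℝ, E) G) ∈
          (Real.pi / 2) • CrownDomain.Omega (𝔞 : Set (GroupLieAlgebra 𝓘(ℝ, E) G)) →
        (∀ j, CrownDomain.IsNormalized θ γ T j (e j)) →
        CrownDomain.orbitExp (F := F) ι θ {∑ j, Real.sin (2 * t j) • e j} =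
          CrownDomain.orbitExp (F := F) ι θ
            {∑ j, t j • (T j : GroupLieAlgebra 𝓘(ℝ, E) G)}) ∧
      CrownDomain.crown (F := F) ι θ 𝔞 =
        CrownDomain.orbitExp (F := F) ι θ (CrownDomain.LambdaP θ γ T) ∧
      CrownDomain.crown (F := F) ι θ 𝔞 =
        CrownDomain.orbitExp (F := F) ι θ (CrownDomain.LambdaPP θ γ T)) ∧
    -- the symplectic group
    (∀ n : ℕ, 1 ≤ n →
      CrownDomain.Sp.LambdaP n =
        {X | ∃ Z : Matrix (Fin n) (Fin n) ℝ, Z.IsSymm ∧ X.1 = Matrix.fromBlocks 0 Z 0 0 ∧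
          CrownDomain.Sp.opNorm Z < 1} ∧
      CrownDomain.Sp.LambdaPP n =
        {X | ∃ t : Fin n → ℝ, X.1 = Matrix.fromBlocks 0 (Matrix.diagonal t) 0 0 ∧
          ∀ i, |t i| < 1} ∧
      CrownDomain.Sp.LambdaP n =
        {X | ∃ k ∈ Matrix.specialOrthogonalGroup (Fin n) ℝ, ∃ D ∈ CrownDomain.Sp.LambdaPP n,
          X.1 = Matrix.fromBlocks k 0 0 k * D.1 * (Matrix.fromBlocks k 0 0 k)⁻¹} ∧
      CrownDomain.Sp.crown n = CrownDomain.Sp.orbitExp n (CrownDomain.Sp.LambdaP n) ∧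
      CrownDomain.Sp.crown n = CrownDomain.Sp.orbitExp n (CrownDomain.Sp.LambdaPP n)) := by
  refine ⟨?_, ?_⟩
  · intro E _ _ _ _ G _ _ _ _ _ F _ _ _ GC _ _ _ _ _ ι θ 𝔞 n γ T _ hι hθ h𝔞 _ hR hT
    have : CompleteSpace F := FiniteDimensional.complete ℂ F
    have hPP := CrownDomain.crown_eq_orbitExp_LambdaPP hι hθ h𝔞 hR hT
    refine ⟨fun t e ht he => ?_, ?_, hPP⟩
    · have : FiniteDimensional ℝ (GroupLieAlgebra 𝓘(ℝ, E) G) :=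
        inferInstanceAs (FiniteDimensional ℝ E)
      exact CrownDomain.orbitExp_sum_sin_eq hι hθ h𝔞 hR hT
        ((CrownDomain.sum_mem_smul_Omega_iff hT hθ h𝔞 hR t).1 ht) he
    · rw [hPP, CrownDomain.orbitExp_LambdaP_eq hι]
  · intro n hn
    exact ⟨CrownDomain.Sp.LambdaP_eq, CrownDomain.Sp.LambdaPP_eq,
      CrownDomain.Sp.LambdaP_eq_conj_LambdaPP hn, CrownDomain.Sp.crown_eq_orbitExp_LambdaP,
      CrownDomain.Sp.crown_eq_orbitExp_LambdaPP⟩
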